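/- Let $F$ be a holomorphic (or antiholomorphic) correspondence on the Riemann sphere $\widehat{\mathbb C}$: $F(z)=\{w:(z,w)\in\Gamma\}$, where $\Gamma\subseteq\widehat{\mathbb C}\times\widehat{\mathbb C}$ is the algebraic curve defined by $P(z,w)=0$ (respectively $P(\bar z,w)=0$) for a nonzero polynomial $P$; $F^0$ is the identity and $F^{n}(z)=\bigcup_{y\in F^{n-1}(z)}F(y)$. Branches of $F^n$ are single-valued functions $f$ on open sets, holomorphic (antiholomorphic if $F$ is antiholomorphic and $n$ is odd), with $f(z)\in F^n(z)$. $|Df|$ is the absolute value of the derivative in the spherical metric. *Definitions.* - $\Lambda_+(x)=\bigcap_{n\ge 0}\overline{\bigcup_{k\ge n}F^k(x)}$ is the forward limit set of $x$. $F$ is *invariantly inverse-like* on $S$ if $F(S)\subseteq S$ and each $w\in F(S)$ has exactly one $z\in S$ with $w\in F(z)$. $\mathrm{Sing}_F$ is the set of first coordinates of points $a\in\Gamma$ such that the first projection is not injective on $\Gamma\cap W$ for any neighborhood $W$ of $a$. - A point $z$ is an attracting (repelling) periodic point if some branch $f$ of some $F^q$, $q\ge1$, fixes $z$ and $|Df(z)|<1$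 ($|Df(z)|>1$). It is a parabolic periodic point if some branch $f$ of some $F^q$, $q\geq 1$, defined near $z$, fixes $z$ and some iterate $f^n$, $n\ge1$, is holomorphic near $z$ with $Df^n(z)=1$. $\Omega_+(x)$ is the set of parabolic periodic points in $\Lambda_+(x)$. The orbit of $y$ is $\{w: w\in F^n(y)\text{ or }y\in F^n(w)\text{ for some }n\ge0\}$. - $F$ is *locally $\Omega_+(x)$-attracting* on $\Lambda_+(x)$ if for each $\omega\in\Omega_+(x)$ and each branch $T$ of an $F^q$, $q\ge1$, fixing $\omega$, there is a set $U$, the closure of an open set with finitely many connected components each of which has $\omega$ in its closure, such that $\Lambda_+(x)\cap V=\Lambda_+(x)\cap V\cap U$ for all sufficiently small neighborhoods $V$ of $\omega$, all iterates $T^n$ are defined on $U$, and $T^n(z)\to\omega$ for each $z\in U$. - For $\omega\in\Omega_+(x)$, let $q$ be the least positive integer with $\omega\in F^q(\omega)$ and $T_\omega$ the branch of $F^q$ fixing $\omega$. The integer $p(\omega)\ge1$ is defined by $T_\omega^n(z)=\omega+(z-\omega)+a(z-\omega)^{p(\omega)+1}+\cdots$ for some $n\ge1$ and $a\ne0$ (in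 the coordinate $1/z$ if $\omega=\infty$). - If $x$ has a connected open neighborhood on which, for every $n$, all branches $f_{n,1},\dots,f_{n,M_n}$ of $F^n$ are defined, put $P_s(x)=\sum_{n\ge0}\sum_{j=1}^{M_n}|Df_{n,j}(x)|^s$; otherwise $P_s(x)=+\infty$. The critical exponent is $\delta=\delta_{\mathrm{crit}}(x)=\inf\{s>0:P_s(x)<\infty\}\in[0,\infty]$. - For $s>\delta$ let $\mu_s=\frac1{Z_s}\sum_n\sum_j|Df_{n,j}(x)|^{t_s(n)}\,\delta_{f_{n,j}(x)}$, where $Z_s=\sum_n\sum_j|Df_{n,j}(x)|^{t_s(n)}$. If $P_s(x)\to\infty$ as $s\searrow\delta$, then $t_s(n)=s$. Otherwise $t_s(n)=2\delta-s$ for $n<h(1/(s-\delta))$ and $t_s(n)=s$ for all other $n$, where $h:\mathbb R\to\mathbb R$ is an increasing function growing so quickly that $Z_s\to\infty$ as $s\searrow\delta$. A *limit measure* is any weak$^*$ accumulation point of $\mu_s$ as $s\searrow\delta$ (for any such $h$ in the second case). **Proposition.** Let $F$ be invariantly inverse-like on a closed set $S\subseteq\widehat{\mathbb C}$, let $x\in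 S$, suppose that $\Lambda_+(x)\cap\mathrm{Sing}_F=\emptyset$ and that $F$ is locally $\Omega_+(x)$-attracting on $\Lambda_+(x)$. 1. If $\omega\in\Omega_+(x)$ and $\dfrac{p(\omega)}{p(\omega)+1}<\delta_{\mathrm{crit}}(x)<\infty$, then every limit measure $\mu$ satisfies $\mu(\{\omega\})=0$ and gives zero mass to the orbit of $\omega$. Moreover $\mu(\{y\})=0$ for every attracting or repelling periodic point $y$ of $F$, and $\mu$ gives zero mass to the orbit of every such $y$ lying in $S$. 2. If $\sup_{\omega\in\Omega_+(x)}\dfrac{p(\omega)}{p(\omega)+1}<\delta_{\mathrm{crit}}(x)<\infty$, then every limit measure satisfies $\mu(\Omega_+(x))=0$. -/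

import Mathlib

open Filter Topology MeasureTheory
open scoped ENNReal OnePoint

noncomputable section

/-- The Riemann sphere. -/
abbrev RiemannSphere : Type := OnePoint ℂ

instance : MeasurableSpace RiemannSphere := borel RiemannSphere

instance : BorelSpace RiemannSphere := ⟨rfl⟩

namespace RiemannSphere

/-- Complex conjugation, fixing `∞`. -/
def conj : RiemannSphere → RiemannSphere := OnePoint.map (starRingEnd ℂ)

/-- The chart used around the point `c`: the coordinate `z` if `c` is finite and the coordinate
`1 / z` if `c = ∞`. (The one point outside the chart gets the value `0`.) -/
def chart (c : RiemannSphere) (w : RiemannSphere) : ℂ :=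
  c.elim (w.elim 0 (fun z => z⁻¹)) (fun _ => w.elim 0 id)

open Classical in
/-- The inverse of `chart c`, a parametrization of a neighbourhood of `c` by `ℂ`. -/
def param (c : RiemannSphere) (t : ℂ) : RiemannSphere :=
  c.elim (if t = 0 then ∞ else ((t⁻¹ : ℂ) : RiemannSphere)) (fun _ => (t : RiemannSphere))

/-- The map `f`, read in the charts around `c` and `f c`. -/
def localRep (f : RiemannSphere → RiemannSphere) (c : RiemannSphere) (t : ℂ) : ℂ :=
  chart (f c) (f (param c t))

/-- `f` is holomorphic in a neighbourhood of `c`, as a map into the Riemann sphere. -/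
def IsHolAt (f : RiemannSphere → RiemannSphere) (c : RiemannSphere) : Prop :=
  ContinuousAt f c ∧ AnalyticAt ℂ (localRep f c) (chart c c)

/-- The absolute value `|Df(c)|`, in the spherical metric, of the total (real) derivative of a
holomorphic or antiholomorphic map. The spherical metric is `2 |dt| / (1 + |t|²)` in both the
coordinates `z` and `1 / z`. -/
def sphericalDeriv (f : RiemannSphere → RiemannSphere) (c : RiemannSphere) : ℝ :=
  ‖fderiv ℝ (localRep f c) (chart c c)‖ * (1 + ‖chart c c‖ ^ 2) / (1 + ‖chart (f c) (f c)‖ ^ 2)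

/-- Homogeneous coordinates: `(z : 1)` for finite `z`, and `(1 : 0)` for `∞`. -/
def homCoord (z : RiemannSphere) : ℂ × ℂ := z.elim (1, 0) (fun t => (t, 1))

/-- A pinched neighbourhood of `ω`: the closure of an open set with finitely many connected
components, the closure of each of which contains `ω`. -/
def IsPinchedNhd (U : Set RiemannSphere) (ω : RiemannSphere) : Prop :=
  ∃ O : Set RiemannSphere, IsOpen O ∧ U = closure O ∧
    {C | ∃ z ∈ O, C = connectedComponentIn O z}.Finite ∧
    ∀ z ∈ O, ω ∈ closure (connectedComponentIn O z)

end RiemannSphere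

open RiemannSphere

/-- A holomorphic (`anti = false`) or antiholomorphic (`anti = true`) correspondence on the Riemann
sphere, given by a nonzero polynomial `P` as `P(z, w) = 0`, respectively `P(z̄, w) = 0`. The variable
with index `0` is the first one and the variable with index `1` is the second one. -/
structure Correspondence where
  poly : MvPolynomial (Fin 2) ℂ
  poly_ne_zero : poly ≠ 0
  anti : Bool

namespace Correspondence

/-- The value at homogeneous coordinates `a = (a₁ : a₂)` and `b = (b₁ : b₂)` of the
bihomogenization of `P`. -/
def bihom (P : MvPolynomial (Fin 2) ℂ) (a b : ℂ × ℂ) : ℂ :=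
  ∑ m ∈ P.support, P.coeff m * (a.1 ^ m 0 * a.2 ^ (P.degreeOf 0 - m 0)) *
    (b.1 ^ m 1 * b.2 ^ (P.degreeOf 1 - m 1))

/-- The curve `Γ` in the product of two spheres. -/
def graph (F : Correspondence) : Set (RiemannSphere × RiemannSphere) :=
  {p | bihom F.poly (homCoord (if F.anti then conj p.1 else p.1)) (homCoord p.2) = 0}

/-- The set `F(z)`. -/
def image (F : Correspondence) (z : RiemannSphere) : Set RiemannSphere :=
  {w | (z, w) ∈ F.graph}

/-- The set `Fⁿ(z)`, with `F⁰` the identity. -/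
def iter (F : Correspondence) : ℕ → RiemannSphere → Set RiemannSphere
  | 0, z => {z}
  | n + 1, z => {w | ∃ y ∈ F.iter n z, w ∈ F.image y}

/-- The forward limit set of `x`. -/
def limitSet (F : Correspondence) (x : RiemannSphere) : Set RiemannSphere :=
  ⋂ n : ℕ, closure (⋃ k ≥ n, F.iter k x)

/-- `F` is invariantly inverse-like on `S`: `F(S) ⊆ S`, and each `w ∈ F(S)` has exactly one
preimage in `S`. -/
def InvariantlyInverseLike (F : Correspondence) (S : Set RiemannSphere) : Prop :=
  (∀ z ∈ S, F.image z ⊆ S) ∧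
    ∀ w, (∃ z ∈ S, w ∈ F.image z) → ∃! z, z ∈ S ∧ w ∈ F.image z

/-- The singular points of `F`: first coordinates of the points of `Γ` near which the first
projection is not injective on `Γ`. -/
def singularSet (F : Correspondence) : Set RiemannSphere :=
  {z | ∃ w, (z, w) ∈ F.graph ∧ ∀ W ∈ 𝓝 (z, w), ¬ Set.InjOn Prod.fst (F.graph ∩ W)}

/-- `f` is a branch of `Fⁿ` on the open set `D`: it selects a point of `Fⁿ(z)` for each `z ∈ D`, and it is holomorphic there, or antiholomorphic if `F` is antiholomorphic and `n`
is odd. -/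
def IsBranchOn (F : Correspondence) (n : ℕ) (f : RiemannSphere → RiemannSphere)
    (D : Set RiemannSphere) : Prop :=
  ∀ z ∈ D, f z ∈ F.iter n z ∧ IsHolAt (if F.anti = true ∧ Odd n then conj ∘ f else f) z

/-- `f` is a branch of `Fⁿ` defined in some neighbourhood of `c` and fixing `c`. -/
def IsBranchFixing (F : Correspondence) (n : ℕ) (f : RiemannSphere → RiemannSphere)
    (c : RiemannSphere) : Prop :=
  (∃ D, IsOpen D ∧ c ∈ D ∧ F.IsBranchOn n f D) ∧ f c = c

/-- The set of branches of `Fⁿ` on `U`. A branch matters only on `U`; it is given the value `∞`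
outside `U`, so that different elements of this set are different functions on `U`. -/
def branches (F : Correspondence) (n : ℕ) (U : Set RiemannSphere) :
    Set (RiemannSphere → RiemannSphere) :=
  {f | F.IsBranchOn n f U ∧ ∀ z, z ∉ U → f z = (∞ : RiemannSphere)}

/-- All branches of `Fⁿ` are defined in `U`. -/
def AllBranchesDefined (F : Correspondence) (n : ℕ) (U : Set RiemannSphere) : Prop :=
  (F.branches n U).Finite ∧ ∀ z ∈ U, F.iter n z = {w | ∃ f ∈ F.branches n U, w = f z}

/-- `U` is a connected open neighbourhood of `x` in which all branches of all iterates of `F` are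
defined. -/
def IsBranchDomain (F : Correspondence) (x : RiemannSphere) (U : Set RiemannSphere) : Prop :=
  IsOpen U ∧ IsConnected U ∧ x ∈ U ∧ ∀ n, F.AllBranchesDefined n U

/-- The series `∑ₙ ∑ⱼ |Df_{n,j}(x)| ^ t(n)` over the branches `f_{n,j}` of `Fⁿ` on `U`. -/
def branchSum (F : Correspondence) (x : RiemannSphere) (U : Set RiemannSphere) (t : ℕ → ℝ) :
    ℝ≥0∞ :=
  ∑' n : ℕ, ∑' f : F.branches n U, ENNReal.ofReal (sphericalDeriv f.1 x) ^ t n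

/-- The Poincaré series `P_s(x)`. It does not depend on the branch domain `U`, and it is `∞` if
there is none (the infimum is then over the empty set). -/
def poincare (F : Correspondence) (x : RiemannSphere) (s : ℝ) : ℝ≥0∞ :=
  ⨅ U, ⨅ _ : F.IsBranchDomain x U, F.branchSum x U (fun _ => s)

/-- The critical exponent: the infimum in `[0, ∞]` of all `s > 0` with `P_s(x) < ∞`. -/
def critExp (F : Correspondence) (x : RiemannSphere) : ℝ≥0∞ :=
  ⨅ s : ℝ, ⨅ _ : 0 < s ∧ F.poincare x s < ⊤, ENNReal.ofReal s

/-- The normalized measure `P⁻¹ ∑ₙ ∑ⱼ |Df_{n,j}(x)| ^ t(n) δ_{f_{n,j}(x)}`, where `P` is the sum of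
all the weights. -/
def orbitMeasure (F : Correspondence) (x : RiemannSphere) (U : Set RiemannSphere) (t : ℕ → ℝ) :
    Measure RiemannSphere :=
  (F.branchSum x U t)⁻¹ • Measure.sum fun n : ℕ => Measure.sum fun f : F.branches n U =>
    (ENNReal.ofReal (sphericalDeriv f.1 x) ^ t n) • Measure.dirac (f.1 x)

/-- The exponents in the altered series: `2δ - s` for `n < h(1 / (s - δ))` and `s` otherwise. -/
def alteredExp (δ : ℝ) (h : ℝ → ℝ) (s : ℝ) (n : ℕ) : ℝ :=
  if (n : ℝ) < h (1 / (s - δ)) then 2 * δ - s else s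

/-- The exponents `t s n` with which the measures `μ_s` are formed. If `P_s(x) → ∞` as `s ↘ δ`, these
are the exponents `s` of the Poincaré series. Otherwise they are the altered exponents, for an
increasing function `h` that grows so quickly that the altered series tends to `∞` as `s ↘ δ`. -/
def IsExponentScheme (F : Correspondence) (x : RiemannSphere) (U : Set RiemannSphere)
    (t : ℝ → ℕ → ℝ) : Prop :=
  let δ : ℝ := (F.critExp x).toReal
  (Tendsto (F.poincare x) (𝓝[>] δ) (𝓝 ⊤) ∧ t = fun s _ => s) ∨
  (¬ Tendsto (F.poincare x) (𝓝[>] δ) (𝓝 ⊤) ∧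
    ∃ h : ℝ → ℝ, Monotone h ∧ t = alteredExp δ h ∧
      Tendsto (fun s => F.branchSum x U (t s)) (𝓝[>] δ) (𝓝 ⊤))

/-- `μ` is a limit measure: a weak-* accumulation point, as `s ↘ δ_crit(x)`, of the
measures `μ_s`. -/
def IsLimitMeasure (F : Correspondence) (x : RiemannSphere) (μ : ProbabilityMeasure RiemannSphere) :
    Prop :=
  ∃ (U : Set RiemannSphere) (t : ℝ → ℕ → ℝ) (ν : ℝ → ProbabilityMeasure RiemannSphere),
    F.IsBranchDomain x U ∧ F.IsExponentScheme x U t ∧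
    (∀ᶠ s in 𝓝[>] (F.critExp x).toReal,
      (ν s : Measure RiemannSphere) = F.orbitMeasure x U (t s)) ∧
    MapClusterPt μ (𝓝[>] (F.critExp x).toReal) ν

/-- An attracting periodic point. -/
def IsAttracting (F : Correspondence) (z : RiemannSphere) : Prop :=
  ∃ q ≥ 1, ∃ f, F.IsBranchFixing q f z ∧ sphericalDeriv f z < 1

/-- A repelling periodic point. -/
def IsRepelling (F : Correspondence) (z : RiemannSphere) : Prop :=
  ∃ q ≥ 1, ∃ f, F.IsBranchFixing q f z ∧ 1 < sphericalDeriv f z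

/-- A parabolic periodic point: some branch of some `F^q` fixes `z`, and some iterate of this
branch is holomorphic with derivative `1` at `z`. -/
def IsParabolic (F : Correspondence) (z : RiemannSphere) : Prop :=
  ∃ q ≥ 1, ∃ f, F.IsBranchFixing q f z ∧
    ∃ n ≥ 1, IsHolAt f^[n] z ∧ deriv (localRep f^[n] z) (chart z z) = 1

/-- The set `Ω₊(x)` of the parabolic periodic points in the forward limit set of `x`. -/
def parabolicSet (F : Correspondence) (x : RiemannSphere) : Set RiemannSphere :=
  {ω | ω ∈ F.limitSet x ∧ F.IsParabolic ω}

/-- The minimal `q ≥ 1` with `z ∈ F^q(z)`. -/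
def period (F : Correspondence) (z : RiemannSphere) : ℕ :=
  sInf {q | 1 ≤ q ∧ z ∈ F.iter q z}

/-- `p(ω)`: for the branch `T` of `F^q` fixing `ω`, with `q` the period of `ω`, there are `n ≥ 1` and
`a ≠ 0` with `Tⁿ(z) = ω + (z - ω) + a (z - ω) ^ (p(ω) + 1) + ⋯` in the chart around `ω`. -/
def parabolicExponent (F : Correspondence) (ω : RiemannSphere) : ℕ :=
  sInf {p | 1 ≤ p ∧ ∃ T, F.IsBranchFixing (F.period ω) T ω ∧ ∃ n ≥ 1, IsHolAt T^[n] ω ∧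
    ∃ a : ℂ, a ≠ 0 ∧
      (fun u => localRep T^[n] ω u - (u + a * (u - chart ω ω) ^ (p + 1)))
        =O[𝓝 (chart ω ω)] fun u => (u - chart ω ω) ^ (p + 2)}

/-- The quotient `p(ω) / (p(ω) + 1)`. -/
def parabolicBound (F : Correspondence) (ω : RiemannSphere) : ℝ≥0∞ :=
  (F.parabolicExponent ω : ℝ≥0∞) / ((F.parabolicExponent ω : ℝ≥0∞) + 1)

/-- The supremum of `p(ω) / (p(ω) + 1)` over all `ω ∈ Ω₊(x)`. -/
def parabolicBoundSup (F : Correspondence) (x : RiemannSphere) : ℝ≥0∞ :=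
  ⨆ ω ∈ F.parabolicSet x, F.parabolicBound ω

/-- `F` is locally `Ω₊(x)`-attracting on the forward limit set of `x`. Each branch of an `F^q`
fixing a point `ω ∈ Ω₊(x)`, given as a germ `f` at `ω`, has a representative `T` on a connected open
set `D` all iterates of which are defined on a pinched neighbourhood `U` of `ω`. -/
def LocallyAttracting (F : Correspondence) (x : RiemannSphere) : Prop :=
  ∀ ω ∈ F.parabolicSet x, ∀ q ≥ 1, ∀ f, F.IsBranchFixing q f ω →
    ∃ (T : RiemannSphere → RiemannSphere) (D U : Set RiemannSphere),
      IsOpen D ∧ IsConnected D ∧ ω ∈ D ∧ F.IsBranchOn q T D ∧ T =ᶠ[𝓝 ω] f ∧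
      IsPinchedNhd U ω ∧
      (∃ V₀ ∈ 𝓝 ω, ∀ V ∈ 𝓝 ω, V ⊆ V₀ → F.limitSet x ∩ V = F.limitSet x ∩ V ∩ U) ∧
      ∀ z ∈ U, (∀ n, T^[n] z ∈ D) ∧ Tendsto (fun n => T^[n] z) atTop (𝓝 ω)

/-- The bi-infinite orbit of `y`: all forward and backward images of `y`. -/
def orbit (F : Correspondence) (y : RiemannSphere) : Set RiemannSphere :=
  {w | ∃ n, w ∈ F.iter n y ∨ y ∈ F.iter n w}

end Correspondence

end

open RiemannSphere

noncomputable section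
-- Charts, inversion and topology of the sphere
namespace RiemannSphere

/-! Call a point y negligible (`Small`) if for every ε some neighbourhood of y carries at most the
fraction ε of the total weight of μ_s for all s close to δ. By the portmanteau inequality for open
sets, limit measures have no mass at negligible points. Near a point outside Λ₊(x) only finitely
many branches end, while the total weight tends to ∞; so limit measures live on Λ₊(x).

The heart is `Setting.small_of_contractsAt`. Let a branch Q of F^N fix y ∈ Λ₊(x). Preimages in S are
unique and vary continuously, and off Sing_F values are locally unique. Hence every branch of
F^(m+N) ending near y is Q composed with a branch of F^m (`Setting.exists_factor`). Peel off copies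
of Q until either the value lies outside a fixed chordal ball around y, after j steps, or the level
drops below N, when the remaining branch ends exactly at y. Branches of the second kind have bounded
total weight: if |DQ(y)| < 1 they form geometric series, and otherwise only finitely many have
nonzero derivative, by convergence of a Poincaré series. A branch of the first kind is determined by
j and the branch at the exit, and its derivative is at most β_j times that of the latter. If the
powers of β_j are summable, the branches with j > J weigh at most the tail of a convergent series
times the total weight, and a small neighbourhood of y forces j > J.

The bounds β_j are the content of `ContractsAt`. At an attracting point they are geometric. At a
repelling point no orbit segment enters the ball from outside. For a parabolic germ G(z) = z + a
z^(p+1) + ⋯ the Fatou coordinate -1/(a p z^p) moves to the right by at least 1/2 per step, so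
|G^j(z)|^p = O(1/j), and the estimate |G'(z)| ≤ |G(z)/z|^(p+1) (1 + C|z|^(p+1)) telescopes to a
bound of order j^(-(p+1)/p) (`exists_prod_deriv_le`). Its τ-th powers are summable for τ > p/(p+1),
which is where the lower bound on δ enters.

For orbits, negligibility passes from a point of Λ₊(x) to its images in Λ₊(x)
(`Setting.small_image`). The orbit of a periodic point of S meets S only in forward images, and
countably many of these lie in Λ₊(x). For the whole of Ω₊(x), countability suffices: for each q its
points with ω ∈ F^q(ω) are isolated from each other, since otherwise the second iterate of a branch
would be the identity near ω, against local attraction.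

Local branches off Sing_F have to be built from mere injectivity of the projection. A polynomial
family with at most one root near s₀ keeps the multiplicity m of that root, so the root is a simple
zero of the (m-1)-st derivative and the implicit function theorem applies
(`exists_analyticAt_root`). -/

@[simp] theorem param_coe (c t : ℂ) : param (c : RiemannSphere) t = (t : RiemannSphere) := rfl

theorem param_infty (t : ℂ) :
    param ∞ t = if t = 0 then (∞ : RiemannSphere) else ((t⁻¹ : ℂ) : RiemannSphere) := by
  rfl

@[simp] theorem param_infty_zero : param ∞ 0 = (∞ : RiemannSphere) := by simp [param_infty]

theorem param_infty_of_ne {t : ℂ} (h : t ≠ 0) : param ∞ t = ((t⁻¹ : ℂ) : RiemannSphere) := by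
  simp [param_infty, h]

@[simp] theorem chart_param (c : RiemannSphere) (t : ℂ) : chart c (param c t) = t := by
  induction c using OnePoint.rec with
  | coe c => rfl
  | infty =>
    by_cases h : t = 0
    · subst h; simp [chart]
    · rw [param_infty_of_ne h]; simp [chart]

@[simp] theorem param_chart_self (c : RiemannSphere) : param c (chart c c) = c := by
  induction c using OnePoint.rec with
  | coe c => rfl
  | infty => simp [chart]

theorem param_injective (c : RiemannSphere) : Function.Injective (param c) :=
  Function.LeftInverse.injective (chart_param c)

/-- The involution `1 / z` of the sphere. -/
def invol (w : RiemannSphere) : RiemannSphere :=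
  w.elim ((0 : ℂ) : RiemannSphere) (param ∞)

theorem invol_coe (t : ℂ) : invol (t : RiemannSphere) = param ∞ t := rfl

theorem invol_infty : invol ∞ = ((0 : ℂ) : RiemannSphere) := rfl

theorem invol_invol (w : RiemannSphere) : invol (invol w) = w := by
  induction w using OnePoint.rec with
  | infty => simp [invol_infty, invol_coe]
  | coe t =>
    by_cases h : t = 0
    · subst h; simp [invol_coe, invol_infty]
    · rw [invol_coe, param_infty_of_ne h, invol_coe, param_infty_of_ne (inv_ne_zero h), inv_inv]

theorem coclosedCompact_eq_cobounded : coclosedCompact ℂ = Bornology.cobounded ℂ := by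
  rw [coclosedCompact_eq_cocompact, Metric.cobounded_eq_cocompact]

/-- Inversion carries the finite chart to the chart at `∞`, so this is what makes the latter an open
embedding. -/
theorem continuous_invol : Continuous invol := by
  rw [OnePoint.continuous_iff]
  constructor
  · rw [coclosedCompact_eq_cobounded, invol_infty]
    have h1 : Tendsto (fun t : ℂ => ((t⁻¹ : ℂ) : RiemannSphere)) (Bornology.cobounded ℂ)
        (𝓝 ((0 : ℂ) : RiemannSphere)) :=
      (OnePoint.continuous_coe.tendsto 0).comp tendsto_inv₀_cobounded
    refine h1.congr' ?_
    have : ∀ᶠ t : ℂ in Bornology.cobounded ℂ, t ≠ 0 := by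
      exact Bornology.isBounded_def.1 Bornology.isBounded_singleton
    filter_upwards [this] with t ht
    exact (param_infty_of_ne ht).symm
  · rw [continuous_iff_continuousAt]
    intro t
    by_cases h : t = 0
    · subst h
      rw [continuousAt_iff_punctured_nhds]
      have h1 : Tendsto (fun t : ℂ => ((t⁻¹ : ℂ) : RiemannSphere)) (𝓝[≠] 0)
          (𝓝 (∞ : RiemannSphere)) := by
        have := OnePoint.tendsto_coe_infty (X := ℂ)
        rw [coclosedCompact_eq_cobounded] at this
        exact this.comp tendsto_inv₀_nhdsNE_zero
      have h2 : invol ((0 : ℂ) : RiemannSphere) = (∞ : RiemannSphere) := by simp [invol_coe]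
      rw [h2]
      refine h1.congr' ?_
      filter_upwards [self_mem_nhdsWithin] with t ht
      exact (param_infty_of_ne ht).symm
    · have h1 : ContinuousAt (fun t : ℂ => ((t⁻¹ : ℂ) : RiemannSphere)) t :=
        OnePoint.continuous_coe.continuousAt.comp (continuousAt_inv₀ h)
      refine h1.congr ?_
      filter_upwards [isOpen_ne.mem_nhds h] with s hs
      exact (param_infty_of_ne hs).symm

/-- The involution `1 / z` as a homeomorphism. -/
def involHomeo : RiemannSphere ≃ₜ RiemannSphere where
  toFun := invol
  invFun := invol
  left_inv := invol_invol
  right_inv := invol_invol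
  continuous_toFun := continuous_invol
  continuous_invFun := continuous_invol

theorem isOpenEmbedding_param (c : RiemannSphere) : IsOpenEmbedding (param c) := by
  induction c using OnePoint.rec with
  | coe c => exact OnePoint.isOpenEmbedding_coe
  | infty => exact involHomeo.isOpenEmbedding.comp OnePoint.isOpenEmbedding_coe

theorem continuous_param (c : RiemannSphere) : Continuous (param c) :=
  (isOpenEmbedding_param c).continuous

theorem nhds_param (c : RiemannSphere) (t : ℂ) : 𝓝 (param c t) = map (param c) (𝓝 t) :=
  ((isOpenEmbedding_param c).map_nhds_eq t).symm

theorem nhds_eq_map_param (c : RiemannSphere) : 𝓝 c = map (param c) (𝓝 (chart c c)) := by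
  conv_lhs => rw [← param_chart_self c]
  exact nhds_param c _

theorem eventually_nhds_param {c : RiemannSphere} {t : ℂ} {p : RiemannSphere → Prop} :
    (∀ᶠ u in 𝓝 (param c t), p u) ↔ ∀ᶠ s in 𝓝 t, p (param c s) := by
  rw [nhds_param, eventually_map]

theorem range_param_mem_nhds (c : RiemannSphere) : Set.range (param c) ∈ 𝓝 c := by
  rw [nhds_eq_map_param, mem_map]
  exact univ_mem' fun t => ⟨t, rfl⟩

theorem continuousAt_comp_param {X : Type*} [TopologicalSpace X] {f : RiemannSphere → X}
    {c : RiemannSphere} {t : ℂ} :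
    ContinuousAt f (param c t) ↔ ContinuousAt (fun s => f (param c s)) t := by
  rw [ContinuousAt, nhds_param, tendsto_map'_iff]; rfl

theorem eventually_param_chart (c : RiemannSphere) : ∀ᶠ u in 𝓝 c, param c (chart c u) = u := by
  filter_upwards [range_param_mem_nhds c]
  rintro _ ⟨t, rfl⟩
  rw [chart_param]

/-- Needed twice: to pass from local to global null sets, and to see that discrete subsets are
countable. -/
instance : SecondCountableTopology RiemannSphere := by
  have h : ∀ b : Bool, SecondCountableTopology
      (Set.range (param (if b then ∞ else ((0 : ℂ) : RiemannSphere)))) := fun b =>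
    ((isOpenEmbedding_param _).toIsEmbedding.toHomeomorph).symm.secondCountableTopology
  refine TopologicalSpace.secondCountableTopology_of_countable_cover
    (U := fun b : Bool => Set.range (param (if b then ∞ else ((0 : ℂ) : RiemannSphere))))
    (fun b => (isOpenEmbedding_param _).isOpen_range) ?_
  rw [Set.eq_univ_iff_forall]
  intro w
  rw [Set.mem_iUnion]
  induction w using OnePoint.rec with
  | infty => exact ⟨true, 0, by simp⟩
  | coe t => exact ⟨false, t, by simp⟩

instance (z : RiemannSphere) : NeBot (𝓝[≠] z) := by
  induction z using OnePoint.rec with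
  | infty => infer_instance
  | coe t => infer_instance

/-! ### Conjugation -/

@[simp] theorem conj_conj (z : RiemannSphere) : conj (conj z) = z := by
  induction z using OnePoint.rec with
  | infty => rfl
  | coe t => simp [conj]

theorem conj_param (c : RiemannSphere) (t : ℂ) :
    conj (param c t) = param c (starRingEnd ℂ t) := by
  induction c using OnePoint.rec with
  | coe c => rfl
  | infty =>
    by_cases h : t = 0
    · subst h; simp [conj]
    · rw [param_infty_of_ne h, param_infty_of_ne (by simpa using h)]
      simp [conj]

theorem continuous_conj : Continuous conj := by
  rw [continuous_iff_continuousAt]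
  intro z
  rw [← param_chart_self z, continuousAt_comp_param]
  simp only [conj_param]
  exact ((continuous_param z).comp Complex.continuous_conj).continuousAt

/-! ### The chordal distance -/

/-- The conformal factor of the chordal metric in a chart. -/
def confFactor (t : ℂ) : ℝ := (√(1 + ‖t‖ ^ 2))⁻¹

theorem confFactor_pos (t : ℂ) : 0 < confFactor t := by
  unfold confFactor; positivity

theorem confFactor_sq (t : ℂ) : confFactor t ^ 2 = (1 + ‖t‖ ^ 2)⁻¹ := by
  unfold confFactor
  rw [inv_pow, Real.sq_sqrt (by positivity)]

theorem continuous_confFactor : Continuous confFactor := by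
  unfold confFactor
  refine Continuous.inv₀ (by fun_prop) fun t => ?_
  positivity

/-- The chordal distance. -/
def chord (u v : RiemannSphere) : ℝ :=
  ‖(homCoord u).1 * (homCoord v).2 - (homCoord u).2 * (homCoord v).1‖ *
    ((√(‖(homCoord u).1‖ ^ 2 + ‖(homCoord u).2‖ ^ 2))⁻¹ *
      (√(‖(homCoord v).1‖ ^ 2 + ‖(homCoord v).2‖ ^ 2))⁻¹)

/-- Homogeneous coordinates of `param c t` depending polynomially on `t`. -/
def homParam (c : RiemannSphere) (t : ℂ) : ℂ × ℂ := c.elim (1, t) (fun _ => (t, 1))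

/-- The chordal distance and the vanishing of `bihom` are invariant under rescaling, so both can be
computed with `homParam`, which is polynomial in the chart variable even at `∞`. -/
theorem exists_homCoord_param (c : RiemannSphere) (t : ℂ) :
    ∃ l : ℂ, l ≠ 0 ∧ homParam c t = (l * (homCoord (param c t)).1, l * (homCoord (param c t)).2) := by
  induction c using OnePoint.rec with
  | coe c => exact ⟨1, one_ne_zero, by simp [homCoord, homParam]⟩
  | infty =>
    by_cases h : t = 0
    · subst h; exact ⟨1, one_ne_zero, by simp [homCoord, homParam]⟩
    · refine ⟨t, h, ?_⟩
      rw [param_infty_of_ne h]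
      simp [homCoord, homParam, h]

theorem norm_homParam (c : RiemannSphere) (t : ℂ) :
    ‖(homParam c t).1‖ ^ 2 + ‖(homParam c t).2‖ ^ 2 = 1 + ‖t‖ ^ 2 := by
  induction c using OnePoint.rec <;> simp [homParam, add_comm]

theorem sqrt_norm_mul (l a b : ℂ) :
    √(‖l * a‖ ^ 2 + ‖l * b‖ ^ 2) = ‖l‖ * √(‖a‖ ^ 2 + ‖b‖ ^ 2) := by
  rw [norm_mul, norm_mul, mul_pow, mul_pow, ← mul_add, Real.sqrt_mul (by positivity),
    Real.sqrt_sq (by positivity)]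

theorem chord_param_left (c : RiemannSphere) (t : ℂ) (v : RiemannSphere) :
    chord (param c t) v = ‖(homParam c t).1 * (homCoord v).2 - (homParam c t).2 * (homCoord v).1‖ *
      (confFactor t * (√(‖(homCoord v).1‖ ^ 2 + ‖(homCoord v).2‖ ^ 2))⁻¹) := by
  obtain ⟨l, hl, h⟩ := exists_homCoord_param c t
  have h3 : confFactor t = ‖l‖⁻¹ * (√(‖(homCoord (param c t)).1‖ ^ 2 +
      ‖(homCoord (param c t)).2‖ ^ 2))⁻¹ := by
    unfold confFactor
    rw [← norm_homParam c t, h, sqrt_norm_mul, mul_inv]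
  rw [h3, h, chord, mul_assoc l, mul_assoc l, ← mul_sub, norm_mul]
  have := norm_ne_zero_iff.2 hl
  field_simp

theorem chord_comm (u v : RiemannSphere) : chord u v = chord v u := by
  unfold chord
  rw [← norm_neg]
  congr 1
  · congr 1; ring
  · ring

theorem chord_param (c : RiemannSphere) (s t : ℂ) :
    chord (param c s) (param c t) = ‖s - t‖ * (confFactor s * confFactor t) := by
  obtain ⟨l, hl, h⟩ := exists_homCoord_param c t
  have h3 : confFactor t = ‖l‖⁻¹ * (√(‖(homCoord (param c t)).1‖ ^ 2 +
      ‖(homCoord (param c t)).2‖ ^ 2))⁻¹ := by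
    unfold confFactor
    rw [← norm_homParam c t, h, sqrt_norm_mul, mul_inv]
  -- The determinant of the two coordinate vectors is ±(s - t) in either kind of chart.
  have h4 : ‖s - t‖ = ‖l‖ * ‖(homParam c s).1 * (homCoord (param c t)).2 -
      (homParam c s).2 * (homCoord (param c t)).1‖ := by
    have h5 : (homParam c s).1 * (homParam c t).2 - (homParam c s).2 * (homParam c t).1 =
      l * ((homParam c s).1 * (homCoord (param c t)).2 -
      (homParam c s).2 * (homCoord (param c t)).1) := by rw [h]; ring
    rw [← norm_mul, ← h5]
    induction c using OnePoint.rec with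
    | coe c => simp [homParam]
    | infty => simp [homParam, norm_sub_rev]
  rw [chord_param_left, h4, h3]
  have := norm_ne_zero_iff.2 hl
  field_simp

theorem continuous_homParam (c : RiemannSphere) : Continuous (homParam c) := by
  induction c using OnePoint.rec with
  | coe c => show Continuous fun t : ℂ => ((t, 1) : ℂ × ℂ); fun_prop
  | infty => show Continuous fun t : ℂ => ((1, t) : ℂ × ℂ); fun_prop

theorem continuous_chord_left (v : RiemannSphere) : Continuous fun u => chord u v := by
  rw [continuous_iff_continuousAt]
  intro z
  rw [← param_chart_self z, continuousAt_comp_param]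
  simp only [chord_param_left]
  have := continuous_homParam z
  have := continuous_confFactor
  exact Continuous.continuousAt (by fun_prop)

theorem chord_nonneg (u v : RiemannSphere) : 0 ≤ chord u v := by unfold chord; positivity

theorem chord_eq_zero {u v : RiemannSphere} : chord u v = 0 ↔ u = v := by
  induction u using OnePoint.rec with
  | coe u =>
    induction v using OnePoint.rec with
    | coe v =>
      rw [← param_coe 0 u, ← param_coe 0 v, chord_param]
      simp [sub_eq_zero, (confFactor_pos _).ne']
    | infty => rw [chord_comm]; simp [chord, homCoord]; positivity
  | infty =>
    induction v using OnePoint.rec with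
    | coe v => simp [chord, homCoord]; positivity
    | infty => simp [chord, homCoord]

theorem chord_self (u : RiemannSphere) : chord u u = 0 := chord_eq_zero.2 rfl

theorem chord_pos {u v : RiemannSphere} (h : u ≠ v) : 0 < chord u v :=
  (chord_nonneg u v).lt_of_ne fun h' => h (chord_eq_zero.1 h'.symm)

/-- Chordal balls form a neighbourhood basis. -/
theorem exists_chord_lt_subset {c : RiemannSphere} {V : Set RiemannSphere} (hV : V ∈ 𝓝 c) :
    ∃ r > 0, {u | chord u c < r} ⊆ V := by
  obtain ⟨O, hOV, hO, hc⟩ := mem_nhds_iff.1 hV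
  rcases (Oᶜ).eq_empty_or_nonempty with h | h
  · exact ⟨1, one_pos, fun u _ => hOV (by rw [Set.compl_empty_iff.1 h]; trivial)⟩
  · obtain ⟨v, hv, hmin⟩ := hO.isClosed_compl.isCompact.exists_isMinOn h
      (continuous_chord_left c).continuousOn
    refine ⟨chord v c, chord_pos fun h' => hv (h' ▸ hc), fun u hu => hOV ?_⟩
    by_contra hu'
    exact absurd hu (not_lt.2 (hmin hu') : ¬ chord u c < chord v c)

theorem setOf_chord_lt_mem_nhds (c : RiemannSphere) {r : ℝ} (hr : 0 < r) :
    {u | chord u c < r} ∈ 𝓝 c :=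
  (continuous_chord_left c).continuousAt.eventually_lt_const (by simpa [chord_self] using hr)

/-! ### The spherical derivative as a metric derivative -/

/-- `f` scales chordal distances to `c` by the factor `k`, to first order. -/
def HasScale (f : RiemannSphere → RiemannSphere) (c : RiemannSphere) (k : ℝ) : Prop :=
  ContinuousAt f c ∧
    (fun u => chord (f u) (f c) - k * chord u c) =o[𝓝 c] fun u => chord u c

/-- A metric notion of derivative makes the chain rule free of charts. -/
theorem HasScale.comp {f g : RiemannSphere → RiemannSphere} {c : RiemannSphere} {k l : ℝ}
    (hg : HasScale g (f c) l) (hf : HasScale f c k) : HasScale (g ∘ f) c (l * k) := by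
  refine ⟨ContinuousAt.comp hg.1 hf.1, ?_⟩
  have h1 : (fun u => chord (f u) (f c)) =O[𝓝 c] fun u => chord u c := by
    have h := hf.2.isBigO.add
      ((Asymptotics.isBigO_refl (fun u => chord u c) (𝓝 c)).const_mul_left k)
    simpa using h
  have h2 := (hg.2.comp_tendsto hf.1).trans_isBigO h1
  refine (h2.add (hf.2.const_mul_left l)).congr_left fun u => ?_
  simp only [Function.comp]
  ring

theorem HasScale.congr {f g : RiemannSphere → RiemannSphere} {c : RiemannSphere} {k : ℝ}
    (hf : HasScale f c k) (h : f =ᶠ[𝓝 c] g) : HasScale g c k := by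
  refine ⟨hf.1.congr h, hf.2.congr' ?_ EventuallyEq.rfl⟩
  filter_upwards [h] with u hu
  rw [hu, h.eq_of_nhds]

/-- Two scales would make (l - k) · chord negligible against chord, which is impossible because `c`
is not isolated. Chart independence and the chain rule for `sphericalDeriv` are deduced from this
uniqueness. -/
theorem HasScale.unique {f : RiemannSphere → RiemannSphere} {c : RiemannSphere} {k l : ℝ}
    (hk : HasScale f c k) (hl : HasScale f c l) : k = l := by
  by_contra hne
  have h : (fun u => (l - k) * chord u c) =o[𝓝 c] fun u => chord u c :=
    (hk.2.sub hl.2).congr_left fun u => by ring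
  have h' : (fun u => chord u c) =o[𝓝 c] fun u => chord u c :=
    (Asymptotics.isLittleO_const_mul_left_iff (sub_ne_zero.2 (Ne.symm hne))).1 h
  have h2 := (Asymptotics.isLittleO_irrefl' (l := 𝓝[≠] c) (f' := fun u => chord u c) ?_)
  · exact h2 (h'.mono nhdsWithin_le_nhds)
  · refine Eventually.frequently ?_
    filter_upwards [self_mem_nhdsWithin] with u hu
    rw [Real.norm_of_nonneg (chord_nonneg _ _)]
    exact (chord_pos hu).ne'

/-- The error has two parts: the linearization error of `F`, multiplied by bounded conformal
factors, and the variation of the conformal factor near `t`, multiplied by `‖s - t‖`. -/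
theorem hasScale_of_chart {f : RiemannSphere → RiemannSphere} {c d : RiemannSphere} {t : ℂ}
    {F : ℂ → ℂ} {L : ℂ →L[ℝ] ℂ} {k : ℝ} (hf : ∀ᶠ s in 𝓝 t, f (param c s) = param d (F s))
    (hF : HasFDerivAt F L t) (hL : ∀ v, ‖L v‖ = k * ‖v‖) :
    HasScale f (param c t) (k * (1 + ‖t‖ ^ 2) / (1 + ‖F t‖ ^ 2)) := by
  have hft := hf.self_of_nhds
  constructor
  · rw [continuousAt_comp_param]
    exact ((continuous_param d).continuousAt.comp hF.continuousAt).congr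
      (hf.mono fun s hs => hs.symm)
  · rw [nhds_param, Asymptotics.isLittleO_map]
    have h1 : (fun s => ‖F s - F t‖ - k * ‖s - t‖) =o[𝓝 t] fun s => s - t := by
      have h0 := hasFDerivAt_iff_isLittleO.1 hF
      refine (Asymptotics.IsBigO.of_bound' (g := fun s => F s - F t - L (s - t))
        (Eventually.of_forall fun s => ?_)).trans_isLittleO h0
      rw [← hL]
      exact abs_norm_sub_norm_le _ _
    set m := confFactor
    have h2 : (fun s => m (F s) * m (F t) * (‖F s - F t‖ - k * ‖s - t‖)) =o[𝓝 t]
        fun s => s - t := by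
      have hb : (fun s => m (F s) * m (F t)) =O[𝓝 t] fun _ => (1 : ℝ) := by
        have : ContinuousAt (fun s => m (F s) * m (F t)) t :=
          (continuous_confFactor.continuousAt.comp hF.continuousAt).mul continuousAt_const
        exact this.isBigO_one ℝ
      simpa using hb.mul_isLittleO h1.norm_right
    have hq : k * (1 + ‖t‖ ^ 2) / (1 + ‖F t‖ ^ 2) = k * m (F t) ^ 2 / m t ^ 2 := by
      simp only [m, confFactor_sq]; field_simp
    have h3 : (fun s => (m (F s) * m (F t) * k - k * m (F t) ^ 2 / m t ^ 2 * (m s * m t)) *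
        ‖s - t‖) =o[𝓝 t] fun s => s - t := by
      have hb : (fun s => m (F s) * m (F t) * k - k * m (F t) ^ 2 / m t ^ 2 * (m s * m t)) =o[𝓝 t]
          fun _ => (1 : ℝ) := by
        rw [Asymptotics.isLittleO_one_iff]
        have hc : ContinuousAt (fun s => m (F s) * m (F t) * k -
            k * m (F t) ^ 2 / m t ^ 2 * (m s * m t)) t :=
          (((continuous_confFactor.continuousAt.comp hF.continuousAt).mul
            continuousAt_const).mul continuousAt_const).sub
            (continuousAt_const.mul (continuous_confFactor.continuousAt.mul continuousAt_const))
        have hz : m (F t) * m (F t) * k - k * m (F t) ^ 2 / m t ^ 2 * (m t * m t) = 0 := by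
          have := (confFactor_pos t).ne'
          simp only [m]
          field_simp
          ring
        simpa [ContinuousAt, hz] using hc
      simpa using hb.mul_isBigO (Asymptotics.isBigO_refl (fun s => ‖s - t‖) (𝓝 t))
    have h4 : (fun s => s - t) =O[𝓝 t] fun s => chord (param c s) (param c t) := by
      have hm : Tendsto (fun s => m s * m t) (𝓝 t) (𝓝 (m t * m t)) :=
        (continuous_confFactor.mul continuous_const).continuousAt
      have hpos : 0 < m t * m t := mul_pos (confFactor_pos t) (confFactor_pos t)
      refine Asymptotics.IsBigO.of_bound (m t * m t / 2)⁻¹ ?_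
      filter_upwards [hm.eventually_const_lt (half_lt_self hpos)] with s hs
      rw [chord_param, norm_mul, norm_norm, Real.norm_of_nonneg (le_trans (by positivity) hs.le)]
      rw [inv_mul_eq_div, le_div_iff₀ (by positivity)]
      exact mul_le_mul_of_nonneg_left hs.le (norm_nonneg _)
    refine ((h2.add h3).trans_isBigO h4).congr' ?_ EventuallyEq.rfl
    filter_upwards [hf] with s hs
    simp only [Function.comp]
    rw [hs, hft, chord_param, chord_param, hq]
    simp only [m]
    ring

end RiemannSphere
namespace RiemannSphere

/-! ### Holomorphic and antiholomorphic germs -/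

/-- Complex conjugation if `b`, and the identity otherwise. -/
def cconj (b : Bool) (z : ℂ) : ℂ := if b then starRingEnd ℂ z else z

/-- Conjugation of the sphere if `b`, and the identity otherwise. -/
def sconj (b : Bool) (z : RiemannSphere) : RiemannSphere := if b then conj z else z

@[simp] theorem cconj_cconj (b : Bool) (z : ℂ) : cconj b (cconj b z) = z := by
  cases b <;> simp [cconj]

@[simp] theorem sconj_sconj (b : Bool) (z : RiemannSphere) : sconj b (sconj b z) = z := by
  cases b <;> simp [sconj]

theorem continuous_cconj (b : Bool) : Continuous (cconj b) := by
  cases b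
  · exact continuous_id
  · exact Complex.continuous_conj

theorem continuous_sconj (b : Bool) : Continuous (sconj b) := by
  cases b
  · exact continuous_id
  · exact continuous_conj

theorem sconj_param (b : Bool) (c : RiemannSphere) (t : ℂ) :
    sconj b (param c t) = param c (cconj b t) := by
  cases b
  · rfl
  · exact conj_param c t

theorem analyticAt_conj_conj {F : ℂ → ℂ} {t : ℂ} (hF : AnalyticAt ℂ F (starRingEnd ℂ t)) :
    AnalyticAt ℂ (fun s => starRingEnd ℂ (F (starRingEnd ℂ s))) t := by
  rw [Complex.analyticAt_iff_eventually_differentiableAt] at hF ⊢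
  filter_upwards [Complex.continuous_conj.continuousAt.eventually hF] with s hs
  have := hs.conj_conj
  simpa [Function.comp_def] using this

/-- `F` is analytic (`b = false`) or antianalytic (`b = true`) at `t`. -/
def AnAt (b : Bool) (F : ℂ → ℂ) (t : ℂ) : Prop := AnalyticAt ℂ (fun s => cconj b (F s)) t

theorem AnAt.comp {b b' : Bool} {F G : ℂ → ℂ} {t : ℂ} (hG : AnAt b' G (F t)) (hF : AnAt b F t) :
    AnAt (xor b b') (fun s => G (F s)) t := by
  cases b
  · have hF' : AnalyticAt ℂ F t := hF
    cases b'
    · exact AnalyticAt.fun_comp (f := F) (g := G) hG hF'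
    · exact AnalyticAt.fun_comp (f := F) (g := fun s => starRingEnd ℂ (G s)) hG hF'
  · have hF' : AnalyticAt ℂ (fun s => starRingEnd ℂ (F s)) t := hF
    cases b'
    · have hG' : AnalyticAt ℂ G (starRingEnd ℂ (starRingEnd ℂ (F t))) := by
        rw [Complex.conj_conj]; exact hG
      have h := AnalyticAt.fun_comp (f := fun s => starRingEnd ℂ (F s)) (analyticAt_conj_conj hG') hF'
      simpa [AnAt, cconj] using h
    · have hG' : AnalyticAt ℂ (fun s => starRingEnd ℂ (G s))
          (starRingEnd ℂ (starRingEnd ℂ (F t))) := by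
        rw [Complex.conj_conj]; exact hG
      have h := AnalyticAt.fun_comp (f := fun s => starRingEnd ℂ (F s)) (analyticAt_conj_conj hG') hF'
      simpa [AnAt, cconj] using h

theorem AnAt.eventually {b : Bool} {F : ℂ → ℂ} {t : ℂ} (hF : AnAt b F t) :
    ∀ᶠ s in 𝓝 t, AnAt b F s := AnalyticAt.eventually_analyticAt hF

theorem AnAt.continuousAt {b : Bool} {F : ℂ → ℂ} {t : ℂ} (hF : AnAt b F t) : ContinuousAt F t := by
  have h := (continuous_cconj b).continuousAt.comp (AnalyticAt.continuousAt hF)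
  simpa [Function.comp_def] using h

theorem AnAt.hasFDerivAt {b : Bool} {F : ℂ → ℂ} {t : ℂ} (hF : AnAt b F t) :
    ∃ L : ℂ →L[ℝ] ℂ, HasFDerivAt F L t ∧
      ∀ v, ‖L v‖ = ‖deriv (fun s => cconj b (F s)) t‖ * ‖v‖ := by
  have h1 : HasFDerivAt (fun s => cconj b (F s)) _ t :=
    (AnalyticAt.differentiableAt hF).hasDerivAt.hasFDerivAt.restrictScalars ℝ
  cases b
  · refine ⟨_, h1, fun v => ?_⟩
    simp [mul_comm]
  · refine ⟨_, by simpa [cconj, Function.comp_def] using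
      Complex.conjCLE.toContinuousLinearMap.hasFDerivAt.comp t h1, fun v => ?_⟩
    simp [mul_comm, cconj]

/-- `f` is holomorphic (`b = false`) or antiholomorphic (`b = true`) at `z`. -/
def IsConf (b : Bool) (f : RiemannSphere → RiemannSphere) (z : RiemannSphere) : Prop :=
  ∃ (c d : RiemannSphere) (t : ℂ) (F : ℂ → ℂ), z = param c t ∧ AnAt b F t ∧
    ∀ᶠ s in 𝓝 t, f (param c s) = param d (F s)

theorem exists_transition {c c' : RiemannSphere} {t t' : ℂ} (h : param c t = param c' t') :
    ∃ τ : ℂ → ℂ, AnalyticAt ℂ τ t ∧ τ t = t' ∧ ∀ᶠ s in 𝓝 t, param c s = param c' (τ s) := by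
  have key : ∀ t t' : ℂ, param ((0 : ℂ) : RiemannSphere) t = param ∞ t' → t ≠ 0 ∧ t⁻¹ = t' := by
    intro t t' h
    by_cases ht' : t' = 0
    · subst ht'; simp at h
    · rw [param_infty_of_ne ht', param_coe, OnePoint.coe_eq_coe] at h
      subst h
      exact ⟨inv_ne_zero ht', inv_inv t'⟩
  have hinv : ∀ s : ℂ, s ≠ 0 → param ∞ s⁻¹ = (s : RiemannSphere) := fun s hs => by
    rw [param_infty_of_ne (inv_ne_zero hs), inv_inv]
  induction c using OnePoint.rec with
  | coe c =>
    induction c' using OnePoint.rec with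
    | coe c' => exact ⟨id, analyticAt_id, param_injective c h, Eventually.of_forall fun s => rfl⟩
    | infty =>
      obtain ⟨h1, h2⟩ := key t t' h
      refine ⟨fun s => s⁻¹, analyticAt_id.inv h1, h2, ?_⟩
      filter_upwards [isOpen_ne.mem_nhds h1] with s hs
      exact (hinv s hs).symm
  | infty =>
    induction c' using OnePoint.rec with
    | coe c' =>
      obtain ⟨h1, h2⟩ := key t' t h.symm
      have h3 : t ≠ 0 := h2 ▸ inv_ne_zero h1
      refine ⟨fun s => s⁻¹, analyticAt_id.inv h3, by simp [← h2], ?_⟩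
      filter_upwards [isOpen_ne.mem_nhds h3] with s hs
      exact param_infty_of_ne hs
    | infty => exact ⟨id, analyticAt_id, param_injective _ h, Eventually.of_forall fun s => rfl⟩

/-- `IsConf` asks for some pair of charts; composing with the transition maps provides a
representative in any prescribed pair. -/
theorem IsConf.exists_rep {b : Bool} {f : RiemannSphere → RiemannSphere} {c d : RiemannSphere}
    {t t' : ℂ}
    (hf : IsConf b f (param c t)) (h : f (param c t) = param d t') :
    ∃ F : ℂ → ℂ, AnAt b F t ∧ F t = t' ∧ ∀ᶠ s in 𝓝 t, f (param c s) = param d (F s) := by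
  obtain ⟨c₁, d₁, t₁, F₁, hz, hF₁, hfF⟩ := hf
  obtain ⟨τ, hτ, hτt, hτe⟩ := exists_transition hz
  have hd : param d₁ (F₁ t₁) = param d t' := by rw [← hfF.self_of_nhds, ← hz, h]
  obtain ⟨σ, hσ, hσt, hσe⟩ := exists_transition hd
  have h1 : AnAt b (fun s => F₁ (τ s)) t := by
    have := AnAt.comp (b := false) (b' := b) (G := F₁) (F := τ) (hτt ▸ hF₁) hτ
    simpa using this
  have h2 : AnAt b (fun s => σ (F₁ (τ s))) t := by
    have := AnAt.comp (b := b) (b' := false) (G := σ) (F := fun s => F₁ (τ s))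
      (by simp only [hτt]; exact hσ) h1
    simpa using this
  refine ⟨_, h2, by simp only [hτt, hσt], ?_⟩
  have hc1 : Tendsto τ (𝓝 t) (𝓝 t₁) := hτt ▸ hτ.continuousAt
  have hc2 : Tendsto F₁ (𝓝 t₁) (𝓝 (F₁ t₁)) := hF₁.continuousAt
  filter_upwards [hτe, hc1.eventually hfF, (hc2.comp hc1).eventually hσe] with s hs1 hs2 hs3
  rw [hs1, hs2]
  exact hs3

theorem IsConf.self_rep {b : Bool} {f : RiemannSphere → RiemannSphere} {z : RiemannSphere}
    (hf : IsConf b f z) : AnAt b (localRep f z) (chart z z) ∧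
      ∀ᶠ s in 𝓝 (chart z z), f (param z s) = param (f z) (localRep f z s) := by
  have hf' : IsConf b f (param z (chart z z)) := by rwa [param_chart_self]
  obtain ⟨F, hF, hFt, hFe⟩ := hf'.exists_rep (d := f z) (t' := chart (f z) (f z))
    (by rw [param_chart_self, param_chart_self])
  have h : F =ᶠ[𝓝 (chart z z)] localRep f z := by
    filter_upwards [hFe] with s hs
    rw [localRep, hs, chart_param]
  refine ⟨AnalyticAt.congr hF (h.mono fun s hs => congrArg (cconj b) hs), ?_⟩
  filter_upwards [hFe, h] with s hs hs'
  rw [hs, hs']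

theorem isConf_of_chart {b : Bool} {f : RiemannSphere → RiemannSphere} {c d : RiemannSphere}
    {t : ℂ} {F : ℂ → ℂ} (hF : AnAt b F t) (h : ∀ᶠ s in 𝓝 t, f (param c s) = param d (F s)) :
    IsConf b f (param c t) := ⟨c, d, t, F, rfl, hF, h⟩

theorem isConf_iff {b : Bool} {f : RiemannSphere → RiemannSphere} {z : RiemannSphere} :
    IsConf b f z ↔ IsHolAt (if b = true then conj ∘ f else f) z := by
  have key : ∀ g : RiemannSphere → RiemannSphere, IsConf false g z ↔ IsHolAt g z := by
    intro g
    constructor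
    · intro h
      refine ⟨?_, h.self_rep.1⟩
      obtain ⟨h1, h2⟩ := h.self_rep
      rw [← param_chart_self z, continuousAt_comp_param]
      exact ((continuous_param _).continuousAt.comp h1.continuousAt).congr
        (h2.mono fun s hs => hs.symm)
    · rintro ⟨h1, h2⟩
      refine ⟨z, g z, chart z z, localRep g z, (param_chart_self z).symm, h2, ?_⟩
      have h3 := h1.eventually (eventually_param_chart (g z))
      rw [nhds_eq_map_param z, eventually_map] at h3
      filter_upwards [h3] with s hs
      exact hs.symm
  cases b
  · simpa using key f
  · rw [if_pos rfl, ← key]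
    constructor
    · rintro ⟨c, d, t, F, hz, hF, h⟩
      exact ⟨c, d, t, fun s => starRingEnd ℂ (F s), hz, hF,
        h.mono fun s hs => by rw [Function.comp, hs, conj_param]⟩
    · rintro ⟨c, d, t, F, hz, hF, h⟩
      refine ⟨c, d, t, fun s => starRingEnd ℂ (F s), hz, ?_, h.mono fun s hs => ?_⟩
      · simpa [AnAt, cconj] using hF
      · rw [← conj_param, ← hs, Function.comp, conj_conj]

theorem IsConf.continuousAt {b : Bool} {f : RiemannSphere → RiemannSphere} {z : RiemannSphere}
    (h : IsConf b f z) : ContinuousAt f z := by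
  obtain ⟨c, d, t, F, rfl, hF, h⟩ := h
  rw [continuousAt_comp_param]
  exact ((continuous_param d).continuousAt.comp hF.continuousAt).congr (h.mono fun s hs => hs.symm)

theorem IsConf.congr {b : Bool} {f g : RiemannSphere → RiemannSphere} {z : RiemannSphere}
    (hf : IsConf b f z) (h : f =ᶠ[𝓝 z] g) : IsConf b g z := by
  obtain ⟨c, d, t, F, rfl, hF, hfF⟩ := hf
  refine ⟨c, d, t, F, rfl, hF, ?_⟩
  filter_upwards [hfF, eventually_nhds_param.1 h] with s hs hs'
  rw [← hs', hs]

theorem IsConf.eventually {b : Bool} {f : RiemannSphere → RiemannSphere} {z : RiemannSphere}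
    (hf : IsConf b f z) : ∀ᶠ u in 𝓝 z, IsConf b f u := by
  obtain ⟨c, d, t, F, rfl, hF, hfF⟩ := hf
  rw [eventually_nhds_param]
  filter_upwards [hF.eventually, hfF.eventually_nhds] with s hs hs'
  exact ⟨c, d, s, F, rfl, hs, hs'⟩

theorem isConf_id (z : RiemannSphere) : IsConf false id z :=
  ⟨z, z, chart z z, id, (param_chart_self z).symm, analyticAt_id, Eventually.of_forall fun _ => rfl⟩

theorem IsConf.comp {b b' : Bool} {f g : RiemannSphere → RiemannSphere} {z : RiemannSphere}
    (hg : IsConf b' g (f z)) (hf : IsConf b f z) : IsConf (xor b b') (g ∘ f) z := by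
  obtain ⟨c, d, t, F, rfl, hF, hfF⟩ := hf
  have hft := hfF.self_of_nhds
  rw [hft] at hg
  obtain ⟨G, hG, -, hgG⟩ := hg.exists_rep (d := g (param d (F t)))
    (t' := chart (g (param d (F t))) (g (param d (F t))))
    (param_chart_self _).symm
  refine isConf_of_chart (d := g (param d (F t))) (hG.comp hF) ?_
  filter_upwards [hfF, hF.continuousAt.eventually hgG] with s hs hs'
  rw [Function.comp, hs, hs']

/-- The identity theorem for germs. -/
theorem IsConf.eventuallyEq_of_frequently {b : Bool} {f g : RiemannSphere → RiemannSphere}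
    {z : RiemannSphere} (hf : IsConf b f z) (hg : IsConf b g z)
    (h : ∃ᶠ u in 𝓝[≠] z, f u = g u) : f =ᶠ[𝓝 z] g := by
  have hz : f z = g z := by
    refine isClosed_diagonal.mem_of_frequently_of_tendsto (s := Set.diagonal RiemannSphere) h
      ((hf.continuousAt.prodMk hg.continuousAt).tendsto.mono_left nhdsWithin_le_nhds)
  obtain ⟨c, d, t, F, rfl, hF, hfF⟩ := hf
  obtain ⟨G, hG, -, hgG⟩ := hg.exists_rep (d := d) (t' := F t) (by rw [← hz, hfF.self_of_nhds])
  have h1 : ∃ᶠ s in 𝓝[≠] t, cconj b (F s) = cconj b (G s) := by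
    have hmap : 𝓝[≠] (param c t) = map (param c) (𝓝[≠] t) := by
      have := (isOpenEmbedding_param c).map_nhdsWithin_preimage_eq {param c t}ᶜ t
      rw [← this]
      congr 1
      congr 1
      ext s
      simp [(param_injective c).eq_iff]
    rw [hmap, frequently_map] at h
    refine (h.and_eventually ((hfF.and hgG).filter_mono nhdsWithin_le_nhds)).mono ?_
    rintro s ⟨h1, h2, h3⟩
    rw [h2, h3] at h1
    rw [param_injective d h1]
  have h2 := (AnalyticAt.frequently_eq_iff_eventually_eq hF hG).1 h1
  rw [EventuallyEq, eventually_nhds_param]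
  filter_upwards [h2, hfF, hgG] with s hs h3 h4
  have := congrArg (cconj b) hs
  rw [cconj_cconj, cconj_cconj] at this
  rw [h3, h4, this]

/-- The identity theorem on connected sets. -/
theorem eqOn_of_eventuallyEq {b : Bool} {f g : RiemannSphere → RiemannSphere}
    {U : Set RiemannSphere} (hU : IsPreconnected U)
    (hf : ∀ z ∈ U, IsConf b f z) (hg : ∀ z ∈ U, IsConf b g z) {x : RiemannSphere} (hx : x ∈ U)
    (h : f =ᶠ[𝓝 x] g) : Set.EqOn f g U := by
  have h1 : U ⊆ {z | f =ᶠ[𝓝 z] g} := by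
    -- The set where the germs agree is open; the identity theorem for germs shows that it is closed
    -- in `U`.
    refine hU.subset_of_closure_inter_subset (isOpen_setOfPred_eventually_nhds) ⟨x, hx, h⟩ ?_
    rintro z ⟨hz, hzU⟩
    refine (hf z hzU).eventuallyEq_of_frequently (hg z hzU) ?_
    have h2 : ∃ᶠ u in 𝓝 z, f =ᶠ[𝓝 u] g := mem_closure_iff_frequently.1 hz
    rw [frequently_iff]
    intro V hV
    rw [mem_nhdsWithin] at hV
    obtain ⟨O, hO, hzO, hOV⟩ := hV
    obtain ⟨u, hu, huO⟩ := (h2.and_eventually (hO.mem_nhds hzO)).exists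
    have h3 : ∀ᶠ v in 𝓝[≠] u, f v = g v ∧ v ∈ O :=
      (hu.and (hO.mem_nhds huO)).filter_mono nhdsWithin_le_nhds
    by_cases huz : u = z
    · subst huz
      obtain ⟨v, ⟨h4, h5⟩, h6⟩ := (h3.and self_mem_nhdsWithin).exists
      exact ⟨v, hOV ⟨h5, h6⟩, h4⟩
    · exact ⟨u, hOV ⟨huO, huz⟩, hu.self_of_nhds⟩
  exact fun z hz => (h1 hz).self_of_nhds

/-! ### Spherical derivatives of germs: chart independence, chain rule, continuity -/

theorem hasScale_of_anAt {b : Bool} {f : RiemannSphere → RiemannSphere} {c d : RiemannSphere}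
    {t : ℂ} {F : ℂ → ℂ} (hF : AnAt b F t) (h : ∀ᶠ s in 𝓝 t, f (param c s) = param d (F s)) :
    HasScale f (param c t)
      (‖deriv (fun s => cconj b (F s)) t‖ * (1 + ‖t‖ ^ 2) / (1 + ‖F t‖ ^ 2)) := by
  obtain ⟨L, hL, hLv⟩ := hF.hasFDerivAt
  exact hasScale_of_chart h hL hLv

theorem IsConf.hasScale {b : Bool} {f : RiemannSphere → RiemannSphere} {z : RiemannSphere}
    (hf : IsConf b f z) : HasScale f z (sphericalDeriv f z) := by
  obtain ⟨h1, h2⟩ := hf.self_rep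
  obtain ⟨L, hL, hLv⟩ := h1.hasFDerivAt
  have h3 := hasScale_of_chart h2 hL hLv
  rw [param_chart_self] at h3
  have h4 : ‖fderiv ℝ (localRep f z) (chart z z)‖ =
      ‖deriv (fun s => cconj b (localRep f z s)) (chart z z)‖ := by
    rw [hL.fderiv]
    refine ContinuousLinearMap.opNorm_eq_of_bounds (norm_nonneg _) (fun v => (hLv v).le) ?_
    intro N hN hb
    have := hb 1
    rw [hLv] at this
    simpa using this
  have h5 : localRep f z (chart z z) = chart (f z) (f z) := by
    rw [localRep, param_chart_self]
  rw [sphericalDeriv, h4, ← h5]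
  exact h3

theorem sphericalDeriv_eq {b : Bool} {f : RiemannSphere → RiemannSphere} {c d : RiemannSphere}
    {t : ℂ} {F : ℂ → ℂ} (hF : AnAt b F t) (h : ∀ᶠ s in 𝓝 t, f (param c s) = param d (F s)) :
    sphericalDeriv f (param c t) =
      ‖deriv (fun s => cconj b (F s)) t‖ * (1 + ‖t‖ ^ 2) / (1 + ‖F t‖ ^ 2) :=
  (isConf_of_chart hF h).hasScale.unique (hasScale_of_anAt hF h)

theorem IsConf.sphericalDeriv_comp {b b' : Bool} {f g : RiemannSphere → RiemannSphere}
    {z : RiemannSphere} (hg : IsConf b' g (f z)) (hf : IsConf b f z) :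
    sphericalDeriv (g ∘ f) z = sphericalDeriv g (f z) * sphericalDeriv f z :=
  (hg.comp hf).hasScale.unique (hg.hasScale.comp hf.hasScale)

theorem IsConf.sphericalDeriv_congr {b : Bool} {f g : RiemannSphere → RiemannSphere}
    {z : RiemannSphere} (hf : IsConf b f z) (h : f =ᶠ[𝓝 z] g) :
    sphericalDeriv f z = sphericalDeriv g z :=
  (hf.hasScale.congr h).unique (hf.congr h).hasScale

theorem IsConf.continuousAt_sphericalDeriv {b : Bool} {f : RiemannSphere → RiemannSphere}
    {z : RiemannSphere} (hf : IsConf b f z) : ContinuousAt (sphericalDeriv f) z := by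
  obtain ⟨c, d, t, F, rfl, hF, h⟩ := hf
  rw [continuousAt_comp_param]
  have h1 : ContinuousAt (fun s => ‖deriv (fun s => cconj b (F s)) s‖ * (1 + ‖s‖ ^ 2) /
      (1 + ‖F s‖ ^ 2)) t := by
    have h2 : ContinuousAt (deriv (fun s => cconj b (F s))) t :=
      (AnalyticAt.deriv hF).continuousAt
    have h3 := hF.continuousAt
    refine ContinuousAt.div (by fun_prop) (by fun_prop) (by positivity)
  refine h1.congr ?_
  filter_upwards [hF.eventually, h.eventually_nhds] with s hs hs'
  exact (sphericalDeriv_eq hs hs').symm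

theorem sphericalDeriv_nonneg (f : RiemannSphere → RiemannSphere) (z : RiemannSphere) :
    0 ≤ sphericalDeriv f z := by unfold sphericalDeriv; positivity

end RiemannSphere
namespace Correspondence

/-! ### The curve and its iterates -/

theorem bihom_mul_left (P : MvPolynomial (Fin 2) ℂ) (l : ℂ) (a b : ℂ × ℂ) :
    bihom P (l * a.1, l * a.2) b = l ^ P.degreeOf 0 * bihom P a b := by
  unfold bihom
  rw [Finset.mul_sum]
  refine Finset.sum_congr rfl fun m hm => ?_
  have h : m 0 + (P.degreeOf 0 - m 0) = P.degreeOf 0 :=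
    Nat.add_sub_cancel' (MvPolynomial.monomial_le_degreeOf 0 hm)
  rw [mul_pow, mul_pow, ← h, pow_add]
  simp only [Nat.add_sub_cancel_left]
  ring

theorem bihom_mul_right (P : MvPolynomial (Fin 2) ℂ) (l : ℂ) (a b : ℂ × ℂ) :
    bihom P a (l * b.1, l * b.2) = l ^ P.degreeOf 1 * bihom P a b := by
  unfold bihom
  rw [Finset.mul_sum]
  refine Finset.sum_congr rfl fun m hm => ?_
  have h : m 1 + (P.degreeOf 1 - m 1) = P.degreeOf 1 :=
    Nat.add_sub_cancel' (MvPolynomial.monomial_le_degreeOf 1 hm)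
  rw [mul_pow, mul_pow, ← h, pow_add]
  simp only [Nat.add_sub_cancel_left]
  ring

theorem bihom_param_eq_zero_iff (P : MvPolynomial (Fin 2) ℂ) (c d : RiemannSphere) (t s : ℂ) :
    bihom P (homCoord (param c t)) (homCoord (param d s)) = 0 ↔
      bihom P (homParam c t) (homParam d s) = 0 := by
  obtain ⟨l, hl, h⟩ := exists_homCoord_param c t
  obtain ⟨k, hk, h'⟩ := exists_homCoord_param d s
  rw [h, h', bihom_mul_left, bihom_mul_right]
  simp [hl, hk]

theorem mem_graph_iff (F : Correspondence) (c d : RiemannSphere) (t s : ℂ) :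
    (sconj F.anti (param c t), param d s) ∈ F.graph ↔
      bihom F.poly (homParam c t) (homParam d s) = 0 := by
  rw [← bihom_param_eq_zero_iff]
  show bihom F.poly (homCoord (sconj F.anti (sconj F.anti (param c t)))) _ = 0 ↔ _
  rw [sconj_sconj]

theorem continuous_bihom (P : MvPolynomial (Fin 2) ℂ) :
    Continuous fun q : (ℂ × ℂ) × (ℂ × ℂ) => bihom P q.1 q.2 := by
  unfold bihom
  fun_prop

theorem continuous_bihom_param (P : MvPolynomial (Fin 2) ℂ) (c d : RiemannSphere) :
    Continuous fun q : ℂ × ℂ => bihom P (homParam c q.1) (homParam d q.2) := by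
  have h1 := continuous_homParam c
  have h2 := continuous_homParam d
  have h : Continuous fun q : ℂ × ℂ => (homParam c q.1, homParam d q.2) := by fun_prop
  have h3 := (continuous_bihom P).comp h
  rw [Function.comp_def] at h3
  exact h3

theorem isClosed_graph (F : Correspondence) : IsClosed F.graph := by
  have h : IsClosed {p : RiemannSphere × RiemannSphere |
      bihom F.poly (homCoord p.1) (homCoord p.2) = 0} := by
    rw [← isOpen_compl_iff, isOpen_iff_mem_nhds]
    rintro ⟨z, w⟩ hzw
    obtain ⟨c, t, rfl⟩ : ∃ c t, z = param c t := ⟨z, _, (param_chart_self z).symm⟩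
    obtain ⟨d, s, rfl⟩ : ∃ d s, w = param d s := ⟨w, _, (param_chart_self w).symm⟩
    rw [nhds_prod_eq, nhds_param, nhds_param, prod_map_map_eq, mem_map, ← nhds_prod_eq]
    have hc := continuous_bihom_param F.poly c d
    have hne : bihom F.poly (homParam c t) (homParam d s) ≠ 0 :=
      fun h0 => hzw ((bihom_param_eq_zero_iff _ _ _ _ _).2 h0)
    filter_upwards [hc.continuousAt.eventually_ne hne] with q hq h0
    exact hq ((bihom_param_eq_zero_iff _ _ _ _ _).1 h0)
  exact h.preimage (((continuous_sconj F.anti).comp continuous_fst).prodMk continuous_snd)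

/-- The graph of `Fⁿ`. -/
def iterGraph (F : Correspondence) (n : ℕ) : Set (RiemannSphere × RiemannSphere) :=
  {p | p.2 ∈ F.iter n p.1}

/-- The intermediate point of a composition ranges over the compact sphere, and projecting along a
compact factor preserves closedness. -/
theorem isClosed_iterGraph (F : Correspondence) (n : ℕ) : IsClosed (F.iterGraph n) := by
  induction n with
  | zero =>
    have h : F.iterGraph 0 = {p | p.2 = p.1} := rfl
    rw [h]
    exact isClosed_eq continuous_snd continuous_fst
  | succ n ih =>
    have h : F.iterGraph (n + 1) = Prod.snd '' {q : RiemannSphere × RiemannSphere × RiemannSphere |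
        (q.2.1, q.1) ∈ F.iterGraph n ∧ (q.1, q.2.2) ∈ F.graph} := by
      ext ⟨z, w⟩
      constructor
      · rintro ⟨y, hy, hw⟩
        exact ⟨(y, z, w), ⟨hy, hw⟩, rfl⟩
      · rintro ⟨⟨y, z', w'⟩, ⟨hy, hw⟩, h⟩
        cases h
        exact ⟨y, hy, hw⟩
    rw [h]
    refine isClosedMap_snd_of_compactSpace _ (IsClosed.inter ?_ ?_)
    · exact ih.preimage (by fun_prop : Continuous fun q : RiemannSphere × RiemannSphere ×
        RiemannSphere => (q.2.1, q.1))
    · exact F.isClosed_graph.preimage (by fun_prop : Continuous fun q : RiemannSphere ×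
        RiemannSphere × RiemannSphere => (q.1, q.2.2))

theorem mem_iter_add {F : Correspondence} {m n : ℕ} {z w : RiemannSphere} :
    w ∈ F.iter (m + n) z ↔ ∃ y ∈ F.iter m z, w ∈ F.iter n y := by
  induction n generalizing w with
  | zero => simp [iter]
  | succ n ih =>
    constructor
    · rintro ⟨y, hy, hw⟩
      obtain ⟨u, hu, hy⟩ := ih.1 hy
      exact ⟨u, hu, y, hy, hw⟩
    · rintro ⟨u, hu, y, hy, hw⟩
      exact ⟨y, ih.2 ⟨u, hu, hy⟩, hw⟩

theorem mem_iter_one {F : Correspondence} {z w : RiemannSphere} :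
    w ∈ F.iter 1 z ↔ w ∈ F.image z := by simp [iter]

theorem mem_iter_mul {F : Correspondence} {q : ℕ} {y : RiemannSphere} (h : y ∈ F.iter q y)
    (n : ℕ) : y ∈ F.iter (q * n) y := by
  induction n with
  | zero => simp [iter]
  | succ n ih => exact mem_iter_add.2 ⟨y, ih, h⟩

/-! ### Consequences of unique preimages in `S` -/

variable {F : Correspondence} {S : Set RiemannSphere} {x : RiemannSphere}

theorem InvariantlyInverseLike.iter_subset (hF : F.InvariantlyInverseLike S) {z : RiemannSphere}
    (hz : z ∈ S) (n : ℕ) : F.iter n z ⊆ S := by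
  induction n with
  | zero => simpa [iter] using hz
  | succ n ih =>
    rintro w ⟨y, hy, hw⟩
    exact hF.1 y (ih hy) hw

theorem InvariantlyInverseLike.eq_of_mem_iter (hF : F.InvariantlyInverseLike S) {n : ℕ}
    {u v w : RiemannSphere} (hu : u ∈ S) (hv : v ∈ S) (hwu : w ∈ F.iter n u)
    (hwv : w ∈ F.iter n v) : u = v := by
  induction n generalizing w with
  | zero => exact hwu.symm.trans hwv
  | succ n ih =>
    obtain ⟨y, hy, hw⟩ := hwu
    obtain ⟨y', hy', hw'⟩ := hwv
    have h1 := hF.iter_subset hu n hy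
    have h2 := hF.iter_subset hv n hy'
    have h3 : y = y' := (hF.2 w ⟨y, h1, hw⟩).unique ⟨h1, hw⟩ ⟨h2, hw'⟩
    exact ih hy (h3 ▸ hy')

theorem limitSet_subset (hS : IsClosed S) (hF : F.InvariantlyInverseLike S) (hx : x ∈ S) :
    F.limitSet x ⊆ S := by
  intro z hz
  have h := Set.mem_iInter.1 hz 0
  refine closure_minimal ?_ hS h
  intro w hw
  simp only [Set.mem_iUnion] at hw
  obtain ⟨k, -, hk⟩ := hw
  exact hF.iter_subset hx k hk

/-- In `S`, points near `w` have preimages under `Fⁿ` only near the preimage of `w`. -/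
theorem InvariantlyInverseLike.exists_nhds_preimage (hS : IsClosed S)
    (hF : F.InvariantlyInverseLike S) {n : ℕ} {y w : RiemannSphere} (hy : y ∈ S)
    (hw : w ∈ F.iter n y) {A : Set RiemannSphere} (hA : A ∈ 𝓝 y) :
    ∃ V ∈ 𝓝 w, ∀ z ∈ V, ∀ v ∈ S, z ∈ F.iter n v → v ∈ A := by
  obtain ⟨O, hOA, hO, hyO⟩ := mem_nhds_iff.1 hA
  -- The `n`-th image of the part of `S` outside `O` is closed, and uniqueness of preimages keeps
  -- `w` out of it.
  have hK : IsClosed (Prod.snd '' (F.iterGraph n ∩ Prod.fst ⁻¹' (S ∩ Oᶜ))) :=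
    isClosedMap_snd_of_compactSpace _
      ((F.isClosed_iterGraph n).inter ((hS.inter hO.isClosed_compl).preimage continuous_fst))
  refine ⟨_, hK.isOpen_compl.mem_nhds ?_, ?_⟩
  · rintro ⟨⟨v, w'⟩, ⟨h1, h2, h3⟩, rfl⟩
    exact h3 (hF.eq_of_mem_iter hy h2 hw h1 ▸ hyO)
  · intro z hz v hv hzv
    by_contra hvA
    exact hz ⟨(v, z), ⟨hzv, hv, fun h => hvA (hOA h)⟩, rfl⟩

theorem mem_limitSet_iff {z : RiemannSphere} :
    z ∈ F.limitSet x ↔ ∀ V ∈ 𝓝 z, ∀ n, ∃ k ≥ n, ∃ w ∈ V, w ∈ F.iter k x := by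
  simp only [limitSet, Set.mem_iInter, mem_closure_iff_nhds]
  constructor
  · intro h V hV n
    obtain ⟨w, hwV, hw⟩ := h n V hV
    simp only [Set.mem_iUnion] at hw
    obtain ⟨k, hk, hw⟩ := hw
    exact ⟨k, hk, w, hwV, hw⟩
  · intro h n V hV
    obtain ⟨k, hk, w, hwV, hw⟩ := h V hV n
    exact ⟨w, hwV, Set.mem_biUnion hk hw⟩

/-- Orbit points of high level close to `w` were, `n` steps earlier, close to the only preimage `z`
of `w` in `S`. This backward invariance keeps all intermediate points off the singular set. -/
theorem InvariantlyInverseLike.mem_limitSet (hS : IsClosed S) (hF : F.InvariantlyInverseLike S)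
    (hx : x ∈ S) {n : ℕ} {w z : RiemannSphere} (hw : w ∈ F.limitSet x) (hz : z ∈ S)
    (hwz : w ∈ F.iter n z) : z ∈ F.limitSet x := by
  rw [mem_limitSet_iff]
  intro A hA m
  obtain ⟨V, hV, hVA⟩ := hF.exists_nhds_preimage hS hz hwz hA
  obtain ⟨k, hk, u, hu, huk⟩ := mem_limitSet_iff.1 hw V hV (m + n)
  obtain ⟨j, rfl⟩ : ∃ j, k = j + n := ⟨k - n, by omega⟩
  obtain ⟨y, hy, huy⟩ := mem_iter_add.1 huk
  exact ⟨j, by omega, y, hVA u hu y (hF.iter_subset hx j hy) huy, hy⟩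

theorem exists_injOn_of_notMem_singularSet {z w : RiemannSphere} (hz : z ∉ F.singularSet)
    (hw : w ∈ F.image z) : ∃ A ∈ 𝓝 z, ∃ B ∈ 𝓝 w, ∀ u ∈ A, ∀ v ∈ B, ∀ v' ∈ B,
      v ∈ F.image u → v' ∈ F.image u → v = v' := by
  by_contra hcon
  refine hz ⟨w, hw, fun W hW hinj => hcon ?_⟩
  obtain ⟨A, hA, B, hB, hAB⟩ := mem_nhds_prod_iff.1 hW
  refine ⟨A, hA, B, hB, fun u hu v hv v' hv' h1 h2 => ?_⟩
  have := @hinj (u, v) ⟨h1, hAB ⟨hu, hv⟩⟩ (u, v') ⟨h2, hAB ⟨hu, hv'⟩⟩ rfl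
  exact congrArg Prod.snd this

/-- Off the singular set, `Fⁿ` is locally single-valued near a pair of points of `S`. -/
theorem InvariantlyInverseLike.exists_nhds_unique (hS : IsClosed S)
    (hF : F.InvariantlyInverseLike S) (hx : x ∈ S) (hsing : F.limitSet x ∩ F.singularSet = ∅)
    {n : ℕ} {y w : RiemannSphere} (hy : y ∈ S) (hw : w ∈ F.limitSet x) (hwy : w ∈ F.iter n y) :
    ∃ A ∈ 𝓝 y, ∃ B ∈ 𝓝 w, ∀ v ∈ A, ∀ z ∈ B, ∀ z' ∈ B,
      z ∈ F.iter n v → z' ∈ F.iter n v → z = z' := by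
  induction n generalizing w with
  | zero =>
    exact ⟨Set.univ, univ_mem, Set.univ, univ_mem, fun v _ z _ z' _ h1 h2 => h1.trans h2.symm⟩
  | succ n ih =>
    obtain ⟨y', hy', hwy'⟩ := hwy
    have hyS' := hF.iter_subset hy n hy'
    have hyL : y' ∈ F.limitSet x := hF.mem_limitSet hS hx hw hyS' (mem_iter_one.2 hwy')
    obtain ⟨A, hA, B, hB, hAB⟩ := ih hyL hy'
    have hns : y' ∉ F.singularSet := fun h => by
      have : y' ∈ F.limitSet x ∩ F.singularSet := ⟨hyL, h⟩
      rwa [hsing] at this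
    obtain ⟨A', hA', B', hB', hAB'⟩ := exists_injOn_of_notMem_singularSet hns hwy'
    obtain ⟨O, hOB, hO, hyO⟩ := mem_nhds_iff.1 (inter_mem hB hA')
    -- Pairs joined by a path whose last intermediate point stays away from `y'`. The pair `(y, w)`
    -- is not among them, so near it all paths pass close to `y'`, where the inductive hypothesis
    -- and nonsingularity apply.
    have hK : IsClosed (Prod.snd '' {q : RiemannSphere × RiemannSphere × RiemannSphere |
        ((q.2.1, q.1) ∈ F.iterGraph n ∧ (q.1, q.2.2) ∈ F.graph) ∧ q.1 ∈ Oᶜ}) := by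
      refine isClosedMap_snd_of_compactSpace _ (IsClosed.inter (IsClosed.inter ?_ ?_) ?_)
      · exact (F.isClosed_iterGraph n).preimage (by fun_prop : Continuous fun q : RiemannSphere ×
          RiemannSphere × RiemannSphere => (q.2.1, q.1))
      · exact F.isClosed_graph.preimage (by fun_prop : Continuous fun q : RiemannSphere ×
          RiemannSphere × RiemannSphere => (q.1, q.2.2))
      · exact hO.isClosed_compl.preimage continuous_fst
    have hmem := hK.isOpen_compl.mem_nhds (x := (y, w)) (by
      rintro ⟨⟨u, v, w'⟩, ⟨⟨h1, h2⟩, h3⟩, h⟩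
      cases h
      have hu : u ∈ S := hF.iter_subset hy n h1
      have : u = y' := (hF.2 w ⟨u, hu, h2⟩).unique ⟨hu, h2⟩ ⟨hyS', hwy'⟩
      exact h3 (this ▸ hyO))
    obtain ⟨A₂, hA₂, B₂, hB₂, hAB₂⟩ := mem_nhds_prod_iff.1 hmem
    refine ⟨A ∩ A₂, inter_mem hA hA₂, B' ∩ B₂, inter_mem hB' hB₂, ?_⟩
    rintro v ⟨hv, hv₂⟩ z ⟨hz, hz₂⟩ z' ⟨hz', hz₂'⟩ ⟨u, hu, hzu⟩ ⟨u', hu', hzu'⟩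
    have key : ∀ z ∈ B₂, ∀ u ∈ F.iter n v, z ∈ F.image u → u ∈ O := by
      intro z hz₂ u hu hzu
      by_contra h
      exact hAB₂ ⟨hv₂, hz₂⟩ ⟨(u, v, z), ⟨⟨hu, hzu⟩, h⟩, rfl⟩
    have h1 := hOB (key z hz₂ u hu hzu)
    have h2 := hOB (key z' hz₂' u' hu' hzu')
    have h3 : u = u' := hAB v hv u h1.1 u' h2.1 hu hu'
    exact hAB' u h1.2 z hz z' hz' hzu (h3 ▸ hzu')

/-- The image is closed in a compact space, and nonsingularity isolates each of its points. -/
theorem finite_image_of_notMem_singularSet {z : RiemannSphere} (hz : z ∉ F.singularSet) :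
    (F.image z).Finite := by
  have hcl : IsClosed (F.image z) := F.isClosed_graph.preimage (by fun_prop : Continuous fun w =>
    (z, w))
  refine hcl.isCompact.finite ?_
  rw [isDiscrete_iff_nhdsWithin]
  intro w hw
  obtain ⟨A, hA, B, hB, hAB⟩ := exists_injOn_of_notMem_singularSet hz hw
  refine le_antisymm ?_ ?_
  · rw [le_pure_iff, mem_nhdsWithin_iff_exists_mem_nhds_inter]
    exact ⟨B, hB, fun v hv => hAB z (mem_of_mem_nhds hA) v hv.1 w (mem_of_mem_nhds hB) hv.2 hw⟩
  · exact pure_le_nhdsWithin hw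

theorem countable_iter_inter_limitSet (hS : IsClosed S) (hF : F.InvariantlyInverseLike S)
    (hx : x ∈ S) (hsing : F.limitSet x ∩ F.singularSet = ∅) {y : RiemannSphere} (hy : y ∈ S)
    (n : ℕ) : (F.iter n y ∩ F.limitSet x).Countable := by
  induction n with
  | zero => exact (Set.countable_singleton y).mono Set.inter_subset_left
  | succ n ih =>
    have h : F.iter (n + 1) y ∩ F.limitSet x ⊆
        ⋃ z ∈ F.iter n y ∩ F.limitSet x, F.image z := by
      rintro w ⟨⟨z, hz, hw⟩, hwL⟩
      refine Set.mem_biUnion (x := z) ⟨hz, ?_⟩ hw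
      exact hF.mem_limitSet hS hx hwL (hF.iter_subset hy n hz) (mem_iter_one.2 hw)
    refine (ih.biUnion fun z hz => ?_).mono h
    refine (finite_image_of_notMem_singularSet fun h' => ?_).countable
    have : z ∈ F.limitSet x ∩ F.singularSet := ⟨hz.2, h'⟩
    rwa [hsing] at this

/-- A backward image of a periodic point is also a forward image: going `n` times round the cycle
passes, `n` steps before its end at `y`, through a preimage of `y` in `S`, and there is only one. -/
theorem InvariantlyInverseLike.orbit_inter_subset (hF : F.InvariantlyInverseLike S)
    {y : RiemannSphere} (hy : y ∈ S) {q : ℕ} (hq : 1 ≤ q) (hyq : y ∈ F.iter q y) :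
    F.orbit y ∩ S ⊆ ⋃ n, F.iter n y := by
  rintro w ⟨⟨n, hn | hn⟩, hw⟩
  · exact Set.mem_iUnion.2 ⟨n, hn⟩
  · have h := mem_iter_mul hyq n
    obtain ⟨m, hm⟩ : ∃ m, q * n = m + n := ⟨q * n - n, by
      have : n ≤ q * n := Nat.le_mul_of_pos_left n hq
      omega⟩
    rw [hm] at h
    obtain ⟨u, hu, hyu⟩ := mem_iter_add.1 h
    have : u = w := hF.eq_of_mem_iter (hF.iter_subset hy m hu) hw hyu hn
    exact Set.mem_iUnion.2 ⟨m, this ▸ hu⟩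

/-! ### Branches -/

/-- The parity of the branches of `Fⁿ`. -/
def parity (F : Correspondence) (n : ℕ) : Bool := F.anti && decide (Odd n)

theorem parity_add (F : Correspondence) (m n : ℕ) :
    F.parity (m + n) = xor (F.parity m) (F.parity n) := by
  unfold parity
  cases F.anti
  · rfl
  · have h : Odd (m + n) ↔ ¬ (Odd m ↔ Odd n) := by
      rw [Nat.odd_add, ← Nat.not_odd_iff_even]; tauto
    by_cases h1 : Odd m <;> by_cases h2 : Odd n <;> simp [h, h1, h2, -Nat.not_odd_iff_even]

theorem isBranchOn_iff {n : ℕ} {f : RiemannSphere → RiemannSphere} {D : Set RiemannSphere} :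
    F.IsBranchOn n f D ↔ ∀ z ∈ D, f z ∈ F.iter n z ∧ IsConf (F.parity n) f z := by
  refine forall₂_congr fun z _ => and_congr_right fun _ => ?_
  rw [isConf_iff]
  simp [parity]

/-- `f` is the germ at `c` of a branch of `Fⁿ`. -/
def IsBranchAt (F : Correspondence) (n : ℕ) (f : RiemannSphere → RiemannSphere)
    (c : RiemannSphere) : Prop :=
  (∀ᶠ z in 𝓝 c, f z ∈ F.iter n z) ∧ IsConf (F.parity n) f c

theorem IsBranchAt.eventually {n : ℕ} {f : RiemannSphere → RiemannSphere} {c : RiemannSphere}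
    (h : F.IsBranchAt n f c) : ∀ᶠ z in 𝓝 c, F.IsBranchAt n f z := by
  filter_upwards [h.1.eventually_nhds, h.2.eventually] with z h1 h2
  exact ⟨h1, h2⟩

theorem isBranchFixing_iff {n : ℕ} {f : RiemannSphere → RiemannSphere} {c : RiemannSphere} :
    F.IsBranchFixing n f c ↔ F.IsBranchAt n f c ∧ f c = c := by
  refine and_congr_left fun _ => ?_
  constructor
  · rintro ⟨D, hD, hc, h⟩
    rw [isBranchOn_iff] at h
    exact ⟨mem_of_superset (hD.mem_nhds hc) fun z hz => (h z hz).1, (h c hc).2⟩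
  · rintro h
    obtain ⟨D, hDs, hD, hc⟩ := eventually_nhds_iff.1 h.eventually
    refine ⟨D, hD, hc, isBranchOn_iff.2 fun z hz => ?_⟩
    exact ⟨(hDs z hz).1.self_of_nhds, (hDs z hz).2⟩

theorem IsBranchAt.comp {m n : ℕ} {f g : RiemannSphere → RiemannSphere} {c : RiemannSphere}
    (hg : F.IsBranchAt n g (f c)) (hf : F.IsBranchAt m f c) :
    F.IsBranchAt (m + n) (g ∘ f) c := by
  refine ⟨?_, F.parity_add m n ▸ hg.2.comp hf.2⟩
  filter_upwards [hf.1, hf.2.continuousAt.eventually hg.1] with z h1 h2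
  exact mem_iter_add.2 ⟨f z, h1, h2⟩

theorem isBranchAt_id (c : RiemannSphere) : F.IsBranchAt 0 id c :=
  ⟨Eventually.of_forall fun _ => rfl, by simpa [parity] using isConf_id c⟩

theorem IsBranchFixing.iterate {q : ℕ} {f : RiemannSphere → RiemannSphere} {c : RiemannSphere}
    (h : F.IsBranchFixing q f c) (n : ℕ) : F.IsBranchFixing (q * n) f^[n] c := by
  rw [isBranchFixing_iff] at h ⊢
  refine ⟨?_, Function.iterate_fixed h.2 n⟩
  induction n with
  | zero => exact isBranchAt_id c
  | succ n ih =>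
    rw [Function.iterate_succ', Nat.mul_succ]
    refine IsBranchAt.comp ?_ ih
    rw [Function.iterate_fixed h.2 n]
    exact h.1

theorem iterate_eventuallyEq {f g : RiemannSphere → RiemannSphere} {c : RiemannSphere}
    (hf : ContinuousAt f c) (hc : f c = c) (h : f =ᶠ[𝓝 c] g) (n : ℕ) :
    f^[n] =ᶠ[𝓝 c] g^[n] := by
  induction n with
  | zero => exact EventuallyEq.rfl
  | succ n ih =>
    have h1 : Tendsto f (𝓝 c) (𝓝 c) := by simpa only [ContinuousAt, hc] using hf
    filter_upwards [h, h1.eventually ih] with z hz hz'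
    rw [Function.iterate_succ_apply, Function.iterate_succ_apply, hz', hz]

end Correspondence
/-! ### Local branches off the singular set -/

open Polynomial in
/-- A minimum modulus principle for polynomials with at most one root in a disc. -/
theorem exists_mul_pow_le_norm_eval {q : ℂ[X]} {m : ℕ} {s₀ : ℂ} {r c : ℝ} (hr : 0 < r) (hc : 0 < c)
    (hbd : ∀ s, ‖s - s₀‖ = r → c ≤ ‖q.eval s‖)
    (huniq : ∀ s ∈ Metric.ball s₀ r, ∀ s' ∈ Metric.ball s₀ r, q.IsRoot s → q.IsRoot s' → s = s')
    (hm : ∀ s ∈ Metric.ball s₀ r, ¬ (X - C s) ^ m ∣ q) :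
    ∃ s₁ ∈ Metric.ball s₀ r, ∀ s ∈ Metric.ball s₀ r,
      c * (‖s - s₁‖ / (2 * r)) ^ (m - 1) ≤ ‖q.eval s‖ := by
  -- Divide out the only possible root in the disc; the cofactor has no zero in the closed disc.
  -- Without a root, `k = 0` and `s₁` is the centre.
  obtain ⟨s₁, hs₁, k, hk, e, hq, he⟩ : ∃ s₁ ∈ Metric.ball s₀ r, ∃ k < m, ∃ e : ℂ[X],
      q = (X - C s₁) ^ k * e ∧ ∀ s ∈ Metric.closedBall s₀ r, e.eval s ≠ 0 := by
    have hm0 : m ≠ 0 := by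
      rintro rfl
      exact hm s₀ (Metric.mem_ball_self hr) (by simp)
    have hq0 : q ≠ 0 := by
      rintro rfl
      exact hm s₀ (Metric.mem_ball_self hr) (dvd_zero _)
    have hcirc : ∀ s, ‖s - s₀‖ = r → q.eval s ≠ 0 := fun s hs h => by
      have := hbd s hs
      rw [h, norm_zero] at this
      linarith
    by_cases h : ∃ s₁ ∈ Metric.ball s₀ r, q.IsRoot s₁
    · obtain ⟨s₁, hs₁, hroot⟩ := h
      obtain ⟨e, he, hnd⟩ := exists_eq_pow_rootMultiplicity_mul_and_not_dvd q hq0 s₁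
      refine ⟨s₁, hs₁, q.rootMultiplicity s₁, ?_, e, he, fun s hs h0 => ?_⟩
      · by_contra hlt
        exact hm s₁ hs₁ ((pow_dvd_pow _ (not_lt.1 hlt)).trans (pow_rootMultiplicity_dvd q s₁))
      · have hqs : q.eval s = 0 := by rw [he, eval_mul, h0, mul_zero]
        rcases (Metric.mem_closedBall.1 hs).lt_or_eq with hlt | heq
        · have := huniq s hlt s₁ hs₁ hqs hroot
          subst this
          exact hnd (dvd_iff_isRoot.2 h0)
        · exact hcirc s (by rwa [dist_eq_norm] at heq) hqs
    · refine ⟨s₀, Metric.mem_ball_self hr, 0, Nat.pos_of_ne_zero hm0, q, by simp, fun s hs h0 => ?_⟩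
      rcases (Metric.mem_closedBall.1 hs).lt_or_eq with hlt | heq
      · exact h ⟨s, hlt, h0⟩
      · exact hcirc s (by rwa [dist_eq_norm] at heq) h0
  have hdist : ∀ s, ‖s - s₀‖ ≤ r → ‖s - s₁‖ ≤ 2 * r := fun s hs => by
    have h1 : ‖s₁ - s₀‖ < r := by rwa [← dist_eq_norm]
    calc ‖s - s₁‖ = ‖(s - s₀) - (s₁ - s₀)‖ := by congr 1; ring
      _ ≤ ‖s - s₀‖ + ‖s₁ - s₀‖ := norm_sub_le _ _
      _ ≤ 2 * r := by linarith
  -- The maximum principle for the reciprocal of the cofactor.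
  have hmax : ∀ s ∈ Metric.ball s₀ r, ‖(e.eval s)⁻¹‖ ≤ (2 * r) ^ k / c := by
    intro s hs
    refine Complex.norm_le_of_forall_mem_frontier_norm_le (f := fun s => (e.eval s)⁻¹)
      (U := Metric.ball s₀ r) Metric.isBounded_ball ?_ ?_ (subset_closure hs)
    · refine DifferentiableOn.diffContOnCl ?_
      rw [closure_ball s₀ hr.ne']
      exact fun s hs => (e.differentiable s).differentiableWithinAt.inv (he s hs)
    · intro s hs
      rw [frontier_ball s₀ hr.ne', Metric.mem_sphere, dist_eq_norm] at hs
      have h1 := hbd s hs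
      have h2 : e.eval s ≠ 0 := he s (by
        rw [Metric.mem_closedBall, dist_eq_norm]; exact hs.le)
      rw [hq, eval_mul, eval_pow, eval_sub, eval_X, eval_C, norm_mul, norm_pow] at h1
      have h3 : ‖s - s₁‖ ^ k ≤ (2 * r) ^ k := pow_le_pow_left₀ (norm_nonneg _) (hdist s hs.le) k
      rw [norm_inv, inv_le_comm₀ (norm_pos_iff.2 h2) (by positivity), inv_div,
        div_le_iff₀ (by positivity)]
      calc c ≤ ‖s - s₁‖ ^ k * ‖e.eval s‖ := h1
        _ ≤ (2 * r) ^ k * ‖e.eval s‖ := by gcongr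
        _ = _ := mul_comm _ _
  refine ⟨s₁, hs₁, fun s hs => ?_⟩
  have h2 : e.eval s ≠ 0 := he s (Metric.ball_subset_closedBall hs)
  have h1 := hmax s hs
  rw [norm_inv, inv_le_comm₀ (norm_pos_iff.2 h2) (by positivity), inv_div] at h1
  have h3 : ‖s - s₁‖ / (2 * r) ≤ 1 := by
    rw [div_le_one (by positivity)]
    exact hdist s (by rw [← dist_eq_norm]; exact (Metric.mem_ball.1 hs).le)
  have h4 : (‖s - s₁‖ / (2 * r)) ^ (m - 1) ≤ (‖s - s₁‖ / (2 * r)) ^ k :=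
    pow_le_pow_of_le_one (by positivity) h3 (by omega)
  rw [hq, eval_mul, eval_pow, eval_sub, eval_X, eval_C, norm_mul, norm_pow]
  calc c * (‖s - s₁‖ / (2 * r)) ^ (m - 1) ≤ c * (‖s - s₁‖ / (2 * r)) ^ k := by gcongr
    _ = ‖s - s₁‖ ^ k * (c / (2 * r) ^ k) := by rw [div_pow]; ring
    _ ≤ _ := by gcongr

open Polynomial in
/-- If a continuous family of polynomials has at most one root near `s₀`, then this root has at
least the multiplicity of the root `s₀` of the central polynomial. -/
theorem eventually_exists_pow_dvd {q : ℂ → ℂ[X]} {t₀ s₀ : ℂ} {A B : Set ℂ}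
    (hcont : Continuous fun p : ℂ × ℂ => (q p.1).eval p.2) (hA : A ∈ 𝓝 t₀) (hB : B ∈ 𝓝 s₀)
    (huniq : ∀ t ∈ A, ∀ s ∈ B, ∀ s' ∈ B, (q t).IsRoot s → (q t).IsRoot s' → s = s')
    (hroot : (q t₀).IsRoot s₀) {B' : Set ℂ} (hB' : B' ∈ 𝓝 s₀) :
    ∀ᶠ t in 𝓝 t₀, ∃ s ∈ B', (X - C s) ^ (q t₀).rootMultiplicity s₀ ∣ q t := by
  obtain ⟨r, hr, hrB⟩ := Metric.nhds_basis_closedBall.mem_iff.1 (inter_mem hB hB')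
  have hballB : Metric.ball s₀ r ⊆ B := fun s hs => (hrB (Metric.ball_subset_closedBall hs)).1
  have h0 : q t₀ ≠ 0 := by
    intro h
    have hs : s₀ + (r : ℂ) / 2 ∈ B := hballB (by
      rw [Metric.mem_ball, dist_eq_norm, add_sub_cancel_left, norm_div, Complex.norm_real,
        Real.norm_of_nonneg hr.le, Complex.norm_ofNat]
      linarith)
    have h1 := huniq t₀ (mem_of_mem_nhds hA) s₀ (mem_of_mem_nhds hB) _ hs hroot (by simp [h])
    have h2 : (r : ℂ) / 2 = 0 := by simpa using h1
    simp [hr.ne'] at h2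
  set m := (q t₀).rootMultiplicity s₀ with hmdef
  have hmpos : 0 < m := (rootMultiplicity_pos h0).2 hroot
  obtain ⟨c, hc, hcbd⟩ : ∃ c > 0, ∀ᶠ t in 𝓝 t₀, ∀ s, ‖s - s₀‖ = r → c ≤ ‖(q t).eval s‖ := by
    have hcomp : IsCompact (Metric.sphere s₀ r) := isCompact_sphere _ _
    obtain ⟨s₁, hs₁, hmin⟩ := hcomp.exists_isMinOn (NormedSpace.sphere_nonempty.2 hr.le)
      ((q t₀).continuous.norm.continuousOn)
    have hpos : 0 < ‖(q t₀).eval s₁‖ := by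
      rw [norm_pos_iff]
      intro h
      have hs₁B : s₁ ∈ B := (hrB (Metric.sphere_subset_closedBall hs₁)).1
      have := huniq t₀ (mem_of_mem_nhds hA) s₁ hs₁B s₀ (mem_of_mem_nhds hB) h hroot
      rw [this, Metric.mem_sphere, dist_self] at hs₁
      exact hr.ne hs₁
    refine ⟨‖(q t₀).eval s₁‖ / 2, by positivity, ?_⟩
    have hev : ∀ᶠ t in 𝓝 t₀, ∀ s ∈ Metric.sphere s₀ r,
        ‖(q t₀).eval s₁‖ / 2 < ‖(q t).eval s‖ := by
      refine hcomp.eventually_forall_of_forall_eventually fun s hs => ?_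
      have : ‖(q t₀).eval s₁‖ / 2 < ‖(q t₀).eval s‖ := lt_of_lt_of_le (half_lt_self hpos) (hmin hs)
      exact (hcont.norm.tendsto (t₀, s)).eventually_const_lt this
    filter_upwards [hev] with t ht s hs
    exact (ht s (by rw [Metric.mem_sphere, dist_eq_norm]; exact hs)).le
  obtain ⟨g, hg⟩ := pow_rootMultiplicity_dvd (q t₀) s₀
  -- The central polynomial is of size η^m at `s₀ + η`, which for small η beats a lower bound of
  -- order η^(m-1).
  obtain ⟨η, hη, hηr, hηg⟩ : ∃ η : ℝ, 0 < η ∧ η < r ∧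
      ‖(q t₀).eval (s₀ + η)‖ < c * (η / 2 / (2 * r)) ^ (m - 1) := by
    have h1 : Tendsto (fun η : ℝ => η * ‖g.eval (s₀ + η)‖) (𝓝[>] 0)
        (𝓝 (0 * ‖g.eval (s₀ + (0 : ℝ))‖)) := by
      have : Continuous fun η : ℝ => η * ‖g.eval (s₀ + η)‖ := by
        have := g.continuous
        fun_prop
      exact (this.tendsto 0).mono_left nhdsWithin_le_nhds
    rw [zero_mul] at h1
    have h2 : 0 < c * (1 / (2 * (2 * r))) ^ (m - 1) := by positivity
    obtain ⟨η, ⟨h3, h4⟩, h5⟩ := ((h1.eventually_lt_const h2).and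
      (mem_nhdsWithin_of_mem_nhds (Iio_mem_nhds hr))).and self_mem_nhdsWithin |>.exists
    have h5 : 0 < η := h5
    refine ⟨η, h5, h4, ?_⟩
    have h6 : η ^ m = η * η ^ (m - 1) := by
      rw [← pow_succ', Nat.sub_add_cancel hmpos]
    rw [hg, eval_mul, eval_pow, eval_sub, eval_X, eval_C, add_sub_cancel_left, norm_mul, norm_pow,
      Complex.norm_real, Real.norm_of_nonneg h5.le, ← hmdef, h6]
    calc η * η ^ (m - 1) * ‖g.eval (s₀ + η)‖ = η ^ (m - 1) * (η * ‖g.eval (s₀ + η)‖) := by ring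
      _ < η ^ (m - 1) * (c * (1 / (2 * (2 * r))) ^ (m - 1)) := by gcongr
      _ = c * (η / 2 / (2 * r)) ^ (m - 1) := by
        rw [mul_left_comm, ← mul_pow]; congr 2; field_simp
  have hK : 0 < c * (η / 2 / (2 * r)) ^ (m - 1) := by positivity
  have hc0 : ∀ᶠ t in 𝓝 t₀, ‖(q t).eval s₀‖ < c * (η / 2 / (2 * r)) ^ (m - 1) := by
    have h1 : Continuous fun t => ‖(q t).eval s₀‖ :=
      (hcont.comp (continuous_id.prodMk continuous_const)).norm
    refine h1.continuousAt.eventually_lt_const ?_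
    have : (q t₀).eval s₀ = 0 := hroot
    simpa [this] using hK
  have hc1 : ∀ᶠ t in 𝓝 t₀, ‖(q t).eval (s₀ + η)‖ < c * (η / 2 / (2 * r)) ^ (m - 1) := by
    have h1 : Continuous fun t => ‖(q t).eval (s₀ + η)‖ :=
      (hcont.comp (continuous_id.prodMk continuous_const)).norm
    exact h1.continuousAt.eventually_lt_const hηg
  filter_upwards [hcbd, hc0, hc1, hA] with t hbd h1 h2 htA
  by_contra hcon
  push Not at hcon
  obtain ⟨s₁, hs₁, hest⟩ := exists_mul_pow_le_norm_eval (q := q t) (m := m) hr hc hbd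
    (fun s hs s' hs' => huniq t htA s (hballB hs) s' (hballB hs'))
    (fun s hs => hcon s (hrB (Metric.ball_subset_closedBall hs)).2)
  -- If all roots had multiplicity below `m`, the lower bound would put both `s₀` and `s₀ + η`
  -- within less than η/2 of `s₁`.
  have key : ∀ s ∈ Metric.ball s₀ r, ‖(q t).eval s‖ < c * (η / 2 / (2 * r)) ^ (m - 1) →
      ‖s - s₁‖ < η / 2 := by
    intro s hs hlt
    by_contra hge
    refine absurd ((hest s hs).trans_lt hlt) (not_lt.2 ?_)
    have := not_lt.1 hge
    gcongr
  have h3 := key s₀ (Metric.mem_ball_self hr) h1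
  have hηn : ‖(η : ℂ)‖ = η := by rw [Complex.norm_real, Real.norm_of_nonneg hη.le]
  have h4 := key (s₀ + η) (by rwa [Metric.mem_ball, dist_eq_norm, add_sub_cancel_left, hηn]) h2
  have h5 : ‖(η : ℂ)‖ ≤ ‖s₀ + η - s₁‖ + ‖s₀ - s₁‖ := by
    calc ‖(η : ℂ)‖ = ‖(s₀ + η - s₁) - (s₀ - s₁)‖ := by congr 1; ring
      _ ≤ _ := norm_sub_le _ _
  rw [hηn] at h5
  linarith

open Polynomial in
/-- An analytic family of polynomials with at most one root near `s₀` has an analytic root. -/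
theorem exists_analyticAt_root {ι : Type*} (I : Finset ι) (a : ι → ℂ → ℂ) (e : ι → ℕ)
    (ha : ∀ i, Differentiable ℂ (a i)) {t₀ s₀ : ℂ} {A B : Set ℂ} (hA : A ∈ 𝓝 t₀) (hB : B ∈ 𝓝 s₀)
    (huniq : ∀ t ∈ A, ∀ s ∈ B, ∀ s' ∈ B, ∑ i ∈ I, a i t * s ^ e i = 0 →
      ∑ i ∈ I, a i t * s' ^ e i = 0 → s = s')
    (hroot : ∑ i ∈ I, a i t₀ * s₀ ^ e i = 0) :
    ∃ b : ℂ → ℂ, AnalyticAt ℂ b t₀ ∧ b t₀ = s₀ ∧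
      ∀ᶠ t in 𝓝 t₀, ∑ i ∈ I, a i t * b t ^ e i = 0 := by
  set q : ℂ → ℂ[X] := fun t => ∑ i ∈ I, C (a i t) * X ^ e i with hq
  have heval : ∀ t s, (q t).eval s = ∑ i ∈ I, a i t * s ^ e i := fun t s => by
    simp [hq, eval_finsetSum]
  have hcont : Continuous fun p : ℂ × ℂ => (q p.1).eval p.2 := by
    simp only [heval]
    have := fun i => (ha i).continuous
    fun_prop
  have huniq' : ∀ t ∈ A, ∀ s ∈ B, ∀ s' ∈ B, (q t).IsRoot s → (q t).IsRoot s' → s = s' := by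
    intro t ht s hs s' hs' h h'
    exact huniq t ht s hs s' hs' (by rw [← heval]; exact h) (by rw [← heval]; exact h')
  have hroot' : (q t₀).IsRoot s₀ := by rw [IsRoot, heval, hroot]
  have h0 : q t₀ ≠ 0 := by
    intro h
    have h1 : ∀ᶠ s in 𝓝 s₀, s = s₀ := by
      filter_upwards [hB] with s hs
      exact huniq' t₀ (mem_of_mem_nhds hA) s hs s₀ (mem_of_mem_nhds hB) (by simp [h]) hroot'
    obtain ⟨s, h2, h3⟩ := ((h1.filter_mono nhdsWithin_le_nhds).and
      (self_mem_nhdsWithin (s := {s₀}ᶜ))).exists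
    exact h3 h2
  set m := (q t₀).rootMultiplicity s₀ with hmdef
  have hmpos : 0 < m := (rootMultiplicity_pos h0).2 hroot'
  -- An `m`-fold root is a simple zero of the (m-1)-st derivative, so the implicit function theorem
  -- applies to `H` although it may not apply to the family itself.
  set H : ℂ × ℂ → ℂ := fun p => (derivative^[m - 1] (q p.1)).eval p.2 with hH
  have hHsum : ∀ p, H p = ∑ i ∈ I, a i p.1 * (derivative^[m - 1] (X ^ e i : ℂ[X])).eval p.2 := by
    intro p
    simp only [hH, hq, iterate_derivative_sum, iterate_derivative_C_mul, eval_finsetSum, eval_mul,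
      eval_C]
  have hHcd : ContDiff ℂ (⊤ : WithTop ℕ∞) H := by
    have : H = fun p => ∑ i ∈ I, a i p.1 * (derivative^[m - 1] (X ^ e i : ℂ[X])).eval p.2 :=
      funext hHsum
    rw [this]
    refine ContDiff.sum fun i _ => ContDiff.mul ?_ ?_
    · exact (ha i).contDiff.comp contDiff_fst
    · exact (Polynomial.differentiable _).contDiff.comp contDiff_snd
  have hH0 : H (t₀, s₀) = 0 :=
    (lt_rootMultiplicity_iff_isRoot_iterate_derivative h0).1
      (show m - 1 < (q t₀).rootMultiplicity s₀ by omega) (m - 1) le_rfl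
  have hder : (derivative^[m] (q t₀)).eval s₀ ≠ 0 := by
    rw [hmdef, eval_iterate_derivative_rootMultiplicity]
    refine smul_ne_zero (Nat.factorial_ne_zero _) ?_
    exact eval_divByMonic_pow_rootMultiplicity_ne_zero s₀ h0
  have hinr : ∀ v, (fderiv ℂ H (t₀, s₀)) (0, v) = (derivative^[m] (q t₀)).eval s₀ * v := by
    intro v
    have h1 : HasFDerivAt H (fderiv ℂ H (t₀, s₀)) (t₀, s₀) :=
      (hHcd.differentiable (by simp) _).hasFDerivAt
    have h2 : HasDerivAt (fun s : ℂ => (t₀, s)) ((0 : ℂ), (1 : ℂ)) s₀ :=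
      (hasDerivAt_const s₀ t₀).prodMk (hasDerivAt_id s₀)
    have h3 := h1.comp_hasDerivAt s₀ h2
    have h4 : HasDerivAt (fun s => (derivative^[m - 1] (q t₀)).eval s)
      ((derivative (derivative^[m - 1] (q t₀))).eval s₀) s₀ := Polynomial.hasDerivAt _ _
    have h5 := h3.unique h4
    rw [← Function.iterate_succ_apply' derivative, Nat.succ_eq_add_one,
      Nat.sub_add_cancel hmpos] at h5
    rw [← h5, show ((0 : ℂ), v) = v • ((0 : ℂ), (1 : ℂ)) by simp, map_smul, smul_eq_mul, mul_comm]
  have hinv : (fderiv ℂ H (t₀, s₀) ∘L .inr ℂ ℂ ℂ).IsInvertible := by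
    set κ := (derivative^[m] (q t₀)).eval s₀
    refine ContinuousLinearMap.IsInvertible.of_inverse
      (g := ContinuousLinearMap.toSpanSingleton ℂ κ⁻¹) ?_ ?_
    · ext
      simp [hinr, hder]
    · ext
      simp [hinr, hder]
  have hcda : ContDiffAt ℂ (⊤ : WithTop ℕ∞) H (t₀, s₀) := hHcd.contDiffAt
  have hω : (⊤ : WithTop ℕ∞) ≠ 0 := by simp
  set b := hcda.implicitFunction hω hinv
  have hb0 : b t₀ = s₀ := hcda.implicitFunction_apply_self hω hinv
  have hban : AnalyticAt ℂ b t₀ := (hcda.contDiffAt_implicitFunction hω hinv).analyticAt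
  refine ⟨b, hban, hb0, ?_⟩
  have hiff := hcda.eventually_apply_eq_iff_implicitFunction hω hinv
  rw [hH0] at hiff
  obtain ⟨A', hA', B', hB', hAB⟩ := mem_nhds_prod_iff.1 hiff
  -- The zero of `H` has to be a root of `q t`: the root near `s₀` still has multiplicity at least
  -- `m`, hence is a zero of `H`, hence equals `b t`.
  filter_upwards [eventually_exists_pow_dvd hcont hA hB huniq' hroot' hB', hA'] with t ht htA
  obtain ⟨s, hs, hdvd⟩ := ht
  by_cases hqt : q t = 0
  · rw [← heval, hqt, eval_zero]
  have hm' : m ≤ (q t).rootMultiplicity s := (le_rootMultiplicity_iff hqt).2 hdvd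
  have hHs : H (t, s) = 0 :=
    (lt_rootMultiplicity_iff_isRoot_iterate_derivative hqt).1
      (show m - 1 < (q t).rootMultiplicity s by omega) (m - 1) le_rfl
  have hbs : b t = s := (hAB (Set.mk_mem_prod htA hs)).1 hHs
  rw [← heval, hbs]
  exact (rootMultiplicity_pos hqt).1 (by omega)

namespace Correspondence

/-- One of the two coordinates is `1`, so in charts the bihomogeneous equation is an ordinary
polynomial equation. -/
theorem exists_homParam_pow (d : RiemannSphere) (j k : ℕ) :
    ∃ e : ℕ, ∀ s, (homParam d s).1 ^ j * (homParam d s).2 ^ k = s ^ e := by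
  induction d using OnePoint.rec with
  | coe d => exact ⟨j, fun s => by simp [homParam]⟩
  | infty => exact ⟨k, fun s => by simp [homParam]⟩

theorem differentiable_homParam_pow (c : RiemannSphere) (α : ℂ) (j k : ℕ) :
    Differentiable ℂ fun t => α * ((homParam c t).1 ^ j * (homParam c t).2 ^ k) := by
  obtain ⟨e, he⟩ := exists_homParam_pow c j k
  simp only [he]
  fun_prop

/-- Off the singular set, every point of `F(z)` is the value of a local branch. -/
theorem exists_isBranchAt {F : Correspondence} {z w : RiemannSphere} (hz : z ∉ F.singularSet)
    (hw : w ∈ F.image z) : ∃ B, F.IsBranchAt 1 B z ∧ B z = w := by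
  obtain ⟨A, hA, B, hB, hAB⟩ := exists_injOn_of_notMem_singularSet hz hw
  -- Writing the point as a conjugate makes the equation holomorphic in the chart variable in both
  -- cases; the conjugation is put back into the branch at the end.
  obtain ⟨c, t₀, rfl⟩ : ∃ c t, z = sconj F.anti (param c t) :=
    ⟨sconj F.anti z, chart (sconj F.anti z) (sconj F.anti z), by
      rw [param_chart_self, sconj_sconj]⟩
  obtain ⟨d, s₀, rfl⟩ : ∃ d s, w = param d s := ⟨w, _, (param_chart_self w).symm⟩
  choose e he using fun m : Fin 2 →₀ ℕ =>
    exists_homParam_pow d (m 1) (F.poly.degreeOf 1 - m 1)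
  have hbi : ∀ t s, bihom F.poly (homParam c t) (homParam d s) =
      ∑ m ∈ F.poly.support, F.poly.coeff m * ((homParam c t).1 ^ m 0 *
        (homParam c t).2 ^ (F.poly.degreeOf 0 - m 0)) * s ^ e m := by
    intro t s
    simp only [bihom, he]
  have hmem : ∀ t s, param d s ∈ F.image (sconj F.anti (param c t)) ↔
      ∑ m ∈ F.poly.support, F.poly.coeff m * ((homParam c t).1 ^ m 0 *
        (homParam c t).2 ^ (F.poly.degreeOf 0 - m 0)) * s ^ e m = 0 := by
    intro t s
    rw [← hbi, ← mem_graph_iff]; rfl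
  have hc1 : Continuous fun t => sconj F.anti (param c t) :=
    (continuous_sconj _).comp (continuous_param c)
  obtain ⟨b, hb, hb0, hbe⟩ := exists_analyticAt_root F.poly.support
    (fun m t => F.poly.coeff m * ((homParam c t).1 ^ m 0 *
        (homParam c t).2 ^ (F.poly.degreeOf 0 - m 0))) e
    (fun m => differentiable_homParam_pow c _ _ _) (hc1.continuousAt hA)
    ((continuous_param d).continuousAt hB)
    (fun t ht s hs s' hs' h h' => param_injective d
      (hAB _ ht _ hs _ hs' ((hmem t s).2 h) ((hmem t s').2 h')))
    ((hmem t₀ s₀).1 hw)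
  have hBp : ∀ s, param d (b (chart c (sconj F.anti (param c s)))) =
      param d (b (cconj F.anti s)) := fun s => by rw [sconj_param, chart_param]
  have hpar : F.parity 1 = F.anti := by simp [parity]
  refine ⟨fun u => param d (b (chart c (sconj F.anti u))), ⟨?_, ?_⟩, ?_⟩
  · rw [sconj_param, eventually_nhds_param]
    have h1 : Tendsto (cconj F.anti) (𝓝 (cconj F.anti t₀)) (𝓝 t₀) := by
      have := (continuous_cconj F.anti).tendsto (cconj F.anti t₀)
      rwa [cconj_cconj] at this
    filter_upwards [h1.eventually hbe] with s hs
    rw [mem_iter_one, hBp]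
    have := (hmem _ _).2 hs
    rwa [sconj_param, cconj_cconj] at this
  · rw [sconj_param, hpar]
    refine isConf_of_chart (d := d) (F := fun s => b (cconj F.anti s)) ?_ (Eventually.of_forall hBp)
    have h1 : AnAt F.anti (cconj F.anti) (cconj F.anti t₀) := by
      simp only [AnAt, cconj_cconj]
      exact analyticAt_id
    have h2 : AnAt false b (cconj F.anti (cconj F.anti t₀)) := by
      rw [cconj_cconj]; exact hb
    simpa using h2.comp h1
  · simp only [sconj_sconj, chart_param, hb0]

end Correspondence
/-! ### Parabolic germs -/

/-- If the vanishing order were k < n, then dividing by z^k would force the nonvanishing cofactor to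
tend to 0. -/
theorem natCast_le_analyticOrderAt_of_isBigO {E : ℂ → ℂ} (hE : AnalyticAt ℂ E 0) {n : ℕ}
    (h : E =O[𝓝 0] fun z => z ^ n) :
    ∃ e : ℂ → ℂ, AnalyticAt ℂ e 0 ∧ ∀ᶠ z in 𝓝 0, E z = z ^ n * e z := by
  have key : (n : ℕ∞) ≤ analyticOrderAt E 0 := by
    by_contra hlt
    rw [not_le] at hlt
    obtain ⟨k, hk⟩ := ENat.ne_top_iff_exists.1 hlt.ne_top
    rw [← hk, Nat.cast_lt] at hlt
    obtain ⟨g, hg, hg0, hgE⟩ := (hE.analyticOrderAt_eq_natCast (n := k)).1 hk.symm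
    simp only [sub_zero, smul_eq_mul] at hgE
    have h1 : g =O[𝓝[≠] 0] fun z : ℂ => z ^ (n - k) := by
      have h2 := (h.mono (nhdsWithin_le_nhds (s := {0}ᶜ))).mul
        (Asymptotics.isBigO_refl (fun z : ℂ => (z ^ k)⁻¹) (𝓝[≠] 0))
      refine h2.congr' ?_ ?_
      · filter_upwards [hgE.filter_mono nhdsWithin_le_nhds, self_mem_nhdsWithin] with z hz hz0
        have hz0 : z ≠ 0 := hz0
        rw [hz]
        field_simp
      · filter_upwards [self_mem_nhdsWithin] with z hz0
        have hz0 : z ≠ 0 := hz0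
        rw [← pow_sub₀ z hz0 hlt.le]
    have h3 : Tendsto (fun z : ℂ => z ^ (n - k)) (𝓝[≠] 0) (𝓝 0) := by
      have : Tendsto (fun z : ℂ => z ^ (n - k)) (𝓝 0) (𝓝 (0 ^ (n - k))) :=
        (continuous_pow _).tendsto 0
      rw [zero_pow (by omega)] at this
      exact this.mono_left nhdsWithin_le_nhds
    have h4 := h1.trans_tendsto h3
    exact hg0 (tendsto_nhds_unique (hg.continuousAt.tendsto.mono_left nhdsWithin_le_nhds) h4)
  obtain ⟨e, he, heE⟩ := (natCast_le_analyticOrderAt hE).1 key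
  exact ⟨e, he, by simpa using heE⟩

open Polynomial in
theorem exists_one_add_pow_eq (n : ℕ) :
    ∃ k : ℂ → ℂ, Continuous k ∧ ∀ e, (1 + e) ^ n = 1 + n * e + k e * e ^ 2 := by
  obtain ⟨k, hk⟩ := Polynomial.powAddExpansion (1 : ℂ[X]) X n
  refine ⟨fun e => k.eval e, k.continuous, fun e => ?_⟩
  have := congrArg (Polynomial.eval e) hk
  simpa using this

/-- Local estimates for a parabolic germ `z + a z ^ (p + 1) + ⋯`. -/
theorem eventually_parabolic {G : ℂ → ℂ} (hG : AnalyticAt ℂ G 0) {p : ℕ} (hp : 1 ≤ p) {a : ℂ}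
    (ha : a ≠ 0) (hO : (fun z => G z - (z + a * z ^ (p + 1))) =O[𝓝 0] fun z => z ^ (p + 2)) :
    ∃ C : ℝ, 0 ≤ C ∧ ∀ᶠ z in 𝓝[≠] 0, 1 / 2 ≤ ‖G z / z‖ ∧
      1 / 2 ≤ (-(a * p * G z ^ p)⁻¹ - -(a * p * z ^ p)⁻¹).re ∧
      ‖deriv G z‖ ≤ ‖G z / z‖ ^ (p + 1) * (1 + C * ‖z‖ ^ (p + 1)) := by
  obtain ⟨e, he, hE⟩ := natCast_le_analyticOrderAt_of_isBigO (hG.sub (by fun_prop)) hO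
  have hGe : G =ᶠ[𝓝 0] fun z => z + a * z ^ (p + 1) + z ^ (p + 2) * e z := by
    filter_upwards [hE] with z hz
    have hz : G z - (z + a * z ^ (p + 1)) = z ^ (p + 2) * e z := hz
    rw [← hz]; ring
  -- The relative displacement: G(z) = z (1 + ε(z)) with ε(z) ~ a z^p.
  set ε : ℂ → ℂ := fun z => z ^ p * (a + z * e z) with hε
  have hdiv : ∀ᶠ z in 𝓝[≠] 0, G z / z = 1 + ε z := by
    filter_upwards [hGe.filter_mono nhdsWithin_le_nhds, self_mem_nhdsWithin] with z hz hz0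
    have hz0 : z ≠ 0 := hz0
    rw [hz, div_eq_iff hz0, hε]
    ring
  have hpne : p ≠ 0 := by omega
  have hε0 : Tendsto ε (𝓝[≠] 0) (𝓝 0) := by
    have h1 : ContinuousAt ε 0 := by
      have := he.continuousAt
      simp only [hε]
      fun_prop
    have h2 : ε 0 = 0 := by simp [hε, hpne]
    have h3 := h1.tendsto
    rw [h2] at h3
    exact h3.mono_left nhdsWithin_le_nhds
  have hhalf : ∀ᶠ z in 𝓝[≠] 0, 1 / 2 ≤ ‖1 + ε z‖ := by
    have h1 : Tendsto (fun z => ‖1 + ε z‖) (𝓝[≠] 0) (𝓝 1) := by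
      simpa using (hε0.const_add 1).norm
    exact (h1.eventually_const_lt (by norm_num : (1 / 2 : ℝ) < 1)).mono fun z hz => hz.le
  obtain ⟨k, hk, hkeq⟩ := exists_one_add_pow_eq (p + 1)
  -- Both G' and (1 + ε)^(p+1) start with 1 + (p+1) a z^p, so their difference is divisible by
  -- z^(p+1); `B` is the quotient. The exponent `p - 1` comes from ε² and needs p ≥ 1.
  set B : ℂ → ℂ := fun z => ((p + 2 : ℕ) : ℂ) * e z + z * deriv e z - (p + 1 : ℕ) * e z -
    k (ε z) * (z ^ (p - 1) * (a + z * e z) ^ 2) with hB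
  have hBc : ContinuousAt B 0 := by
    have h1 := he.continuousAt
    have h2 := he.deriv.continuousAt
    have h3 : ContinuousAt ε 0 := by simp only [hε]; fun_prop
    have h4 : ContinuousAt (fun z => k (ε z)) 0 := hk.continuousAt.comp h3
    simp only [hB]
    fun_prop
  have hder : ∀ᶠ z in 𝓝[≠] 0, deriv G z = (1 + ε z) ^ (p + 1) + z ^ (p + 1) * B z := by
    have h1 : ∀ᶠ z in 𝓝 0, deriv G z = 1 + a * ((p + 1 : ℕ) * z ^ p) +
        (((p + 2 : ℕ) : ℂ) * z ^ (p + 1) * e z + z ^ (p + 2) * deriv e z) := by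
      filter_upwards [hGe.eventuallyEq_nhds, he.eventually_analyticAt] with z hz hez
      rw [hz.deriv_eq]
      have h2 := ((hasDerivAt_id z).add ((hasDerivAt_pow (p + 1) z).const_mul a)).add
        ((hasDerivAt_pow (p + 2) z).mul hez.differentiableAt.hasDerivAt)
      exact h2.deriv
    filter_upwards [h1.filter_mono nhdsWithin_le_nhds] with z hz
    rw [hz, hkeq]
    obtain ⟨l, rfl⟩ : ∃ l, p = l + 1 := ⟨p - 1, by omega⟩
    simp only [hB, hε, Nat.add_sub_cancel]
    push_cast
    ring
  obtain ⟨C, hC⟩ : ∃ C : ℝ, ∀ᶠ z in 𝓝 0, ‖B z‖ ≤ C :=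
    ⟨‖B 0‖ + 1, (hBc.norm.eventually_lt_const (lt_add_one _)).mono fun z hz => hz.le⟩
  refine ⟨max C 0 * 2 ^ (p + 1), by positivity, ?_⟩
  -- In the Fatou coordinate the germ is asymptotically the translation by 1, because (1 + ε)^(-p) =
  -- 1 - pε + o(ε).
  have hre : Tendsto (fun z => (-(a * p * G z ^ p)⁻¹ - -(a * p * z ^ p)⁻¹)) (𝓝[≠] 0) (𝓝 1) := by
    have hφ : HasDerivAt (fun w : ℂ => ((1 + w) ^ p)⁻¹) (-p) 0 := by
      have h1 : HasDerivAt (fun w : ℂ => (1 + w) ^ p) (p : ℂ) 0 := by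
        have := ((hasDerivAt_id (0 : ℂ)).const_add 1).fun_pow p
        simpa using this
      have := h1.fun_inv (by simp)
      simpa using this
    have h1 : (fun z => ((1 + ε z) ^ p)⁻¹ - 1 + p * ε z) =o[𝓝[≠] 0] ε := by
      have h2 := (hasDerivAt_iff_isLittleO.1 hφ).comp_tendsto hε0
      refine (h2.congr_left fun z => ?_).congr_right fun z => ?_
      · simp [Function.comp]; ring
      · simp [Function.comp]
    have hεO : ε =O[𝓝[≠] 0] fun z => z ^ p := by
      have h3 : ContinuousAt (fun z => a + z * e z) 0 := by
        have := he.continuousAt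
        fun_prop
      have h4 : (fun z => a + z * e z) =O[𝓝 0] fun _ => (1 : ℂ) := h3.isBigO_one ℂ
      have h5 := (Asymptotics.isBigO_refl (fun z : ℂ => z ^ p) (𝓝[≠] 0)).mul
        (h4.mono nhdsWithin_le_nhds)
      simpa using h5
    have h6 := (h1.trans_isBigO hεO).tendsto_div_nhds_zero
    have h7 : Tendsto (fun z => a + z * e z) (𝓝[≠] 0) (𝓝 a) := by
      have h3 : ContinuousAt (fun z => a + z * e z) 0 := by
        have := he.continuousAt
        fun_prop
      have h8 := h3.tendsto
      simp only [zero_mul, add_zero] at h8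
      exact h8.mono_left nhdsWithin_le_nhds
    have h9 := ((h7.const_mul (p : ℂ)).sub h6).const_mul (a * p)⁻¹
    have hpc : (p : ℂ) ≠ 0 := by exact_mod_cast hpne
    have h10 : (a * p)⁻¹ * ((p : ℂ) * a - 0) = 1 := by field_simp; ring
    rw [h10] at h9
    refine h9.congr' ?_
    filter_upwards [hdiv, hhalf, self_mem_nhdsWithin] with z hz hz2 hz0
    have hz0 : z ≠ 0 := hz0
    have hne : 1 + ε z ≠ 0 := by
      intro h
      rw [h, norm_zero] at hz2
      norm_num at hz2
    rw [div_eq_iff hz0] at hz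
    rw [hz, mul_pow]
    have h11 : ε z = z ^ p * (a + z * e z) := rfl
    have h12 : a + z * e z = ε z / z ^ p := by rw [h11]; field_simp
    rw [h12]
    field_simp
    ring
  have hre' : ∀ᶠ z in 𝓝[≠] 0, 1 / 2 ≤ (-(a * p * G z ^ p)⁻¹ - -(a * p * z ^ p)⁻¹).re := by
    have h1 := (Complex.continuous_re.tendsto 1).comp hre
    rw [Complex.one_re] at h1
    exact (h1.eventually_const_lt (by norm_num : (1 / 2 : ℝ) < 1)).mono fun z hz => hz.le
  filter_upwards [hdiv, hhalf, hre', hder, hC.filter_mono nhdsWithin_le_nhds]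
    with z h1 h2 h3 h4 h5
  refine ⟨h1 ▸ h2, h3, ?_⟩
  rw [h4, h1]
  -- The bound ‖1 + ε‖ ≥ 1/2 turns the additive error into a multiplicative one.
  have h6 : 1 ≤ ‖1 + ε z‖ ^ (p + 1) * 2 ^ (p + 1) := by
    rw [← mul_pow]
    exact one_le_pow₀ (by linarith)
  calc ‖(1 + ε z) ^ (p + 1) + z ^ (p + 1) * B z‖
      ≤ ‖1 + ε z‖ ^ (p + 1) + ‖z‖ ^ (p + 1) * ‖B z‖ := by
        refine (norm_add_le _ _).trans ?_
        rw [norm_mul, norm_pow, norm_pow]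
    _ ≤ ‖1 + ε z‖ ^ (p + 1) + ‖z‖ ^ (p + 1) * max C 0 * 1 := by
        rw [mul_one]
        gcongr
        exact h5.trans (le_max_left _ _)
    _ ≤ ‖1 + ε z‖ ^ (p + 1) + ‖z‖ ^ (p + 1) * max C 0 * (‖1 + ε z‖ ^ (p + 1) * 2 ^ (p + 1)) := by
        gcongr
    _ = _ := by ring

/-- Orbits that start away from a parabolic fixed point contract at the parabolic rate. -/
theorem exists_prod_deriv_le {G : ℂ → ℂ} (hG : AnalyticAt ℂ G 0) {p : ℕ} (hp : 1 ≤ p) {a : ℂ}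
    (ha : a ≠ 0) (hO : (fun z => G z - (z + a * z ^ (p + 1))) =O[𝓝 0] fun z => z ^ (p + 2)) :
    ∃ r > 0, ∀ ρ > 0, ∃ K : ℝ, 0 ≤ K ∧ ∀ (j : ℕ) (z : ℂ), ρ ≤ ‖z‖ → (∀ i ≤ j, ‖G^[i] z‖ < r) →
      ∏ i ∈ Finset.range j, ‖deriv G (G^[i] z)‖ ≤ K * ((j : ℝ) + 1) ^ (-((p + 1 : ℝ) / p)) := by
  obtain ⟨C, hC, hev⟩ := eventually_parabolic hG hp ha hO
  rw [eventually_nhdsWithin_iff, Metric.eventually_nhds_iff_ball] at hev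
  obtain ⟨r, hr, hloc⟩ := hev
  have hpr : (0 : ℝ) < p := by exact_mod_cast hp
  have hap : 0 < ‖a‖ * p := mul_pos (norm_pos_iff.2 ha) hpr
  refine ⟨r, hr, fun ρ hρ => ?_⟩
  -- In the Fatou coordinate, `R₀` bounds the modulus from below on the disc of radius `r`, and `R₁`
  -- bounds it from above at the starting point. The choice θ R₀ = R₁ + 1/2 absorbs the initial
  -- stretch during which the real part may still be negative.
  set R₀ : ℝ := (‖a‖ * p * r ^ p)⁻¹
  set R₁ : ℝ := (‖a‖ * p * ρ ^ p)⁻¹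
  have hR₀ : 0 < R₀ := by positivity
  have hR₁ : 0 < R₁ := by positivity
  set θ : ℝ := (R₁ + 1 / 2) / R₀
  have hθ : 0 < θ := by positivity
  set K₁ : ℝ := 2 * (1 + θ) / (‖a‖ * p)
  have hK₁ : 0 < K₁ := by positivity
  have hsum : Summable fun i : ℕ => C * (K₁ / ((i : ℝ) + 1)) ^ ((p + 1 : ℝ) / p) := by
    refine Summable.mul_left _ ?_
    have h1 : Summable fun i : ℕ => ((((i + 1 : ℕ) : ℝ)) ^ ((p + 1 : ℝ) / p))⁻¹ := by
      have h2 : (1 : ℝ) < (p + 1 : ℝ) / p := by rw [lt_div_iff₀ hpr]; linarith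
      exact (summable_nat_add_iff 1).2 (Real.summable_nat_rpow_inv.2 h2)
    refine (h1.mul_left (K₁ ^ ((p + 1 : ℝ) / p))).congr fun i => ?_
    rw [Real.div_rpow hK₁.le (by positivity), div_eq_mul_inv]
    push_cast
    rfl
  refine ⟨(ρ ^ (p + 1))⁻¹ * K₁ ^ ((p + 1 : ℝ) / p) *
    Real.exp (∑' i : ℕ, C * (K₁ / ((i : ℝ) + 1)) ^ ((p + 1 : ℝ) / p)), by positivity, ?_⟩
  intro j z hz hzr
  have hne : ∀ i ≤ j, G^[i] z ≠ 0 := by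
    intro i
    induction i with
    | zero =>
      intro _ h
      have h : z = 0 := h
      rw [h, norm_zero] at hz
      linarith
    | succ i ih =>
      intro hi h
      have h1 := (hloc (G^[i] z) (by simpa using hzr i (by omega)) (ih (by omega))).1
      rw [Function.iterate_succ_apply'] at h
      rw [h, zero_div, norm_zero] at h1
      norm_num at h1
  have hl : ∀ i ≤ j, _ := fun i hi => hloc (G^[i] z) (by simpa using hzr i hi) (hne i hi)
  set u : ℂ → ℂ := fun z => -(a * p * z ^ p)⁻¹ with hu
  have hun : ∀ w, ‖u w‖ = (‖a‖ * p * ‖w‖ ^ p)⁻¹ := by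
    intro w
    simp [hu]
  have hre : ∀ i ≤ j, (i : ℝ) / 2 - R₁ ≤ (u (G^[i] z)).re := by
    intro i
    induction i with
    | zero =>
      intro _
      have h1 : ‖u z‖ ≤ R₁ := by
        rw [hun]
        simp only [R₁]
        gcongr
      have h2 := (abs_le.1 ((Complex.abs_re_le_norm (u z)).trans h1)).1
      simpa using h2
    | succ i ih =>
      intro hi
      have h1 := ih (by omega)
      have h2 := (hl i (by omega)).2.1
      rw [← Function.iterate_succ_apply' G, Complex.sub_re] at h2
      have h3 : (1 : ℝ) / 2 ≤ (u (G^[i + 1] z)).re - (u (G^[i] z)).re := h2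
      push_cast
      linarith
  have hsmall : ∀ i ≤ j, ‖G^[i] z‖ ^ p ≤ K₁ / (i + 1) := by
    intro i hi
    have h1 : (i : ℝ) / 2 - R₁ ≤ ‖u (G^[i] z)‖ :=
      (hre i hi).trans ((le_abs_self _).trans (Complex.abs_re_le_norm _))
    have h0 : 0 < ‖G^[i] z‖ := norm_pos_iff.2 (hne i hi)
    have h2 : R₀ ≤ ‖u (G^[i] z)‖ := by
      rw [hun]
      simp only [R₀]
      have := (hzr i hi).le
      gcongr
    have h3 : ((i : ℝ) + 1) / 2 ≤ (1 + θ) * ‖u (G^[i] z)‖ := by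
      have h4 : θ * R₀ = R₁ + 1 / 2 := by simp only [θ]; field_simp
      have h5 : θ * R₀ ≤ θ * ‖u (G^[i] z)‖ := by gcongr
      linarith
    rw [hun] at h3
    rw [le_div_iff₀ (by positivity)]
    have h6 : (1 + θ) * (‖a‖ * p * ‖G^[i] z‖ ^ p)⁻¹ = K₁ / 2 / ‖G^[i] z‖ ^ p := by
      simp only [K₁]; field_simp
    rw [h6, le_div_iff₀ (by positivity)] at h3
    linarith
  have hsmall' : ∀ i ≤ j, ‖G^[i] z‖ ^ (p + 1) ≤ (K₁ / (i + 1)) ^ ((p + 1 : ℝ) / p) := by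
    intro i hi
    have h1 : ‖G^[i] z‖ ^ (p + 1) = (‖G^[i] z‖ ^ p) ^ ((p + 1 : ℝ) / p) := by
      rw [← Real.rpow_natCast (‖G^[i] z‖) p, ← Real.rpow_mul (norm_nonneg _),
        mul_div_cancel₀ _ hpr.ne', ← Real.rpow_natCast]
      push_cast
      rfl
    rw [h1]
    exact Real.rpow_le_rpow (by positivity) (hsmall i hi) (by positivity)
  -- The ratios of successive moduli telescope; the remaining product converges because (p + 1)/p >
  -- 1.
  have hprod : ∀ n ≤ j, ∏ i ∈ Finset.range n, ‖deriv G (G^[i] z)‖ ≤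
      (‖G^[n] z‖ / ‖z‖) ^ (p + 1) *
        ∏ i ∈ Finset.range n, (1 + C * ‖G^[i] z‖ ^ (p + 1)) := by
    intro n
    induction n with
    | zero =>
      intro _
      have : ‖z‖ ≠ 0 := by linarith
      simp [this]
    | succ n ih =>
      intro hn
      rw [Finset.prod_range_succ, Finset.prod_range_succ]
      have h1 := ih (by omega)
      have h2 := (hl n (by omega)).2.2
      have h3 : 0 < ‖G^[n] z‖ := norm_pos_iff.2 (hne n (by omega))
      have hz0 : 0 < ‖z‖ := lt_of_lt_of_le hρ hz
      rw [← Function.iterate_succ_apply' G, norm_div] at h2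
      calc _ ≤ ((‖G^[n] z‖ / ‖z‖) ^ (p + 1) *
            ∏ i ∈ Finset.range n, (1 + C * ‖G^[i] z‖ ^ (p + 1))) *
            ((‖G^[n + 1] z‖ / ‖G^[n] z‖) ^ (p + 1) * (1 + C * ‖G^[n] z‖ ^ (p + 1))) := by
              gcongr
        _ = ((‖G^[n] z‖ / ‖z‖) * (‖G^[n + 1] z‖ / ‖G^[n] z‖)) ^ (p + 1) *
            ((∏ i ∈ Finset.range n, (1 + C * ‖G^[i] z‖ ^ (p + 1))) *
              (1 + C * ‖G^[n] z‖ ^ (p + 1))) := by rw [mul_pow]; ring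
        _ = _ := by
          congr 2
          field_simp
  refine (hprod j le_rfl).trans ?_
  have hexp : ∏ i ∈ Finset.range j, (1 + C * ‖G^[i] z‖ ^ (p + 1)) ≤
      Real.exp (∑' i : ℕ, C * (K₁ / ((i : ℝ) + 1)) ^ ((p + 1 : ℝ) / p)) := by
    calc ∏ i ∈ Finset.range j, (1 + C * ‖G^[i] z‖ ^ (p + 1))
        ≤ ∏ i ∈ Finset.range j, Real.exp (C * (K₁ / ((i : ℝ) + 1)) ^ ((p + 1 : ℝ) / p)) := by
          refine Finset.prod_le_prod (fun i _ => by positivity) fun i hi => ?_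
          have h1 := hsmall' i (Finset.mem_range.1 hi).le
          have h2 := Real.add_one_le_exp (C * (K₁ / ((i : ℝ) + 1)) ^ ((p + 1 : ℝ) / p))
          have h3 : C * ‖G^[i] z‖ ^ (p + 1) ≤ C * (K₁ / ((i : ℝ) + 1)) ^ ((p + 1 : ℝ) / p) := by
            gcongr
          linarith
      _ = Real.exp (∑ i ∈ Finset.range j, C * (K₁ / ((i : ℝ) + 1)) ^ ((p + 1 : ℝ) / p)) :=
          (Real.exp_sum _ _).symm
      _ ≤ _ := Real.exp_le_exp.2 (hsum.sum_le_tsum _ fun i _ => by positivity)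
  have hfirst : (‖G^[j] z‖ / ‖z‖) ^ (p + 1) ≤
      (ρ ^ (p + 1))⁻¹ * K₁ ^ ((p + 1 : ℝ) / p) * ((j : ℝ) + 1) ^ (-((p + 1 : ℝ) / p)) := by
    rw [div_pow, div_eq_inv_mul, mul_assoc]
    have h1 := hsmall' j le_rfl
    rw [Real.div_rpow hK₁.le (by positivity), div_eq_mul_inv, ← Real.rpow_neg (by positivity)] at h1
    gcongr
  calc _ ≤ ((ρ ^ (p + 1))⁻¹ * K₁ ^ ((p + 1 : ℝ) / p) * ((j : ℝ) + 1) ^ (-((p + 1 : ℝ) / p))) *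
        Real.exp (∑' i : ℕ, C * (K₁ / ((i : ℝ) + 1)) ^ ((p + 1 : ℝ) / p)) := by
        gcongr
    _ = _ := by ring
/-! ### Contraction along orbit segments -/

/-- Orbit segments of `Q` that come from outside a ball around `y` and then stay in it have
derivatives bounded by a sequence whose powers with exponents at least `s₀` are summable. -/
def ContractsAt (Q : RiemannSphere → RiemannSphere) (y : RiemannSphere) (s₀ : ℝ) : Prop :=
  ∃ R ∈ 𝓝 y, ∀ ρ > 0, ∃ β : ℕ → ℝ, (∀ j, 0 ≤ β j) ∧ (∀ τ ≥ s₀, Summable fun j => β j ^ τ) ∧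
    ∀ j ≥ 1, ∀ v ∈ R, ρ ≤ chord v y →
      (∀ i, 1 ≤ i → i ≤ j → Q^[i] v ∈ R ∧ chord (Q^[i] v) y < ρ) →
      ∏ i ∈ Finset.range j, sphericalDeriv Q (Q^[i] v) ≤ β j

/-- By continuity the derivative stays below some l < 1 near `y`, and β_j = l^j works. -/
theorem contractsAt_of_lt_one {b : Bool} {Q : RiemannSphere → RiemannSphere} {y : RiemannSphere}
    (hQ : IsConf b Q y) (h : sphericalDeriv Q y < 1) {s₀ : ℝ} (hs₀ : 0 < s₀) :
    ContractsAt Q y s₀ := by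
  obtain ⟨l, hl, hl1⟩ := exists_between h
  have hl0 : 0 < l := (sphericalDeriv_nonneg _ _).trans_lt hl
  refine ⟨_, hQ.continuousAt_sphericalDeriv.eventually_lt_const hl, fun ρ hρ =>
    ⟨fun j => l ^ j, fun j => by positivity, fun τ hτ => ?_, ?_⟩⟩
  · have h1 : l ^ τ < 1 := Real.rpow_lt_one hl0.le hl1 (by linarith)
    refine (summable_geometric_of_lt_one (by positivity) h1).congr fun j => ?_
    rw [← Real.rpow_natCast, ← Real.rpow_mul hl0.le, mul_comm, Real.rpow_mul hl0.le,
      Real.rpow_natCast]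
  · intro j hj v hv hvρ hvi
    calc ∏ i ∈ Finset.range j, sphericalDeriv Q (Q^[i] v) ≤ ∏ i ∈ Finset.range j, l := by
          refine Finset.prod_le_prod (fun i _ => sphericalDeriv_nonneg _ _) fun i hi => ?_
          rcases Nat.eq_zero_or_pos i with rfl | hi0
          · exact le_of_lt hv
          · exact le_of_lt (hvi i hi0 (Finset.mem_range.1 hi).le).1
      _ = l ^ j := by simp

/-- Near `y` the map does not decrease the distance to `y`, so no segment enters the ball from
outside, and β = 0 works vacuously. -/
theorem contractsAt_of_one_lt {b : Bool} {Q : RiemannSphere → RiemannSphere} {y : RiemannSphere}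
    (hQ : IsConf b Q y) (hy : Q y = y) (h : 1 < sphericalDeriv Q y) {s₀ : ℝ} (hs₀ : 0 < s₀) :
    ContractsAt Q y s₀ := by
  have h1 := hQ.hasScale.2.bound (sub_pos.2 h)
  refine ⟨_, h1, fun ρ hρ => ⟨fun _ => 0, fun _ => le_rfl, fun τ hτ => ?_, ?_⟩⟩
  · simp only [Real.zero_rpow (by linarith : τ ≠ 0)]
    exact summable_zero
  · intro j hj v hv hvρ hvi
    exfalso
    have h2 := (hvi 1 le_rfl hj).2
    have h3 : ‖chord (Q v) (Q y) - sphericalDeriv Q y * chord v y‖ ≤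
      (sphericalDeriv Q y - 1) * ‖chord v y‖ := hv
    rw [Real.norm_of_nonneg (chord_nonneg _ _), hy] at h3
    have h4 := (abs_le.1 h3).1
    have h5 : Q^[1] v = Q v := rfl
    rw [h5] at h2
    nlinarith

/-- The bound is a constant times (j + 1)^(-(p+1)/p), whose τ-th powers are summable for τ >
p/(p+1). -/
theorem contractsAt_of_parabolic {Q : RiemannSphere → RiemannSphere} {y : RiemannSphere}
    (hQ : IsConf false Q y) (hy : Q y = y) {p : ℕ} (hp : 1 ≤ p) {a : ℂ} (ha : a ≠ 0)
    (hO : (fun u => localRep Q y u - (u + a * (u - chart y y) ^ (p + 1)))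
        =O[𝓝 (chart y y)] fun u => (u - chart y y) ^ (p + 2)) {s₀ : ℝ}
    (hs₀ : (p : ℝ) / (p + 1) < s₀) : ContractsAt Q y s₀ := by
  obtain ⟨hF, hQF⟩ := hQ.self_rep
  rw [hy] at hQF
  set c := chart y y with hc
  set F := localRep Q y
  have hF : AnalyticAt ℂ F c := hF
  set G : ℂ → ℂ := fun z => F (c + z) - c with hG
  have hadd : Tendsto (fun z : ℂ => c + z) (𝓝 0) (𝓝 c) := by
    have : Continuous fun z : ℂ => c + z := by fun_prop
    simpa using this.tendsto 0
  have hGan : AnalyticAt ℂ G 0 := by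
    have h1 : AnalyticAt ℂ F (c + 0) := by rwa [add_zero]
    have h2 : AnalyticAt ℂ (fun z : ℂ => c + z) 0 := by fun_prop
    exact (AnalyticAt.fun_comp h1 h2).sub analyticAt_const
  have hGO : (fun z => G z - (z + a * z ^ (p + 1))) =O[𝓝 0] fun z => z ^ (p + 2) := by
    refine ((hO.comp_tendsto hadd).congr_left fun z => ?_).congr_right fun z => ?_
    · simp only [Function.comp, hG, add_sub_cancel_left]; ring
    · simp [Function.comp]
  have hGder : ∀ z, deriv G z = deriv F (c + z) := fun z => by
    simp only [hG]
    rw [deriv_sub_const, deriv_comp_const_add]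
  obtain ⟨r, hr, hcore⟩ := exists_prod_deriv_le hGan hp ha hGO
  obtain ⟨r', hr', hball⟩ := Metric.eventually_nhds_iff_ball.1
    (hQF.eventually_nhds.and hF.eventually_analyticAt)
  set r₁ := min r r'
  have hr₁ : 0 < r₁ := lt_min hr hr'
  refine ⟨param y '' Metric.ball c r₁, ?_, ?_⟩
  · rw [nhds_eq_map_param y]
    exact image_mem_map (Metric.ball_mem_nhds _ hr₁)
  intro ρ hρ
  obtain ⟨K, hK, hbd⟩ := hcore ρ hρ
  have hpr : (0 : ℝ) < p := by exact_mod_cast hp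
  -- The extra factor compares spherical with Euclidean derivatives; along a product only the
  -- conformal factors at its two ends survive.
  set K' : ℝ := K * (1 + (‖c‖ + r₁) ^ 2)
  have hK' : 0 ≤ K' := by positivity
  refine ⟨fun j => K' * ((j : ℝ) + 1) ^ (-((p + 1 : ℝ) / p)), fun j => by positivity,
    fun τ hτ => ?_, ?_⟩
  · have h1 : 1 < (p + 1 : ℝ) / p * τ := by
      have h2 : (p : ℝ) / (p + 1) < τ := hs₀.trans_le hτ
      rw [div_lt_iff₀ (by positivity)] at h2
      rw [div_mul_eq_mul_div, lt_div_iff₀ hpr]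
      linarith
    have h2 := ((summable_nat_add_iff 1).2 (Real.summable_nat_rpow_inv.2 h1)).mul_left (K' ^ τ)
    refine h2.congr fun j => ?_
    rw [Real.mul_rpow hK' (by positivity), ← Real.rpow_mul (by positivity), neg_mul,
      Real.rpow_neg (by positivity)]
    push_cast
    rfl
  · rintro j hj v ⟨t, ht, rfl⟩ hvρ hvi
    have hR : ∀ i ≤ j, ∃ s ∈ Metric.ball c r₁, param y s = Q^[i] (param y t) := by
      intro i hi
      rcases Nat.eq_zero_or_pos i with rfl | hi0
      · exact ⟨t, ht, rfl⟩
      · exact (hvi i hi0 hi).1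
    have hrep : ∀ i ≤ j, Q^[i] (param y t) = param y (c + G^[i] (t - c)) ∧
        c + G^[i] (t - c) ∈ Metric.ball c r₁ := by
      intro i
      induction i with
      | zero => intro _; simpa using ht
      | succ i ih =>
        intro hi
        obtain ⟨h1, h2⟩ := ih (by omega)
        have h3 : Q^[i + 1] (param y t) = param y (c + G^[i + 1] (t - c)) := by
          rw [Function.iterate_succ_apply', h1,
            (hball _ (Metric.ball_subset_ball (min_le_right _ _) h2)).1.self_of_nhds,
            Function.iterate_succ_apply']
          congr 1
          simp only [hG]; ring
        refine ⟨h3, ?_⟩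
        obtain ⟨s, hs, hs'⟩ := hR (i + 1) hi
        rw [h3] at hs'
        rwa [← param_injective y hs']
    have hnorm : ∀ i ≤ j, ‖G^[i] (t - c)‖ < r := by
      intro i hi
      have := (hrep i hi).2
      rw [Metric.mem_ball, dist_eq_norm, add_sub_cancel_left] at this
      exact this.trans_le (min_le_left _ _)
    have hρt : ρ ≤ ‖t - c‖ := by
      refine hvρ.trans ?_
      have h1 := chord_param y t c
      rw [show param y c = y from param_chart_self y] at h1
      rw [h1]
      have hle : ∀ s, confFactor s ≤ 1 := fun s => by
        unfold confFactor
        refine inv_le_one_of_one_le₀ (Real.one_le_sqrt.2 ?_)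
        nlinarith [sq_nonneg ‖s‖]
      calc ‖t - c‖ * (confFactor t * confFactor c) ≤ ‖t - c‖ * (1 * 1) := by
            have := (confFactor_pos t).le
            have := (confFactor_pos c).le
            gcongr
            · exact hle t
            · exact hle c
        _ = ‖t - c‖ := by ring
    have hprod : ∀ n ≤ j, ∏ i ∈ Finset.range n, sphericalDeriv Q (Q^[i] (param y t)) =
        (∏ i ∈ Finset.range n, ‖deriv G (G^[i] (t - c))‖) * (1 + ‖t‖ ^ 2) /
          (1 + ‖c + G^[n] (t - c)‖ ^ 2) := by
      intro n
      induction n with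
      | zero =>
        intro _
        have : (1 + ‖t‖ ^ 2) ≠ 0 := by positivity
        simp [this]
      | succ n ih =>
        intro hn
        obtain ⟨h1, h2⟩ := hrep n (by omega)
        have h3 := hball _ (Metric.ball_subset_ball (min_le_right _ _) h2)
        have h4 : sphericalDeriv Q (param y (c + G^[n] (t - c))) = _ :=
          sphericalDeriv_eq (b := false) (show AnAt false F _ from h3.2) h3.1
        have h5 : F (c + G^[n] (t - c)) = c + G^[n + 1] (t - c) := by
          rw [Function.iterate_succ_apply']; simp only [hG]; ring
        rw [Finset.prod_range_succ, Finset.prod_range_succ, ih (by omega), h1, h4, h5, hGder]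
        have h6 : (fun s => cconj false (F s)) = F := rfl
        have h7 : (1 + ‖c + G^[n] (t - c)‖ ^ 2) ≠ 0 := by positivity
        rw [h6]
        field_simp
    rw [hprod j le_rfl]
    have h1 := hbd j (t - c) hρt hnorm
    have h2 : ‖t‖ ≤ ‖c‖ + r₁ := by
      have h3 : ‖t - c‖ < r₁ := by rwa [← dist_eq_norm]
      calc ‖t‖ = ‖c + (t - c)‖ := by congr 1; ring
        _ ≤ ‖c‖ + ‖t - c‖ := norm_add_le _ _
        _ ≤ _ := by linarith
    refine (div_le_self (by positivity) (by nlinarith [sq_nonneg ‖c + G^[j] (t - c)‖])).trans ?_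
    calc _ ≤ (K * ((j : ℝ) + 1) ^ (-((p + 1 : ℝ) / p))) * (1 + (‖c‖ + r₁) ^ 2) := by
          gcongr
      _ = _ := by simp only [K']; ring
namespace Correspondence

/-! ### Sums over branches -/

section BranchSums

variable {F : Correspondence} {S : Set RiemannSphere} {x : RiemannSphere} {U : Set RiemannSphere}

theorem isBranchAt_of_mem_branches (hU : F.IsBranchDomain x U) {n : ℕ}
    {f : RiemannSphere → RiemannSphere} (hf : f ∈ F.branches n U) {z : RiemannSphere}
    (hz : z ∈ U) : F.IsBranchAt n f z := by
  have h := isBranchOn_iff.1 hf.1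
  exact ⟨mem_of_superset (hU.1.mem_nhds hz) fun u hu => (h u hu).1, (h z hz).2⟩

/-- The identity theorem on the connected set `U`; outside `U` both functions are `∞` by
normalization. Branches can thus be counted by their germs at `x`. -/
theorem eq_of_eventuallyEq (hU : F.IsBranchDomain x U) {n : ℕ}
    {f g : RiemannSphere → RiemannSphere} (hf : f ∈ F.branches n U) (hg : g ∈ F.branches n U)
    (h : f =ᶠ[𝓝 x] g) : f = g := by
  have h1 := eqOn_of_eventuallyEq hU.2.1.isPreconnected
    (fun z hz => (isBranchAt_of_mem_branches hU hf hz).2)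
    (fun z hz => (isBranchAt_of_mem_branches hU hg hz).2) hU.2.2.1 h
  funext z
  by_cases hz : z ∈ U
  · exact h1 hz
  · rw [hf.2 z hz, hg.2 z hz]

/-- A property of the values of the branches of `Fⁿ` that holds for some branch at each point holds
frequently for one branch. -/
theorem exists_frequently_branch (hU : F.IsBranchDomain x U) {n : ℕ}
    {p : RiemannSphere → RiemannSphere → Prop}
    (h : ∀ᶠ u in 𝓝 x, ∃ w ∈ F.iter n u, p u w) :
    ∃ g ∈ F.branches n U, ∃ᶠ u in 𝓝[≠] x, p u (g u) := by
  by_contra hcon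
  push Not at hcon
  have h1 : ∀ᶠ u in 𝓝[≠] x, ∀ g ∈ F.branches n U, ¬ p u (g u) := by
    -- Pigeonhole over finitely many branches: if each of them failed eventually, all would fail at
    -- a common point. "Frequently" is enough for the identity theorem.
    rw [eventually_all_finite (hU.2.2.2 n).1]
    exact fun g hg => hcon g hg
  have hUx : ∀ᶠ u in 𝓝 x, u ∈ U := hU.1.mem_nhds hU.2.2.1
  obtain ⟨u, hu1, hu2, w, hw, hp⟩ :=
    (h1.and ((hUx.and h).filter_mono nhdsWithin_le_nhds)).exists
  rw [(hU.2.2.2 n).2 u hu2] at hw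
  obtain ⟨g, hg, rfl⟩ := hw
  exact hu1 g hg hp

theorem exists_branch_eventuallyEq (hU : F.IsBranchDomain x U) {n : ℕ}
    {f : RiemannSphere → RiemannSphere} (hf : F.IsBranchAt n f x) :
    ∃ g ∈ F.branches n U, f =ᶠ[𝓝 x] g := by
  obtain ⟨g, hg, hfg⟩ := exists_frequently_branch hU (n := n) (p := fun u w => f u = w)
    (hf.1.mono fun u hu => ⟨f u, hu, rfl⟩)
  exact ⟨g, hg, hf.2.eventuallyEq_of_frequently (isBranchAt_of_mem_branches hU hg hU.2.2.1).2 hfg⟩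

/-- Matching germs at `x` injects the branches on `U'` into those on `U` and preserves derivatives.
By symmetry the sums do not depend on the domain. -/
theorem branchSum_le {U' : Set RiemannSphere} (hU : F.IsBranchDomain x U)
    (hU' : F.IsBranchDomain x U') (t : ℕ → ℝ) : F.branchSum x U' t ≤ F.branchSum x U t := by
  refine ENNReal.tsum_le_tsum fun n => ?_
  have h : ∀ f : F.branches n U', ∃ g : F.branches n U, f.1 =ᶠ[𝓝 x] g.1 := fun f => by
    obtain ⟨g, hg, hfg⟩ := exists_branch_eventuallyEq hU
      (isBranchAt_of_mem_branches hU' f.2 hU'.2.2.1)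
    exact ⟨⟨g, hg⟩, hfg⟩
  choose m hm using h
  have hinj : Function.Injective m := fun f f' hff => Subtype.ext
    (eq_of_eventuallyEq hU' f.2 f'.2 ((hm f).trans (hff ▸ (hm f').symm)))
  calc ∑' f : F.branches n U', ENNReal.ofReal (sphericalDeriv f.1 x) ^ t n
      = ∑' f : F.branches n U', ENNReal.ofReal (sphericalDeriv (m f).1 x) ^ t n := by
        refine tsum_congr fun f => ?_
        rw [(isBranchAt_of_mem_branches hU' f.2 hU'.2.2.1).2.sphericalDeriv_congr (hm f)]
    _ ≤ _ := ENNReal.tsum_comp_le_tsum_of_injective hinj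
        fun g : F.branches n U => ENNReal.ofReal (sphericalDeriv g.1 x) ^ t n

theorem poincare_eq (hU : F.IsBranchDomain x U) (s : ℝ) :
    F.poincare x s = F.branchSum x U fun _ => s :=
  le_antisymm (iInf₂_le U hU) (le_iInf₂ fun _ hU' => branchSum_le hU' hU _)

/-! ### Weights of branches and the measures μ_s -/

/-- The index set of all branches of all iterates. -/
abbrev BranchIndex (F : Correspondence) (U : Set RiemannSphere) : Type :=
  Σ n : ℕ, F.branches n U

/-- The derivative at `x` of an indexed branch. -/
def bderiv (x : RiemannSphere) (i : F.BranchIndex U) : ℝ≥0∞ :=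
  ENNReal.ofReal (sphericalDeriv i.2.1 x)

/-- The weight of an indexed branch. -/
def weight (x : RiemannSphere) (t : ℕ → ℝ) (i : F.BranchIndex U) : ℝ≥0∞ := bderiv x i ^ t i.1

theorem branchSum_eq (t : ℕ → ℝ) :
    F.branchSum x U t = ∑' i : F.BranchIndex U, weight x t i :=
  (ENNReal.tsum_sigma' (weight x t)).symm

/-- The total weight of the branches with values in `V`. -/
def localSum (F : Correspondence) (x : RiemannSphere) (U : Set RiemannSphere) (t : ℕ → ℝ)
    (V : Set RiemannSphere) : ℝ≥0∞ :=
  ∑' i : {i : F.BranchIndex U // i.2.1 x ∈ V}, weight x t i.1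

theorem orbitMeasure_apply (t : ℕ → ℝ) {V : Set RiemannSphere} (hV : MeasurableSet V) :
    F.orbitMeasure x U t V = (F.branchSum x U t)⁻¹ * F.localSum x U t V := by
  rw [orbitMeasure, Measure.smul_apply, smul_eq_mul, Measure.sum_apply _ hV]
  congr 1
  have h : F.localSum x U t V =
      ∑' i, Set.indicator {i : F.BranchIndex U | i.2.1 x ∈ V} (weight x t) i :=
    tsum_subtype _ _
  rw [h, ENNReal.tsum_sigma']
  refine tsum_congr fun n => ?_
  rw [Measure.sum_apply _ hV]
  refine tsum_congr fun f => ?_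
  rw [Measure.smul_apply, Measure.dirac_apply' _ hV, smul_eq_mul]
  by_cases h : f.1 x ∈ V
  · rw [Set.indicator_of_mem h, Set.indicator_of_mem (show _ ∈ {i : F.BranchIndex U | i.2.1 x ∈ V}
      from h)]
    simp [weight, bderiv]
  · rw [Set.indicator_of_notMem h, Set.indicator_of_notMem
      (show _ ∉ {i : F.BranchIndex U | i.2.1 x ∈ V} from h), mul_zero]

/-- The properties of the exponents `t s n` that matter for the limit measures. -/
structure GoodScheme (F : Correspondence) (x : RiemannSphere) (U : Set RiemannSphere) (δ : ℝ)
    (t : ℝ → ℕ → ℝ) : Prop where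
  pos : 0 < δ
  mono : ∀ᶠ s in 𝓝[>] δ, ∀ m n, m ≤ n → t s m ≤ t s n ∧ t s n ≤ t s m + 1
  range : ∀ a < δ, ∀ b > δ, ∀ᶠ s in 𝓝[>] δ, ∀ n, a ≤ t s n ∧ t s n ≤ b
  tendsto : Tendsto (fun s => F.branchSum x U (t s)) (𝓝[>] δ) (𝓝 ⊤)
  finite : ∃ s > 0, F.branchSum x U (fun _ => s) ≠ ⊤

/-- In both cases the exponents lie between 2δ - s and s and do not decrease with the level; nothing
else about `h` matters apart from divergence of the total. -/
theorem IsExponentScheme.goodScheme (hU : F.IsBranchDomain x U) {t : ℝ → ℕ → ℝ}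
    (ht : F.IsExponentScheme x U t) (hpos : 0 < F.critExp x) (hfin : F.critExp x < ⊤) :
    F.GoodScheme x U (F.critExp x).toReal t := by
  set δ := (F.critExp x).toReal with hδ
  have hδ0 : 0 < δ := ENNReal.toReal_pos hpos.ne' hfin.ne
  have hclose : ∀ η > 0, ∀ᶠ s in 𝓝[>] δ, δ < s ∧ s < δ + η := fun η hη =>
    Ioo_mem_nhdsGT (by linarith)
  have hval : ∀ s, δ < s → (∀ m n, m ≤ n → t s m ≤ t s n ∧ t s n ≤ t s m + 2 * (s - δ)) ∧
      ∀ n, 2 * δ - s ≤ t s n ∧ t s n ≤ s := by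
    intro s hs
    rcases ht with ⟨-, rfl⟩ | ⟨-, h, -, rfl, -⟩
    · refine ⟨fun m n _ => ⟨le_rfl, by linarith⟩, fun n => ⟨by linarith, le_rfl⟩⟩
    · refine ⟨fun m n hmn => ?_, fun n => ?_⟩
      · have hmn' : (m : ℝ) ≤ n := by exact_mod_cast hmn
        unfold alteredExp
        rw [← hδ]
        split_ifs with h1 h2 h2 <;> constructor <;> linarith
      · unfold alteredExp
        rw [← hδ]
        split_ifs <;> constructor <;> linarith
  refine ⟨hδ0, ?_, ?_, ?_, ?_⟩
  · filter_upwards [hclose (1 / 2) (by norm_num)] with s hs m n hmn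
    obtain ⟨h1, h2⟩ := (hval s hs.1).1 m n hmn
    exact ⟨h1, by linarith [hs.2]⟩
  · intro a ha b hb
    filter_upwards [hclose (δ - a) (by linarith), hclose (b - δ) (by linarith)] with s hs hs' n
    obtain ⟨h1, h2⟩ := (hval s hs.1).2 n
    exact ⟨by linarith [hs.2], by linarith [hs'.2]⟩
  · rcases ht with ⟨h, rfl⟩ | ⟨-, h, -, -, h'⟩
    · exact h.congr fun s => poincare_eq hU s
    · exact h'
  · rw [critExp, iInf_lt_iff] at hfin
    obtain ⟨s, hs⟩ := hfin
    rw [iInf_lt_iff] at hs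
    obtain ⟨⟨h1, h2⟩, -⟩ := hs
    exact ⟨s, h1, by rw [← poincare_eq hU]; exact h2.ne⟩

/-! ### Negligible points -/

/-- The limit measures give arbitrarily small mass to small neighbourhoods of `y`. -/
def Small (F : Correspondence) (x : RiemannSphere) (U : Set RiemannSphere) (δ : ℝ)
    (t : ℝ → ℕ → ℝ) (y : RiemannSphere) : Prop :=
  ∀ ε : ℝ≥0∞, ε ≠ 0 → ∃ V ∈ 𝓝 y, ∀ᶠ s in 𝓝[>] δ,
    F.localSum x U (t s) V ≤ ε * F.branchSum x U (t s)

/-- Removes the dependence on an exponent that varies in an interval, whether the base is below or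
above 1. -/
theorem rpow_le_add {a : ℝ≥0∞} {p q r : ℝ} (hpq : p ≤ q) (hqr : q ≤ r) :
    a ^ q ≤ a ^ p + a ^ r := by
  rcases le_total a 1 with h | h
  · exact (ENNReal.rpow_le_rpow_of_exponent_ge h hpq).trans le_self_add
  · exact (ENNReal.rpow_le_rpow_of_exponent_le h hqr).trans le_add_self

theorem bderiv_ne_top (i : F.BranchIndex U) : bderiv x i ≠ ⊤ := ENNReal.ofReal_ne_top

theorem GoodScheme.eventually_le {δ : ℝ} {t : ℝ → ℕ → ℝ} (ht : F.GoodScheme x U δ t)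
    {C : ℝ≥0∞} (hC : C ≠ ⊤) {ε : ℝ≥0∞} (hε : ε ≠ 0) :
    ∀ᶠ s in 𝓝[>] δ, C ≤ ε * F.branchSum x U (t s) := by
  rcases eq_or_ne ε ⊤ with rfl | hε'
  · filter_upwards [ht.tendsto.eventually (lt_mem_nhds ENNReal.zero_lt_top)] with s hs
    rw [ENNReal.top_mul hs.ne']
    exact le_top
  · have h : C / ε < ⊤ := ENNReal.div_lt_top hC hε
    filter_upwards [ht.tendsto.eventually (lt_mem_nhds h)] with s hs
    rw [mul_comm]
    exact (ENNReal.div_le_iff hε hε').1 hs.le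

theorem GoodScheme.exists_finite_bound {δ : ℝ} {t : ℝ → ℕ → ℝ} (ht : F.GoodScheme x U δ t)
    {E : Set (F.BranchIndex U)} (hE : E.Finite) :
    ∃ C : ℝ≥0∞, C ≠ ⊤ ∧ ∀ᶠ s in 𝓝[>] δ, ∑' i : E, weight x (t s) i.1 ≤ C := by
  have : Fintype E := hE.fintype
  refine ⟨∑' i : E, (bderiv x i.1 ^ (δ / 2) + bderiv x i.1 ^ (δ + 1)), ?_, ?_⟩
  · rw [tsum_fintype]
    refine ENNReal.sum_ne_top.2 fun i _ => ENNReal.add_ne_top.2 ⟨?_, ?_⟩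
    · exact ENNReal.rpow_ne_top_of_nonneg (by linarith [ht.pos]) (bderiv_ne_top _)
    · exact ENNReal.rpow_ne_top_of_nonneg (by linarith [ht.pos]) (bderiv_ne_top _)
  · filter_upwards [ht.range (δ / 2) (by linarith [ht.pos]) (δ + 1) (by linarith)] with s hs
    exact ENNReal.tsum_le_tsum fun i => rpow_le_add (hs _).1 (hs _).2

theorem finite_setOf_level_lt (hU : F.IsBranchDomain x U) (n : ℕ) :
    {i : F.BranchIndex U | i.1 < n}.Finite := by
  have h : {i : F.BranchIndex U | i.1 < n} ⊆
      ⋃ k ∈ Finset.range n, Set.range fun f : F.branches k U => (⟨k, f⟩ : F.BranchIndex U) := by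
    rintro ⟨k, f⟩ hk
    simp only [Set.mem_iUnion]
    exact ⟨k, Finset.mem_range.2 hk, f, rfl⟩
  refine Set.Finite.subset (Set.Finite.biUnion (Finset.finite_toSet _) fun k _ => ?_) h
  have : Finite (F.branches k U) := (hU.2.2.2 k).1
  exact Set.finite_range _

/-- Each term of a convergent Poincaré series is at most its sum. -/
theorem GoodScheme.exists_deriv_bound {δ : ℝ} {t : ℝ → ℕ → ℝ} (ht : F.GoodScheme x U δ t) :
    ∃ M : ℝ≥0∞, 1 ≤ M ∧ M ≠ ⊤ ∧ ∀ i : F.BranchIndex U, bderiv x i ≤ M := by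
  obtain ⟨s, hs, hfin⟩ := ht.finite
  rw [branchSum_eq] at hfin
  refine ⟨max 1 ((∑' i : F.BranchIndex U, weight x (fun _ => s) i) ^ s⁻¹), le_max_left _ _,
    ?_, fun i => le_max_of_le_right ?_⟩
  · exact (max_lt ENNReal.one_lt_top
      (ENNReal.rpow_ne_top_of_nonneg (by positivity) hfin).lt_top).ne
  · rw [ENNReal.le_rpow_inv_iff hs]
    exact ENNReal.le_tsum (f := weight x fun _ => s) i

/-- Compares the exponents of a branch and of one of its initial segments, which in an altered
series may differ. -/
theorem rpow_le_mul_rpow {a M : ℝ≥0∞} (hM : 1 ≤ M) (ha : a ≤ M) {p q : ℝ} (hp : 0 ≤ p)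
    (hpq : p ≤ q) (hq : q ≤ p + 1) : a ^ q ≤ M * a ^ p := by
  have h : q = (q - p) + p := by ring
  rw [h, ENNReal.rpow_add_of_nonneg _ _ (by linarith) hp]
  gcongr
  calc a ^ (q - p) ≤ M ^ (q - p) := ENNReal.rpow_le_rpow ha (by linarith)
    _ ≤ M ^ (1 : ℝ) := ENNReal.rpow_le_rpow_of_exponent_le hM (by linarith)
    _ = M := ENNReal.rpow_one M

/-- Only branches of low level, hence finitely many, end in some fixed `V`; their bounded weight is
negligible against the diverging total. -/
theorem small_of_notMem_limitSet (hU : F.IsBranchDomain x U) {δ : ℝ} {t : ℝ → ℕ → ℝ}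
    (ht : F.GoodScheme x U δ t) {y : RiemannSphere} (hy : y ∉ F.limitSet x) :
    ∃ V ∈ 𝓝 y, ∀ ε : ℝ≥0∞, ε ≠ 0 → ∀ᶠ s in 𝓝[>] δ,
      F.localSum x U (t s) V ≤ ε * F.branchSum x U (t s) := by
  rw [mem_limitSet_iff] at hy
  push Not at hy
  obtain ⟨V, hV, n, hn⟩ := hy
  have hfin : {i : F.BranchIndex U | i.2.1 x ∈ V}.Finite := by
    refine (finite_setOf_level_lt hU n).subset fun i hi => ?_
    by_contra hlt
    have hb := (isBranchAt_of_mem_branches hU i.2.2 hU.2.2.1).1.self_of_nhds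
    exact hn i.1 (not_lt.1 hlt) _ hi hb
  obtain ⟨C, hC, hCs⟩ := ht.exists_finite_bound hfin
  refine ⟨V, hV, fun ε hε => ?_⟩
  filter_upwards [hCs, ht.eventually_le hC hε] with s h1 h2
  exact h1.trans h2

/-- The standing assumptions on the correspondence, the set `S` and the base point. -/
structure Setting (F : Correspondence) (S : Set RiemannSphere) (x : RiemannSphere) : Prop where
  isClosed : IsClosed S
  inverseLike : F.InvariantlyInverseLike S
  mem : x ∈ S
  sing : F.limitSet x ∩ F.singularSet = ∅

theorem Setting.notMem_singularSet (h : F.Setting S x) {z : RiemannSphere}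
    (hz : z ∈ F.limitSet x) : z ∉ F.singularSet := fun h' => by
  have : z ∈ F.limitSet x ∩ F.singularSet := ⟨hz, h'⟩
  rwa [h.sing] at this

/-- A branch of `Fᵐ⁺ᴺ` with value near `w` factors through the branch of `Fᴺ` from `y` to `w`. -/
theorem Setting.exists_factor (h : F.Setting S x) (hU : F.IsBranchDomain x U) {N : ℕ}
    {Q : RiemannSphere → RiemannSphere} {y w : RiemannSphere} (hy : y ∈ S)
    (hw : w ∈ F.limitSet x) (hQ : F.IsBranchAt N Q y) (hQy : Q y = w) {A : Set RiemannSphere}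
    (hA : A ∈ 𝓝 y) : ∃ V ∈ 𝓝 w, ∀ m, ∀ f ∈ F.branches (m + N) U, f x ∈ V →
      ∃ f' ∈ F.branches m U, f' x ∈ A ∧ F.IsBranchAt N Q (f' x) ∧ f =ᶠ[𝓝 x] Q ∘ f' := by
  have hwy : w ∈ F.iter N y := hQy ▸ hQ.1.self_of_nhds
  obtain ⟨A₁, hA₁, B₁, hB₁, hAB⟩ :=
    h.inverseLike.exists_nhds_unique h.isClosed h.mem h.sing hy hw hwy
  have hQB : ∀ᶠ v in 𝓝 y, Q v ∈ B₁ := hQ.2.continuousAt (by rwa [hQy])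
  have hA' : ∀ᶠ v in 𝓝 y, v ∈ A := hA
  have hA₁' : ∀ᶠ v in 𝓝 y, v ∈ A₁ := hA₁
  obtain ⟨A₂, hA₂s, hA₂, hyA₂⟩ := eventually_nhds_iff.1
    (hA'.and (hA₁'.and (hQB.and hQ.eventually)))
  obtain ⟨V, hV, hVA⟩ := h.inverseLike.exists_nhds_preimage h.isClosed hy hwy
    (hA₂.mem_nhds hyA₂)
  refine ⟨V ∩ interior B₁, inter_mem hV (interior_mem_nhds.2 hB₁), fun m f hf hfx => ?_⟩
  have hfx' := isBranchAt_of_mem_branches hU hf hU.2.2.1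
  -- For each u near x, f(u) is reached through some point of F^m(u); a single branch `f'` supplies
  -- this point for u accumulating at x.
  obtain ⟨f', hf', hfreq⟩ := exists_frequently_branch hU (n := m)
    (p := fun u v => f u ∈ F.iter N v) (hfx'.1.mono fun u hu => by
      obtain ⟨v, hv, hfv⟩ := mem_iter_add.1 hu
      exact ⟨v, hv, hfv⟩)
  have hbx := isBranchAt_of_mem_branches hU hf' hU.2.2.1
  have hmem : f x ∈ F.iter N (f' x) := by
    have : (f' x, f x) ∈ F.iterGraph N :=
      (F.isClosed_iterGraph N).mem_of_frequently_of_tendsto hfreq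
        ((hbx.2.continuousAt.prodMk hfx'.2.continuousAt).tendsto.mono_left nhdsWithin_le_nhds)
    exact this
  have hf'S : f' x ∈ S := h.inverseLike.iter_subset h.mem m hbx.1.self_of_nhds
  have hf'A : f' x ∈ A₂ := hVA _ hfx.1 _ hf'S hmem
  have hg := hA₂s _ hf'A
  refine ⟨f', hf', hg.1, hg.2.2.2, ?_⟩
  have hcomp := hg.2.2.2.comp hbx
  refine hfx'.2.eventuallyEq_of_frequently hcomp.2 ?_
  have hev : ∀ᶠ u in 𝓝[≠] x, f u ∈ B₁ ∧ f' u ∈ A₂ := by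
    refine Eventually.filter_mono nhdsWithin_le_nhds (Eventually.and ?_ ?_)
    · exact hfx'.2.continuousAt.eventually (mem_interior_iff_mem_nhds.1 hfx.2)
    · exact hbx.2.continuousAt.eventually (hA₂.mem_nhds hf'A)
  -- At these u both f(u) and Q(f'(u)) are values of F^N at f'(u) close to `w`, so they coincide by
  -- local uniqueness.
  refine (hfreq.and_eventually hev).mono ?_
  rintro u ⟨h1, h2, h3⟩
  have h4 := hA₂s _ h3
  exact hAB _ h4.2.1 _ h2 _ h4.2.2.1 h1 h4.2.2.2.1.self_of_nhds

theorem bderiv_comp (hU : F.IsBranchDomain x U) {N m n : ℕ}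
    {Q : RiemannSphere → RiemannSphere} (f : F.branches n U) (f' : F.branches m U)
    (hQ : F.IsBranchAt N Q (f'.1 x)) (h : f.1 =ᶠ[𝓝 x] Q ∘ f'.1) :
    sphericalDeriv f.1 x = sphericalDeriv Q (f'.1 x) * sphericalDeriv f'.1 x := by
  rw [(isBranchAt_of_mem_branches hU f.2 hU.2.2.1).2.sphericalDeriv_congr h]
  exact hQ.2.sphericalDeriv_comp (isBranchAt_of_mem_branches hU f'.2 hU.2.2.1).2

/-- Negligibility propagates along the correspondence inside the limit set. -/
theorem Setting.small_image (h : F.Setting S x) (hU : F.IsBranchDomain x U) {δ : ℝ}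
    {t : ℝ → ℕ → ℝ} (ht : F.GoodScheme x U δ t) {y w : RiemannSphere}
    (hy : y ∈ F.limitSet x) (hw : w ∈ F.limitSet x) (hwy : w ∈ F.image y)
    (hsmall : F.Small x U δ t y) : F.Small x U δ t w := by
  obtain ⟨Q, hQ, hQy⟩ := exists_isBranchAt (h.notMem_singularSet hy) hwy
  have hyS := limitSet_subset h.isClosed h.inverseLike h.mem hy
  set κ := ENNReal.ofReal (sphericalDeriv Q y + 1)
  obtain ⟨M, hM1, hM, hMb⟩ := ht.exists_deriv_bound (F := F) (U := U)
  -- The first factor bounds the derivative of the extra step, with base at least 1 so that its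
  -- exponent can be raised to δ + 1; `M` pays for the change of exponent from one level to the
  -- next.
  set K : ℝ≥0∞ := (1 + κ) ^ (δ + 1) * M
  have hK : K ≠ ⊤ := by
    refine ENNReal.mul_ne_top (ENNReal.rpow_ne_top_of_nonneg (by linarith [ht.pos]) ?_) hM
    exact ENNReal.add_ne_top.2 ⟨ENNReal.one_ne_top, ENNReal.ofReal_ne_top⟩
  have hK0 : K ≠ 0 := by
    refine mul_ne_zero ?_ (one_pos.trans_le hM1).ne'
    have h1 : (1 : ℝ≥0∞) ≤ (1 + κ) ^ (δ + 1) :=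
      ENNReal.one_le_rpow le_self_add (by linarith [ht.pos])
    exact (one_pos.trans_le h1).ne'
  intro ε hε
  obtain ⟨V, hV, hVs⟩ := hsmall (ε / 2 / K) (by
    simp [ENNReal.div_eq_zero_iff, hε, hK])
  have hκ : ∀ᶠ v in 𝓝 y, sphericalDeriv Q v < sphericalDeriv Q y + 1 :=
    hQ.2.continuousAt_sphericalDeriv.eventually_lt_const (lt_add_one _)
  obtain ⟨W, hW, hWf⟩ := h.exists_factor hU hyS hw hQ hQy (inter_mem hV hκ)
  obtain ⟨C, hC, hCs⟩ := ht.exists_finite_bound (finite_setOf_level_lt hU 1)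
  refine ⟨W, hW, ?_⟩
  -- Strip the last step. Level 0 has none and is estimated separately as a finite set.
  have hex : ∀ i : {i : F.BranchIndex U // i.2.1 x ∈ W ∧ ¬ i.1 < 1},
      ∃ j : {j : F.BranchIndex U // j.2.1 x ∈ V}, i.1.1 = j.1.1 + 1 ∧
        i.1.2.1 =ᶠ[𝓝 x] Q ∘ j.1.2.1 ∧ bderiv x i.1 ≤ (1 + κ) * bderiv x j.1 := by
    rintro ⟨⟨n, f⟩, hf, hn⟩
    obtain ⟨m, rfl⟩ : ∃ m, n = m + 1 := ⟨n - 1, by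
      have : ¬ n < 1 := hn
      omega⟩
    obtain ⟨f', hf', hfV, hQf, heq⟩ := hWf m f.1 f.2 hf
    refine ⟨⟨⟨m, f', hf'⟩, hfV.1⟩, rfl, heq, ?_⟩
    have h1 := bderiv_comp hU f ⟨f', hf'⟩ hQf heq
    simp only [bderiv]
    rw [h1, ENNReal.ofReal_mul (sphericalDeriv_nonneg _ _)]
    gcongr
    exact (ENNReal.ofReal_le_ofReal (le_of_lt hfV.2)).trans le_add_self
  choose g hg1 hg2 hg3 using hex
  have hginj : Function.Injective g := by
    rintro ⟨⟨n, f⟩, hf⟩ ⟨⟨n', f'⟩, hf'⟩ heq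
    have h1 : n = n' := by
      have h1 := hg1 ⟨⟨n, f⟩, hf⟩
      have h2 := hg1 ⟨⟨n', f'⟩, hf'⟩
      rw [heq, ← h2] at h1
      exact h1
    subst h1
    have h3 := (hg2 ⟨⟨n, f⟩, hf⟩).trans (heq ▸ (hg2 ⟨⟨n, f'⟩, hf'⟩).symm)
    have h4 := eq_of_eventuallyEq hU f.2 f'.2 h3
    have h5 : f = f' := Subtype.ext h4
    subst h5
    rfl
  filter_upwards [hVs, hCs, ht.eventually_le hC (ε := ε / 2) (by simpa using hε), ht.mono,
    ht.range 0 ht.pos (δ + 1) (by linarith)] with s h1 h2 h3 h4 h5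
  have h6 : ∑' i : {i : F.BranchIndex U // i.2.1 x ∈ W ∧ ¬ i.1 < 1}, weight x (t s) i.1 ≤
      K * F.localSum x U (t s) V := by
    calc _ ≤ ∑' i : {i : F.BranchIndex U // i.2.1 x ∈ W ∧ ¬ i.1 < 1},
          K * weight x (t s) (g i).1 := by
          refine ENNReal.tsum_le_tsum fun i => ?_
          have h7 := h4 (g i).1.1 i.1.1 (by rw [hg1 i]; omega)
          calc weight x (t s) i.1 ≤ ((1 + κ) * bderiv x (g i).1) ^ t s i.1.1 :=
                ENNReal.rpow_le_rpow (hg3 i) (h5 _).1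
            _ = (1 + κ) ^ t s i.1.1 * bderiv x (g i).1 ^ t s i.1.1 :=
                ENNReal.mul_rpow_of_nonneg _ _ (h5 _).1
            _ ≤ (1 + κ) ^ (δ + 1) * (M * bderiv x (g i).1 ^ t s (g i).1.1) := by
                gcongr
                · exact le_self_add
                · exact (h5 _).2
                · exact rpow_le_mul_rpow hM1 (hMb _) (h5 _).1 h7.1 h7.2
            _ = _ := (mul_assoc _ _ _).symm
      _ ≤ ∑' j : {j : F.BranchIndex U // j.2.1 x ∈ V}, K * weight x (t s) j.1 :=
          ENNReal.tsum_comp_le_tsum_of_injective hginj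
            fun j : {j : F.BranchIndex U // j.2.1 x ∈ V} => K * weight x (t s) j.1
      _ = _ := ENNReal.tsum_mul_left
  have h7 : F.localSum x U (t s) W ≤
      ∑' i : {i : F.BranchIndex U | i.1 < 1}, weight x (t s) i.1 +
      ∑' i : {i : F.BranchIndex U // i.2.1 x ∈ W ∧ ¬ i.1 < 1}, weight x (t s) i.1 := by
    refine le_trans ?_ (ENNReal.tsum_union_le (weight x (t s)) {i : F.BranchIndex U | i.1 < 1}
      {i : F.BranchIndex U | i.2.1 x ∈ W ∧ ¬ i.1 < 1})
    refine ENNReal.tsum_mono_subtype (weight x (t s)) (s := {i : F.BranchIndex U | i.2.1 x ∈ W})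
      fun i hi => ?_
    by_cases hi1 : i.1 < 1
    · exact Or.inl hi1
    · exact Or.inr ⟨hi, hi1⟩
  calc F.localSum x U (t s) W ≤ ε / 2 * F.branchSum x U (t s) +
        K * (ε / 2 / K * F.branchSum x U (t s)) := by
        refine h7.trans (add_le_add (h2.trans h3) (h6.trans ?_))
        gcongr
    _ = ε / 2 * F.branchSum x U (t s) + ε / 2 * F.branchSum x U (t s) := by
        rw [← mul_assoc, ENNReal.mul_div_cancel hK0 hK]
    _ = ε * F.branchSum x U (t s) := by rw [← add_mul, ENNReal.add_halves]

end BranchSums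

end Correspondence

namespace Correspondence

/-! ### Negligibility of periodic points -/

section Periodic

variable {F : Correspondence} {S : Set RiemannSphere} {x : RiemannSphere} {U : Set RiemannSphere}

/-- The branch `i` is the branch `i'` followed by `j` steps of `Q`, all of which end near `y`. -/
structure FactorsThrough (Q : RiemannSphere → RiemannSphere) (y : RiemannSphere)
    (R : Set RiemannSphere) (ρ : ℝ) (N : ℕ) (i : F.BranchIndex U) (j : ℕ)
    (i' : F.BranchIndex U) : Prop where
  level : i.1 = i'.1 + j * N
  eventuallyEq : i.2.1 =ᶠ[𝓝 x] Q^[j] ∘ i'.2.1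
  deriv : sphericalDeriv i.2.1 x =
    (∏ k ∈ Finset.range j, sphericalDeriv Q (Q^[k] (i'.2.1 x))) * sphericalDeriv i'.2.1 x
  near : ∀ k, 1 ≤ k → k ≤ j → Q^[k] (i'.2.1 x) ∈ R ∧ chord (Q^[k] (i'.2.1 x)) y < ρ
  mem_iter : i.2.1 x ∈ F.iter (j * N) (i'.2.1 x)

theorem FactorsThrough.left_unique (hU : F.IsBranchDomain x U) {Q : RiemannSphere → RiemannSphere}
    {y : RiemannSphere} {R : Set RiemannSphere} {ρ : ℝ} {N j : ℕ} {i₁ i₂ i' : F.BranchIndex U}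
    (h₁ : FactorsThrough (x := x) Q y R ρ N i₁ j i')
    (h₂ : FactorsThrough (x := x) Q y R ρ N i₂ j i') : i₁ = i₂ := by
  obtain ⟨n₁, f₁⟩ := i₁
  obtain ⟨n₂, f₂⟩ := i₂
  have h : n₁ = n₂ := h₁.level.trans h₂.level.symm
  subst h
  have h : f₁ = f₂ := Subtype.ext
    (eq_of_eventuallyEq hU f₁.2 f₂.2 (h₁.eventuallyEq.trans h₂.eventuallyEq.symm))
  subst h
  rfl

/-- Strong induction on the level, peeling off one `Q` at a time. The process stops when the value
leaves the ball or the level is below `N`; by `hlow` the value is then `y` itself. -/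
theorem exists_factorsThrough (hU : F.IsBranchDomain x U) {Q : RiemannSphere → RiemannSphere}
    {y : RiemannSphere} {R V : Set RiemannSphere} {ρ : ℝ} {N : ℕ} (hN : 1 ≤ N)
    (hV : ∀ m, ∀ f ∈ F.branches (m + N) U, f x ∈ V →
      ∃ f' ∈ F.branches m U, f' x ∈ R ∧ F.IsBranchAt N Q (f' x) ∧ f =ᶠ[𝓝 x] Q ∘ f')
    (hρ : ∀ z, chord z y < ρ → z ∈ V ∧ z ∈ R)
    (hlow : ∀ i : F.BranchIndex U, i.1 < N → chord (i.2.1 x) y < ρ → i.2.1 x = y)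
    (i : F.BranchIndex U) (hi : chord (i.2.1 x) y < ρ) :
    ∃ j i', FactorsThrough (x := x) Q y R ρ N i j i' ∧
      ((1 ≤ j ∧ i'.2.1 x ∈ R ∧ ρ ≤ chord (i'.2.1 x) y) ∨ (i'.1 < N ∧ i'.2.1 x = y)) := by
  obtain ⟨m, f⟩ := i
  induction m using Nat.strong_induction_on with
  | _ m ih =>
    rcases lt_or_ge m N with hm | hm
    · refine ⟨0, ⟨m, f⟩, ⟨by simp, EventuallyEq.rfl, by simp, fun k h1 h2 => by omega, ?_⟩,
        Or.inr ⟨hm, hlow ⟨m, f⟩ hm hi⟩⟩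
      simp [iter]
    · obtain ⟨m, rfl⟩ : ∃ m', m = m' + N := ⟨m - N, by omega⟩
      obtain ⟨f', hf', hfR, hQf, heq⟩ := hV m f.1 f.2 (hρ _ hi).1
      have hd := bderiv_comp hU f ⟨f', hf'⟩ hQf heq
      have hval : f.1 x = Q (f' x) := heq.self_of_nhds
      have hmem : f.1 x ∈ F.iter N (f' x) := hval ▸ hQf.1.self_of_nhds
      rcases le_or_gt ρ (chord (f' x) y) with h | h
      · refine ⟨1, ⟨m, f', hf'⟩, ⟨by simp, heq, by simpa using hd, fun k h1 h2 => ?_,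
          by simpa using hmem⟩, Or.inl ⟨le_rfl, hfR, h⟩⟩
        obtain rfl : k = 1 := by omega
        simp only [Function.iterate_one]
        rw [← hval]
        exact ⟨(hρ _ hi).2, hi⟩
      · obtain ⟨j, i', hfac, hi'⟩ := ih m (by omega) ⟨f', hf'⟩ h
        have hval' : f' x = Q^[j] (i'.2.1 x) := hfac.eventuallyEq.self_of_nhds
        refine ⟨j + 1, i', ⟨?_, ?_, ?_, ?_, ?_⟩, ?_⟩
        · have := hfac.level
          simp only at this ⊢
          rw [this]; ring
        · rw [Function.iterate_succ', Function.comp_assoc]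
          exact heq.trans (hfac.eventuallyEq.fun_comp Q)
        · rw [hd, hfac.deriv, Finset.prod_range_succ, ← hval']
          ring
        · intro k h1 h2
          rcases h2.eq_or_lt with rfl | h2
          · rw [Function.iterate_succ_apply', ← hval', ← hval]
            exact ⟨(hρ _ hi).2, hi⟩
          · exact hfac.near k h1 (by omega)
        · rw [Nat.succ_mul]
          exact mem_iter_add.2 ⟨f' x, hfac.mem_iter, hmem⟩
        · exact hi'.imp_left fun h => ⟨by omega, h.2⟩

/-- Branches that leave a neighbourhood of a contracting periodic point on their way back. -/
theorem tsum_exit_le {δ : ℝ} {t : ℝ → ℕ → ℝ} (hU : F.IsBranchDomain x U)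
    {Q : RiemannSphere → RiemannSphere} {y : RiemannSphere} {R : Set RiemannSphere} {ρ : ℝ}
    {N J : ℕ} {s t₀ : ℝ} {M : ℝ≥0∞} (hM1 : 1 ≤ M) (hM : ∀ i : F.BranchIndex U, bderiv x i ≤ M)
    (ht₀ : 0 < t₀) (hrange : ∀ n, t₀ ≤ t s n ∧ t s n ≤ δ + 1)
    (hmono : ∀ m n, m ≤ n → t s m ≤ t s n ∧ t s n ≤ t s m + 1) {β : ℕ → ℝ}
    (hβ : ∀ j ≥ 1, ∀ v ∈ R, ρ ≤ chord v y →
      (∀ i, 1 ≤ i → i ≤ j → Q^[i] v ∈ R ∧ chord (Q^[i] v) y < ρ) →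
      ∏ i ∈ Finset.range j, sphericalDeriv Q (Q^[i] v) ≤ β j)
    (E : Set (F.BranchIndex U))
    (hE : ∀ i ∈ E, ∃ j i', FactorsThrough (x := x) Q y R ρ N i j i' ∧ J < j ∧
      i'.2.1 x ∈ R ∧ ρ ≤ chord (i'.2.1 x) y) :
    ∑' i : E, weight x (t s) i.1 ≤
      (∑' k, (ENNReal.ofReal (β (k + (J + 1))) ^ t₀ + ENNReal.ofReal (β (k + (J + 1))) ^ (δ + 1))) *
        (M * F.branchSum x U (t s)) := by
  choose! j i' hfac hJ hR hρ using hE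
  set b : ℕ → ℝ≥0∞ := fun k => ENNReal.ofReal (β k) ^ t₀ + ENNReal.ofReal (β k) ^ (δ + 1) with hb
  -- The number of steps and the exit branch determine the branch. The shift by `J + 1` makes the
  -- sum over steps a tail.
  let g : E → ℕ × F.BranchIndex U := fun i => (j i - (J + 1), i' i)
  have hg : Function.Injective g := by
    rintro ⟨i₁, h₁⟩ ⟨i₂, h₂⟩ h
    simp only [g, Prod.mk.injEq] at h
    have hj : j i₁ = j i₂ := by
      have := hJ i₁ h₁
      have := hJ i₂ h₂
      omega
    have h3 := hfac i₁ h₁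
    have h4 := hfac i₂ h₂
    rw [hj, h.2] at h3
    exact Subtype.ext (h3.left_unique hU h4)
  calc ∑' i : E, weight x (t s) i.1
      ≤ ∑' i : E, b ((g i).1 + (J + 1)) * (M * weight x (t s) (g i).2) := by
        refine ENNReal.tsum_le_tsum fun i => ?_
        have hf := hfac i i.2
        have hJi := hJ i i.2
        have hj : (g i).1 + (J + 1) = j i := by simp only [g]; omega
        rw [hj]
        have hT : 0 ≤ t s i.1.1 := ht₀.le.trans (hrange _).1
        have hd : bderiv x i.1 ≤ ENNReal.ofReal (β (j i)) * bderiv x (i' i) := by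
          unfold bderiv
          rw [hf.deriv, ENNReal.ofReal_mul (Finset.prod_nonneg fun _ _ => sphericalDeriv_nonneg _ _)]
          gcongr
          exact hβ _ (by omega) _ (hR i i.2) (hρ i i.2) hf.near
        have hlev : (i' i).1 ≤ i.1.1 := by rw [hf.level]; omega
        have hm := hmono _ _ hlev
        calc weight x (t s) i.1 ≤ (ENNReal.ofReal (β (j i)) * bderiv x (i' i)) ^ t s i.1.1 :=
              ENNReal.rpow_le_rpow hd hT
          _ = ENNReal.ofReal (β (j i)) ^ t s i.1.1 * bderiv x (i' i) ^ t s i.1.1 :=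
              ENNReal.mul_rpow_of_nonneg _ _ hT
          _ ≤ _ := by
              gcongr
              · exact rpow_le_add (hrange _).1 (hrange _).2
              · exact rpow_le_mul_rpow hM1 (hM _) (ht₀.le.trans (hrange _).1) hm.1 hm.2
    _ ≤ ∑' p : ℕ × F.BranchIndex U, b (p.1 + (J + 1)) * (M * weight x (t s) p.2) :=
        ENNReal.tsum_comp_le_tsum_of_injective hg
          fun p : ℕ × F.BranchIndex U => b (p.1 + (J + 1)) * (M * weight x (t s) p.2)
    _ = (∑' k, b (k + (J + 1))) * (M * F.branchSum x U (t s)) := by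
        rw [ENNReal.tsum_prod (f := fun k (i : F.BranchIndex U) =>
          b (k + (J + 1)) * (M * weight x (t s) i)), branchSum_eq, ← ENNReal.tsum_mul_right]
        refine tsum_congr fun k => ?_
        rw [ENNReal.tsum_mul_left, ENNReal.tsum_mul_left]

/-- Branches that start with a branch of low level ending in the periodic point `y`. -/
theorem GoodScheme.exists_end_bound (hU : F.IsBranchDomain x U) {δ : ℝ} {t : ℝ → ℕ → ℝ}
    (ht : F.GoodScheme x U δ t) {Q : RiemannSphere → RiemannSphere} {y : RiemannSphere}
    (hQy : Q y = y) {R : Set RiemannSphere} {ρ : ℝ} {N : ℕ} :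
    ∃ C : ℝ≥0∞, C ≠ ⊤ ∧ ∀ᶠ s in 𝓝[>] δ,
      ∑' i : {i : F.BranchIndex U | ∃ j i', FactorsThrough (x := x) Q y R ρ N i j i' ∧
        i'.1 < N ∧ i'.2.1 x = y}, weight x (t s) i.1 ≤ C := by
  set E := {i : F.BranchIndex U | ∃ j i', FactorsThrough (x := x) Q y R ρ N i j i' ∧
        i'.1 < N ∧ i'.2.1 x = y} with hE
  set κ := ENNReal.ofReal (sphericalDeriv Q y) with hκ
  have hex : ∀ i ∈ E, ∃ j i', FactorsThrough (x := x) Q y R ρ N i j i' ∧ i'.1 < N ∧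
      bderiv x i = κ ^ j * bderiv x i' := by
    rintro i ⟨j, i', hfac, hN, hy⟩
    refine ⟨j, i', hfac, hN, ?_⟩
    have h : ∏ k ∈ Finset.range j, sphericalDeriv Q (Q^[k] (i'.2.1 x)) = sphericalDeriv Q y ^ j := by
      rw [Finset.prod_congr rfl fun k _ => by rw [hy, Function.iterate_fixed hQy k]]
      simp
    unfold bderiv
    rw [hfac.deriv, h, ENNReal.ofReal_mul (pow_nonneg (sphericalDeriv_nonneg _ _) _),
      ENNReal.ofReal_pow (sphericalDeriv_nonneg _ _)]
  have hδ := ht.pos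
  -- Each such derivative is κ^j times one of finitely many. For κ < 1 the weights are dominated by
  -- finitely many geometric series.
  rcases lt_or_ge κ 1 with hκ1 | hκ1
  · choose! j i' hfac hN hd using hex
    let L := {i : F.BranchIndex U | i.1 < N}
    have hL : L.Finite := finite_setOf_level_lt hU N
    have : Fintype L := hL.fintype
    let g : E → ℕ × L := fun i => (j i, ⟨i' i, hN i i.2⟩)
    have hg : Function.Injective g := by
      rintro ⟨i₁, h₁⟩ ⟨i₂, h₂⟩ h
      simp only [g, Prod.mk.injEq, Subtype.mk.injEq] at h
      have h3 := hfac i₁ h₁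
      have h4 := hfac i₂ h₂
      rw [h.1, h.2] at h3
      exact Subtype.ext (h3.left_unique hU h4)
    let c : F.BranchIndex U → ℝ≥0∞ := fun i => bderiv x i ^ (δ / 2) + bderiv x i ^ (δ + 1)
    refine ⟨∑' k : ℕ, (κ ^ (δ / 2)) ^ k * ∑' i : L, c i, ?_, ?_⟩
    · rw [ENNReal.tsum_mul_right, ENNReal.tsum_geometric]
      refine ENNReal.mul_ne_top ?_ ?_
      · rw [ENNReal.inv_ne_top]
        exact (tsub_pos_of_lt (ENNReal.rpow_lt_one hκ1 (by linarith))).ne'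
      · rw [tsum_fintype]
        refine ENNReal.sum_ne_top.2 fun i _ => ENNReal.add_ne_top.2 ⟨?_, ?_⟩
        · exact ENNReal.rpow_ne_top_of_nonneg (by linarith) (bderiv_ne_top _)
        · exact ENNReal.rpow_ne_top_of_nonneg (by linarith) (bderiv_ne_top _)
    · filter_upwards [ht.range (δ / 2) (by linarith) (δ + 1) (by linarith)] with s hs
      calc ∑' i : E, weight x (t s) i.1
          ≤ ∑' i : E, (κ ^ (δ / 2)) ^ (g i).1 * c (g i).2 := by
            refine ENNReal.tsum_le_tsum fun i => ?_
            have hT : 0 ≤ t s i.1.1 := by linarith [(hs i.1.1).1]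
            unfold weight
            rw [hd i i.2, ENNReal.mul_rpow_of_nonneg _ _ hT]
            gcongr
            · calc (κ ^ j i) ^ t s i.1.1 ≤ (κ ^ j i) ^ (δ / 2) :=
                    ENNReal.rpow_le_rpow_of_exponent_ge (pow_le_one' hκ1.le _) (hs _).1
                _ = (κ ^ (δ / 2)) ^ j i := by
                    rw [← ENNReal.rpow_natCast, ← ENNReal.rpow_natCast, ← ENNReal.rpow_mul,
                      ← ENNReal.rpow_mul, mul_comm]
            · exact rpow_le_add (hs _).1 (hs _).2
        _ ≤ ∑' p : ℕ × L, (κ ^ (δ / 2)) ^ p.1 * c p.2 :=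
            ENNReal.tsum_comp_le_tsum_of_injective hg
              fun p : ℕ × L => (κ ^ (δ / 2)) ^ p.1 * c p.2
        _ = _ := by
            rw [ENNReal.tsum_prod (f := fun k (i : L) => (κ ^ (δ / 2)) ^ k * c i)]
            refine tsum_congr fun k => ENNReal.tsum_mul_left
  -- For κ ≥ 1 the nonzero derivatives are bounded below by `c`, so a convergent Poincaré series
  -- admits only finitely many of them. Zero derivatives carry no weight, since the exponents are
  -- positive.
  · obtain ⟨c, hc0, hc⟩ : ∃ c : ℝ≥0∞, 0 < c ∧
        ∀ i ∈ {i : F.BranchIndex U | i.1 < N}, bderiv x i ≠ 0 → c ≤ bderiv x i := by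
      have h1 : ∀ᶠ c in 𝓝[>] (0 : ℝ≥0∞),
          ∀ i ∈ {i : F.BranchIndex U | i.1 < N}, bderiv x i ≠ 0 → c ≤ bderiv x i := by
        rw [eventually_all_finite (finite_setOf_level_lt hU N)]
        intro i _
        by_cases h : bderiv x i = 0
        · exact Eventually.of_forall fun c h' => absurd h h'
        · have h2 : ∀ᶠ c in 𝓝 (0 : ℝ≥0∞), c < bderiv x i :=
            gt_mem_nhds (pos_iff_ne_zero.2 h)
          exact (h2.filter_mono nhdsWithin_le_nhds).mono fun c hc _ => hc.le
      have h2 : ∀ᶠ c in 𝓝[>] (0 : ℝ≥0∞), 0 < c := self_mem_nhdsWithin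
      exact (h2.and h1).exists
    obtain ⟨s₁, hs₁, hfin⟩ := ht.finite
    rw [branchSum_eq] at hfin
    have hE' : (E ∩ {i | bderiv x i ≠ 0}).Finite := by
      refine (ENNReal.finite_const_le_of_tsum_ne_top hfin
        (ε := c ^ s₁) (by simp [ENNReal.rpow_eq_zero_iff, hc0.ne', hs₁.le])).subset ?_
      rintro i ⟨hi, hi0⟩
      obtain ⟨j, i', -, hN, hd⟩ := hex i hi
      have hi0' : bderiv x i' ≠ 0 := fun h => hi0 (by rw [hd, h, mul_zero])
      refine ENNReal.rpow_le_rpow ?_ hs₁.le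
      calc c ≤ bderiv x i' := hc i' hN hi0'
        _ ≤ κ ^ j * bderiv x i' := le_mul_of_one_le_left' (one_le_pow₀ hκ1)
        _ = bderiv x i := hd.symm
    obtain ⟨C, hC, hCs⟩ := ht.exists_finite_bound hE'
    refine ⟨C, hC, ?_⟩
    filter_upwards [hCs, ht.range (δ / 2) (by linarith) (δ + 1) (by linarith)] with s h1 h2
    refine le_trans (le_of_eq ?_) h1
    rw [tsum_subtype E (weight x (t s)), tsum_subtype (E ∩ {i | bderiv x i ≠ 0}) (weight x (t s))]
    refine tsum_congr fun i => ?_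
    by_cases hi : i ∈ E
    · rw [Set.indicator_of_mem hi]
      by_cases h0 : bderiv x i = 0
      · rw [Set.indicator_of_notMem fun h => h.2 h0]
        unfold weight
        rw [h0, ENNReal.zero_rpow_of_pos (by linarith [(h2 i.1).1])]
      · rw [Set.indicator_of_mem (show i ∈ E ∩ {i | bderiv x i ≠ 0} from ⟨hi, h0⟩)]
    · rw [Set.indicator_of_notMem hi, Set.indicator_of_notMem fun h => hi h.1]

/-- A contracting periodic point of the limit set is negligible. -/
theorem Setting.small_of_contractsAt (h : F.Setting S x) (hU : F.IsBranchDomain x U) {δ : ℝ}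
    {t : ℝ → ℕ → ℝ} (ht : F.GoodScheme x U δ t) {y : RiemannSphere} (hy : y ∈ F.limitSet x)
    {N : ℕ} (hN : 1 ≤ N) {Q : RiemannSphere → RiemannSphere} (hQ : F.IsBranchAt N Q y)
    (hQy : Q y = y) {t₀ : ℝ} (ht₀ : 0 < t₀) (htδ : t₀ < δ) (hc : ContractsAt Q y t₀) :
    F.Small x U δ t y := by
  obtain ⟨R, hR, hcon⟩ := hc
  have hyS := limitSet_subset h.isClosed h.inverseLike h.mem hy
  have hyN : y ∈ F.iter N y := by
    have := hQ.1.self_of_nhds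
    rwa [hQy] at this
  obtain ⟨V, hV, hVf⟩ := h.exists_factor hU hyS hy hQ hQy hR
  have hlowfin : ((fun i : F.BranchIndex U => i.2.1 x) '' {i | i.1 < N} \ {y}).Finite :=
    ((finite_setOf_level_lt hU N).image _).subset Set.sdiff_subset
  -- The ball avoids the finitely many values other than `y` of branches of level below `N`.
  obtain ⟨ρ, hρ0, hρ⟩ := exists_chord_lt_subset (inter_mem (inter_mem hV hR)
    (hlowfin.isClosed.isOpen_compl.mem_nhds (x := y) (by simp)))
  have hlow : ∀ i : F.BranchIndex U, i.1 < N → chord (i.2.1 x) y < ρ → i.2.1 x = y := by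
    intro i hi hi'
    by_contra hne
    exact (hρ hi').2 ⟨⟨i, hi, rfl⟩, hne⟩
  obtain ⟨β, hβ0, hβs, hβ⟩ := hcon ρ hρ0
  obtain ⟨M, hM1, hM, hMb⟩ := ht.exists_deriv_bound (F := F) (U := U)
  obtain ⟨C, hC, hCs⟩ := ht.exists_end_bound hU hQy (R := R) (ρ := ρ) (N := N)
  set b : ℕ → ℝ≥0∞ := fun k => ENNReal.ofReal (β k) ^ t₀ + ENNReal.ofReal (β k) ^ (δ + 1) with hb
  have hbsum : ∑' k, b k ≠ ⊤ := by
    rw [hb, ENNReal.tsum_add]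
    have h1 : ∀ τ, t₀ ≤ τ → ∑' k, ENNReal.ofReal (β k) ^ τ ≠ ⊤ := fun τ hτ => by
      simp_rw [ENNReal.ofReal_rpow_of_nonneg (hβ0 _) (ht₀.le.trans hτ)]
      exact (hβs τ hτ).tsum_ofReal_ne_top
    exact ENNReal.add_ne_top.2 ⟨h1 _ le_rfl, h1 _ (by linarith)⟩
  intro ε hε
  obtain ⟨J, hJ⟩ : ∃ J, ∑' k, b (k + (J + 1)) ≤ ε / 2 / M := by
    have h1 := (ENNReal.tendsto_sum_nat_add b hbsum).eventually_le_const
      (u := ε / 2 / M) (pos_iff_ne_zero.2 (by simp [ENNReal.div_eq_zero_iff, hε, hM]))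
    obtain ⟨J, hJ⟩ := (h1.and (eventually_ge_atTop 1)).exists
    exact ⟨J - 1, by rw [Nat.sub_add_cancel hJ.2]; exact hJ.1⟩
  -- Points of `W j` have preimages under F^(jN) in `S` only inside the ball, so a branch ending
  -- there cannot have left it exactly `j` rounds earlier. Intersecting over j ≤ J forces more than
  -- `J` rounds.
  have hsep : ∀ j : ℕ, ∃ W ∈ 𝓝 y, ∀ z ∈ W, ∀ v ∈ S, z ∈ F.iter (j * N) v → chord v y < ρ :=
    fun j => h.inverseLike.exists_nhds_preimage h.isClosed hyS
      (mul_comm N j ▸ mem_iter_mul hyN j) (setOf_chord_lt_mem_nhds y hρ0)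
  choose W hW hWs using hsep
  refine ⟨{u | chord u y < ρ} ∩ ⋂ j ∈ Set.Iic J, W j, inter_mem (setOf_chord_lt_mem_nhds y hρ0)
    ((biInter_mem (Set.finite_Iic J)).2 fun j _ => hW j), ?_⟩
  filter_upwards [hCs, ht.eventually_le hC (ε := ε / 2) (by simpa using hε), ht.mono,
    ht.range t₀ htδ (δ + 1) (by linarith)] with s h1 h2 h3 h4
  set V' := {u | chord u y < ρ} ∩ ⋂ j ∈ Set.Iic J, W j with hV'
  set E₁ := {i : F.BranchIndex U | i.2.1 x ∈ V' ∧ ∃ j i',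
    FactorsThrough (x := x) Q y R ρ N i j i' ∧ 1 ≤ j ∧ i'.2.1 x ∈ R ∧ ρ ≤ chord (i'.2.1 x) y}
  have h5 : ∑' i : E₁, weight x (t s) i.1 ≤ ε / 2 * F.branchSum x U (t s) := by
    refine (tsum_exit_le (N := N) (J := J) hU hM1 hMb ht₀ h4 h3 hβ E₁ ?_).trans ?_
    · rintro i ⟨hi, j, i', hfac, -, hR, hle⟩
      refine ⟨j, i', hfac, ?_, hR, hle⟩
      by_contra hj
      refine hle.not_gt (hWs j _ (Set.mem_iInter₂.1 hi.2 j (not_lt.1 hj)) _ ?_ hfac.mem_iter)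
      exact h.inverseLike.iter_subset h.mem _
        (isBranchAt_of_mem_branches hU i'.2.2 hU.2.2.1).1.self_of_nhds
    · rw [← mul_assoc]
      gcongr
      calc _ ≤ ε / 2 / M * M := by gcongr
        _ = ε / 2 := ENNReal.div_mul_cancel (one_pos.trans_le hM1).ne' hM
  calc F.localSum x U (t s) V'
      ≤ ∑' i : (E₁ ∪ {i : F.BranchIndex U | ∃ j i', FactorsThrough (x := x) Q y R ρ N i j i' ∧
        i'.1 < N ∧ i'.2.1 x = y} : Set (F.BranchIndex U)), weight x (t s) i.1 := by
        refine ENNReal.tsum_mono_subtype (weight x (t s))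
          (s := {i : F.BranchIndex U | i.2.1 x ∈ V'}) fun i hi => ?_
        obtain ⟨j, i', hfac, h' | h'⟩ := exists_factorsThrough hU hN hVf
          (fun z hz => (hρ hz).1) hlow i (show i.2.1 x ∈ V' from hi).1
        · exact Or.inl ⟨hi, j, i', hfac, h'⟩
        · exact Or.inr ⟨j, i', hfac, h'⟩
    _ ≤ ε / 2 * F.branchSum x U (t s) + ε / 2 * F.branchSum x U (t s) :=
        (ENNReal.tsum_union_le _ _ _).trans (add_le_add h5 (h1.trans h2))
    _ = ε * F.branchSum x U (t s) := by rw [← add_mul, ENNReal.add_halves]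

end Periodic

end Correspondence

namespace Correspondence

/-! ### Limit measures -/

section LimitMeasures

variable {F : Correspondence} {S : Set RiemannSphere} {x : RiemannSphere} {U : Set RiemannSphere}

theorem measure_eq_zero_of_countable {α : Type*} [MeasurableSpace α] {μ : Measure α} {s : Set α}
    (hs : s.Countable) (h : ∀ a ∈ s, μ {a} = 0) : μ s = 0 := by
  rw [← Set.biUnion_of_singleton s]
  exact (measure_biUnion_null_iff hs).2 h

theorem orbitMeasure_le {t : ℕ → ℝ} {V : Set RiemannSphere} (hV : MeasurableSet V) {ε : ℝ≥0∞}
    (h : F.localSum x U t V ≤ ε * F.branchSum x U t) : F.orbitMeasure x U t V ≤ ε := by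
  rw [orbitMeasure_apply t hV]
  calc (F.branchSum x U t)⁻¹ * F.localSum x U t V
      ≤ (F.branchSum x U t)⁻¹ * (ε * F.branchSum x U t) := by gcongr
    _ = ε * ((F.branchSum x U t)⁻¹ * F.branchSum x U t) := by ring
    _ ≤ ε * 1 := by
        gcongr
        exact ENNReal.inv_mul_le_one _
    _ = ε := mul_one ε

/-- The portmanteau inequality for open sets, along an ultrafilter that realizes the cluster point.
-/
theorem IsLimitMeasure.exists_scheme {μ : ProbabilityMeasure RiemannSphere}
    (hμ : F.IsLimitMeasure x μ) (hpos : 0 < F.critExp x) (hfin : F.critExp x < ⊤) :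
    ∃ U t, F.IsBranchDomain x U ∧ F.GoodScheme x U (F.critExp x).toReal t ∧
      ∀ (ε : ℝ≥0∞) (V : Set RiemannSphere), IsOpen V →
        (∀ᶠ s in 𝓝[>] (F.critExp x).toReal,
          F.localSum x U (t s) V ≤ ε * F.branchSum x U (t s)) →
        (μ : Measure RiemannSphere) V ≤ ε := by
  obtain ⟨U, t, ν, hU, ht, hν, hcl⟩ := hμ
  refine ⟨U, t, hU, ht.goodScheme hU hpos hfin, fun ε V hV hle => ?_⟩
  obtain ⟨ℱ, hℱ, hlim⟩ := mapClusterPt_iff_ultrafilter.1 hcl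
  have h1 := ProbabilityMeasure.le_liminf_measure_open_of_tendsto hlim hV
  have h2 : ∀ᶠ s in (ℱ : Filter ℝ), (ν s : Measure RiemannSphere) V ≤ ε := by
    filter_upwards [hν.filter_mono hℱ, hle.filter_mono hℱ] with s h3 h4
    rw [h3]
    exact orbitMeasure_le hV.measurableSet h4
  refine h1.trans ((liminf_le_liminf h2).trans ?_)
  rw [liminf_const]

/-- Limit measures have no atoms at negligible points and live on the limit set. -/
theorem IsLimitMeasure.exists_small {μ : ProbabilityMeasure RiemannSphere}
    (hμ : F.IsLimitMeasure x μ) (hpos : 0 < F.critExp x) (hfin : F.critExp x < ⊤) :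
    ∃ U t, F.IsBranchDomain x U ∧ F.GoodScheme x U (F.critExp x).toReal t ∧
      (∀ y, F.Small x U (F.critExp x).toReal t y → (μ : Measure RiemannSphere) {y} = 0) ∧
      (μ : Measure RiemannSphere) (F.limitSet x)ᶜ = 0 := by
  obtain ⟨U, t, hU, ht, hle⟩ := hμ.exists_scheme hpos hfin
  refine ⟨U, t, hU, ht, fun y hy => ?_, ?_⟩
  · by_contra hne
    have h0 : (μ : Measure RiemannSphere) {y} / 2 ≠ 0 := by simpa using hne
    obtain ⟨V, hV, hVs⟩ := hy _ h0
    obtain ⟨O, hOV, hO, hyO⟩ := mem_nhds_iff.1 hV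
    have h1 : (μ : Measure RiemannSphere) O ≤ (μ : Measure RiemannSphere) {y} / 2 := by
      refine hle _ O hO (hVs.mono fun s hs => le_trans ?_ hs)
      exact ENNReal.tsum_mono_subtype (weight x (t s))
        (s := {i : F.BranchIndex U | i.2.1 x ∈ O}) fun i hi => hOV hi
    have h2 : (μ : Measure RiemannSphere) {y} ≤ (μ : Measure RiemannSphere) O :=
      measure_mono (by simpa using hyO)
    exact (ENNReal.half_lt_self hne (measure_ne_top _ _)).not_ge (h2.trans h1)
  · refine measure_null_of_locally_null _ fun y hy => ?_
    obtain ⟨V, hV, hVs⟩ := small_of_notMem_limitSet hU ht hy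
    obtain ⟨O, hOV, hO, hyO⟩ := mem_nhds_iff.1 hV
    refine ⟨O, mem_nhdsWithin_of_mem_nhds (hO.mem_nhds hyO), ?_⟩
    by_contra hne
    have h0 : (μ : Measure RiemannSphere) O / 2 ≠ 0 := by simpa using hne
    refine (ENNReal.half_lt_self hne (measure_ne_top _ _)).not_ge ?_
    refine hle _ O hO ((hVs _ h0).mono fun s hs => le_trans ?_ hs)
    exact ENNReal.tsum_mono_subtype (weight x (t s))
      (s := {i : F.BranchIndex U | i.2.1 x ∈ O}) fun i hi => hOV hi

theorem Setting.small_iter (h : F.Setting S x) (hU : F.IsBranchDomain x U) {δ : ℝ}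
    {t : ℝ → ℕ → ℝ} (ht : F.GoodScheme x U δ t) {y : RiemannSphere} (hy : y ∈ S)
    (hsmall : F.Small x U δ t y) {n : ℕ} {w : RiemannSphere} (hw : w ∈ F.iter n y)
    (hwL : w ∈ F.limitSet x) : F.Small x U δ t w := by
  induction n generalizing w with
  | zero =>
    obtain rfl : w = y := hw
    exact hsmall
  | succ n ih =>
    obtain ⟨z, hz, hwz⟩ := hw
    have hzL : z ∈ F.limitSet x := h.inverseLike.mem_limitSet h.isClosed h.mem hwL
      (h.inverseLike.iter_subset hy n hz) (mem_iter_one.2 hwz)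
    exact h.small_image hU ht hzL hwL hwz (ih hz hzL)

/-- Orbits of negligible periodic points are null sets. -/
theorem Setting.measure_orbit_eq_zero (h : F.Setting S x) (hU : F.IsBranchDomain x U) {δ : ℝ}
    {t : ℝ → ℕ → ℝ} (ht : F.GoodScheme x U δ t) {μ : Measure RiemannSphere}
    (hμ : ∀ y, F.Small x U δ t y → μ {y} = 0) (hμL : μ (F.limitSet x)ᶜ = 0)
    {y : RiemannSphere} (hy : y ∈ S) {q : ℕ} (hq : 1 ≤ q) (hyq : y ∈ F.iter q y)
    (hsmall : y ∈ F.limitSet x → F.Small x U δ t y) : μ (F.orbit y) = 0 := by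
  have hsub : F.orbit y ⊆ (F.limitSet x)ᶜ ∪ ⋃ n, F.iter n y ∩ F.limitSet x := by
    intro w hw
    by_cases hwL : w ∈ F.limitSet x
    · have hwS := limitSet_subset h.isClosed h.inverseLike h.mem hwL
      obtain ⟨n, hn⟩ := Set.mem_iUnion.1 (h.inverseLike.orbit_inter_subset hy hq hyq ⟨hw, hwS⟩)
      exact Or.inr (Set.mem_iUnion.2 ⟨n, hn, hwL⟩)
    · exact Or.inl hwL
  refine measure_mono_null hsub (measure_union_null hμL (measure_iUnion_null fun n => ?_))
  refine measure_eq_zero_of_countable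
    (countable_iter_inter_limitSet h.isClosed h.inverseLike h.mem h.sing hy n) ?_
  rintro w ⟨hw, hwL⟩
  have hyL := h.inverseLike.mem_limitSet h.isClosed h.mem hwL hy hw
  exact hμ w (h.small_iter hU ht hy (hsmall hyL) hw hwL)

end LimitMeasures

/-! ### Parabolic points -/

section Parabolic

variable {F : Correspondence} {S : Set RiemannSphere} {x : RiemannSphere}

theorem Setting.exists_isBranchAt_iter (h : F.Setting S x) {y w : RiemannSphere} (hy : y ∈ S)
    (hw : w ∈ F.limitSet x) {n : ℕ} (hwy : w ∈ F.iter n y) :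
    ∃ T, F.IsBranchAt n T y ∧ T y = w := by
  induction n generalizing w with
  | zero => exact ⟨id, isBranchAt_id y, hwy.symm⟩
  | succ n ih =>
    obtain ⟨z, hz, hwz⟩ := hwy
    have hzL : z ∈ F.limitSet x := h.inverseLike.mem_limitSet h.isClosed h.mem hw
      (h.inverseLike.iter_subset hy n hz) (mem_iter_one.2 hwz)
    obtain ⟨T, hT, rfl⟩ := ih hzL hz
    obtain ⟨B, hB, hBw⟩ := exists_isBranchAt (h.notMem_singularSet hzL) hwz
    exact ⟨B ∘ T, hB.comp hT, hBw⟩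

/-- Local uniqueness of values near `(ω, ω)` leaves a single germ. This links branches found at
different multiples of the period. -/
theorem Setting.eventuallyEq_of_fixing (h : F.Setting S x) {ω : RiemannSphere}
    (hω : ω ∈ F.limitSet x) {n : ℕ} {f g : RiemannSphere → RiemannSphere}
    (hf : F.IsBranchFixing n f ω) (hg : F.IsBranchFixing n g ω) : f =ᶠ[𝓝 ω] g := by
  rw [isBranchFixing_iff] at hf hg
  have hmem := hf.1.1.self_of_nhds
  rw [hf.2] at hmem
  obtain ⟨A, hA, B, hB, hAB⟩ := h.inverseLike.exists_nhds_unique h.isClosed h.mem h.sing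
    (limitSet_subset h.isClosed h.inverseLike h.mem hω) hω hmem
  have hfB : ∀ᶠ v in 𝓝 ω, f v ∈ B := hf.1.2.continuousAt (by rwa [hf.2])
  have hgB : ∀ᶠ v in 𝓝 ω, g v ∈ B := hg.1.2.continuousAt (by rwa [hg.2])
  filter_upwards [hA, hfB, hgB, hf.1.1, hg.1.1] with v h1 h2 h3 h4 h5
  exact hAB v h1 _ h2 _ h3 h4 h5

theorem parity_mul_two (F : Correspondence) (q : ℕ) : F.parity (q * 2) = false := by
  rw [mul_two, parity_add, Bool.xor_self]

/-- Local attraction rules out branches that are the identity near a parabolic point. -/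
theorem LocallyAttracting.not_eventuallyEq_id (hattr : F.LocallyAttracting x) {ω : RiemannSphere}
    (hω : ω ∈ F.parabolicSet x) {q : ℕ} (hq : 1 ≤ q) {f : RiemannSphere → RiemannSphere}
    (hf : F.IsBranchFixing q f ω) : ¬ f^[2] =ᶠ[𝓝 ω] id := by
  intro hid
  obtain ⟨T, D, U, hD, hDc, hωD, hT, hTf, ⟨O, hO, rfl, -, -⟩, ⟨V₀, hV₀, hV⟩, hTU⟩ :=
    hattr ω hω (q * 2) (by omega) _ (hf.iterate 2)
  have hTid : Set.EqOn T id D := by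
    refine eqOn_of_eventuallyEq (b := false) hDc.isPreconnected (fun z hz => ?_)
      (fun z _ => isConf_id z) hωD (hTf.trans hid)
    have := (isBranchOn_iff.1 hT z hz).2
    rwa [parity_mul_two] at this
  -- Iterates of the identity converge to `ω` only at `ω`, so the pinched neighbourhood shrinks to a
  -- point; being the closure of a nonempty open set, it would make `ω` isolated.
  have hU : closure O ⊆ {ω} := by
    intro z hz
    obtain ⟨h1, h2⟩ := hTU z hz
    have hfix : T z = z := hTid (h1 0)
    have h3 : ∀ n, T^[n] z = z := fun n => Function.iterate_fixed hfix n
    simp only [h3] at h2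
    exact tendsto_nhds_unique tendsto_const_nhds h2
  have hωU : ω ∈ closure O := by
    have h1 : ω ∈ F.limitSet x ∩ V₀ := ⟨hω.1, mem_of_mem_nhds hV₀⟩
    rw [hV V₀ hV₀ subset_rfl] at h1
    exact h1.2
  have hOω : O ∈ 𝓝 ω := by
    obtain ⟨z, hz⟩ := closure_nonempty_iff.1 ⟨ω, hωU⟩
    have : z = ω := hU (subset_closure hz)
    exact hO.mem_nhds (this ▸ hz)
  have h1 : ∀ᶠ z in 𝓝[≠] ω, z ∈ O ∧ z ≠ ω := by
    filter_upwards [mem_nhdsWithin_of_mem_nhds hOω, self_mem_nhdsWithin] with z h1 h2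
    exact ⟨h1, h2⟩
  obtain ⟨z, hz, hne⟩ := h1.exists
  exact hne (hU (subset_closure hz))

/-- Accumulating fixed points would make the second iterate the identity. The second iterate is
holomorphic even if `f` is antiholomorphic. -/
theorem LocallyAttracting.not_frequently_fixed (hattr : F.LocallyAttracting x)
    {ω : RiemannSphere} (hω : ω ∈ F.parabolicSet x) {q : ℕ} (hq : 1 ≤ q)
    {f : RiemannSphere → RiemannSphere} (hf : F.IsBranchFixing q f ω) :
    ∀ᶠ z in 𝓝[≠] ω, f z ≠ z := by
  by_contra hcon
  refine hattr.not_eventuallyEq_id hω hq hf ?_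
  have h2 := (isBranchFixing_iff.1 (hf.iterate 2)).1.2
  rw [parity_mul_two] at h2
  refine h2.eventuallyEq_of_frequently (isConf_id ω) ?_
  rw [not_eventually] at hcon
  exact hcon.mono fun z hz => Function.iterate_fixed (not_not.1 hz) 2

/-- For fixed `q` the points form a discrete set: near `ω`, a point v ∈ F^q(v) must satisfy T v = v
by local uniqueness, and fixed points of `T` do not accumulate at `ω`. -/
theorem Setting.countable_parabolicSet (h : F.Setting S x) (hattr : F.LocallyAttracting x) :
    (F.parabolicSet x).Countable := by
  have hcov : F.parabolicSet x ⊆ ⋃ q : ℕ, {ω | ω ∈ F.parabolicSet x ∧ 1 ≤ q ∧ ω ∈ F.iter q ω} := by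
    intro ω hω
    obtain ⟨q, hq, f, hf, -⟩ := hω.2
    rw [isBranchFixing_iff] at hf
    have := hf.1.1.self_of_nhds
    rw [hf.2] at this
    exact Set.mem_iUnion.2 ⟨q, hω, hq, this⟩
  refine (Set.countable_iUnion fun q => ?_).mono hcov
  set A := {ω | ω ∈ F.parabolicSet x ∧ 1 ≤ q ∧ ω ∈ F.iter q ω} with hA
  have : DiscreteTopology A := by
    rw [discreteTopology_subtype_iff]
    rintro ω ⟨hω, hq, hωq⟩
    have hωS := limitSet_subset h.isClosed h.inverseLike h.mem hω.1
    obtain ⟨T, hT, hTω⟩ := h.exists_isBranchAt_iter hωS hω.1 hωq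
    obtain ⟨A', hA', B, hB, hAB⟩ :=
      h.inverseLike.exists_nhds_unique h.isClosed h.mem h.sing hωS hω.1 hωq
    have hTB : ∀ᶠ v in 𝓝 ω, T v ∈ B := hT.2.continuousAt (by rwa [hTω])
    rw [← disjoint_iff, disjoint_principal_right]
    filter_upwards [hattr.not_frequently_fixed hω hq (isBranchFixing_iff.2 ⟨hT, hTω⟩),
      mem_nhdsWithin_of_mem_nhds hA', mem_nhdsWithin_of_mem_nhds hB,
      hTB.filter_mono nhdsWithin_le_nhds, hT.1.filter_mono nhdsWithin_le_nhds] with v h1 h2 h3 h4 h5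
    exact fun hv => h1 (hAB v h2 _ h4 _ h3 h5 hv.2.2)
  exact Set.countable_coe_iff.1 (TopologicalSpace.separableSpace_iff_countable.1 inferInstance)

theorem localRep_comp_eventuallyEq {f g : RiemannSphere → RiemannSphere} {ω : RiemannSphere}
    (hg : IsConf false g ω) (hgω : g ω = ω) (hfω : f ω = ω) :
    localRep (f ∘ g) ω =ᶠ[𝓝 (chart ω ω)] localRep f ω ∘ localRep g ω := by
  filter_upwards [hg.self_rep.2] with s hs
  simp only [localRep, Function.comp, hgω, hfω] at hs ⊢
  rw [← hs]

theorem localRep_chart_self {f : RiemannSphere → RiemannSphere} {ω : RiemannSphere}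
    (h : f ω = ω) : localRep f ω (chart ω ω) = chart ω ω := by
  rw [localRep, param_chart_self, h]

theorem deriv_localRep_iterate {f : RiemannSphere → RiemannSphere} {ω : RiemannSphere}
    (hf : IsConf false f ω) (hfω : f ω = ω) (hd : deriv (localRep f ω) (chart ω ω) = 1) (n : ℕ) :
    IsConf false f^[n] ω ∧ deriv (localRep f^[n] ω) (chart ω ω) = 1 := by
  induction n with
  | zero =>
    refine ⟨isConf_id ω, ?_⟩
    have h : localRep id ω =ᶠ[𝓝 (chart ω ω)] id :=
      Eventually.of_forall fun s => chart_param ω s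
    simpa using h.deriv_eq.trans (deriv_id _)
  | succ n ih =>
    have hn : f^[n] ω = ω := Function.iterate_fixed hfω n
    rw [Function.iterate_succ']
    refine ⟨?_, ?_⟩
    · exact IsConf.comp (b := false) (b' := false) (by rwa [hn]) ih.1
    · rw [(localRep_comp_eventuallyEq ih.1 hn hfω).deriv_eq]
      have h1 : AnalyticAt ℂ (localRep f^[n] ω) (chart ω ω) := ih.1.self_rep.1
      have h2 : AnalyticAt ℂ (localRep f ω) (chart ω ω) := hf.self_rep.1
      have h3 := localRep_chart_self hn
      rw [deriv_comp _ (by rw [h3]; exact h2.differentiableAt) h1.differentiableAt, h3, hd, ih.2,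
        one_mul]

/-- The expansion of a germ that is tangent to the identity but is not the identity. -/
theorem exists_tangent_expansion {L : ℂ → ℂ} {c : ℂ} (hL : AnalyticAt ℂ L c) (hc : L c = c)
    (hd : deriv L c = 1) (hne : ¬ ∀ᶠ u in 𝓝 c, L u = u) :
    ∃ p : ℕ, 1 ≤ p ∧ ∃ a : ℂ, a ≠ 0 ∧
      (fun u => L u - (u + a * (u - c) ^ (p + 1))) =O[𝓝 c] fun u => (u - c) ^ (p + 2) := by
  have hE : AnalyticAt ℂ (fun u => L u - u) c := hL.sub analyticAt_id
  have htop : analyticOrderAt (fun u => L u - u) c ≠ ⊤ := by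
    rw [Ne, analyticOrderAt_eq_top]
    simpa only [sub_eq_zero] using hne
  obtain ⟨k, hk⟩ := ENat.ne_top_iff_exists.1 htop
  -- The order `k` of L(u) - u is p + 1, and a is the leading coefficient; derivative 1 excludes k =
  -- 1.
  obtain ⟨g, hg, hg0, hgE⟩ := hE.analyticOrderAt_eq_natCast.1 hk.symm
  simp only [smul_eq_mul] at hgE
  have hk2 : 2 ≤ k := by
    by_contra hlt
    have hval := hgE.self_of_nhds
    rw [hc, sub_self] at hval
    obtain rfl | rfl : k = 0 ∨ k = 1 := by omega
    · simp only [pow_zero, one_mul] at hval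
      exact hg0 hval.symm
    · have h1 : HasDerivAt (fun u => L u - u) (1 - 1) c :=
        (hd ▸ hL.differentiableAt.hasDerivAt).sub (hasDerivAt_id c)
      have h2 : HasDerivAt (fun u => (u - c) ^ 1 * g u) (1 * g c + (c - c) ^ 1 * deriv g c) c := by
        have h3 : HasDerivAt (fun u => (u - c) ^ 1) 1 c := by
          simpa using (hasDerivAt_id c).sub_const c
        exact h3.mul hg.differentiableAt.hasDerivAt
      have h4 := h1.unique (h2.congr_of_eventuallyEq hgE)
      simp at h4
      exact hg0 h4.symm
  refine ⟨k - 1, by omega, g c, hg0, ?_⟩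
  have e1 : k - 1 + 1 = k := by omega
  have e2 : k - 1 + 2 = k + 1 := by omega
  rw [e1, e2]
  have h1 : (fun u => g u - g c) =O[𝓝 c] fun u => u - c := hg.differentiableAt.isBigO_sub
  have h2 : (fun u => (u - c) ^ k * (g u - g c)) =O[𝓝 c] fun u => (u - c) ^ k * (u - c) :=
    (Asymptotics.isBigO_refl _ _).mul h1
  refine (h2.congr' ?_ ?_)
  · filter_upwards [hgE] with u hu
    linear_combination -hu
  · exact Eventually.of_forall fun u => (pow_succ _ _).symm

theorem isConf_false_iff {f : RiemannSphere → RiemannSphere} {z : RiemannSphere} :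
    IsConf false f z ↔ IsHolAt f z := by
  simpa using isConf_iff (b := false) (f := f) (z := z)

/-- The infimum defining the exponent is attained once its set is nonempty. Parabolicity is
witnessed by a branch `f` of some F^q', not of F^q with `q` the period; but T^q' and f^q are the
same germ, so an iterate of `T` is tangent to the identity, and local attraction keeps it from being
the identity. -/
theorem Setting.exists_parabolicExponent (h : F.Setting S x) (hattr : F.LocallyAttracting x)
    {ω : RiemannSphere} (hω : ω ∈ F.parabolicSet x) :
    1 ≤ F.period ω ∧ 1 ≤ F.parabolicExponent ω ∧ ∃ T, F.IsBranchFixing (F.period ω) T ω ∧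
      ∃ n ≥ 1, IsHolAt T^[n] ω ∧ ∃ a : ℂ, a ≠ 0 ∧
        (fun u => localRep T^[n] ω u - (u + a * (u - chart ω ω) ^ (F.parabolicExponent ω + 1)))
          =O[𝓝 (chart ω ω)] fun u => (u - chart ω ω) ^ (F.parabolicExponent ω + 2) := by
  obtain ⟨q', hq', f, hf, n, hn, hol, hd⟩ := hω.2
  have hωS := limitSet_subset h.isClosed h.inverseLike h.mem hω.1
  have hmem : ω ∈ F.iter q' ω := by
    have hf' := isBranchFixing_iff.1 hf
    have := hf'.1.1.self_of_nhds
    rwa [hf'.2] at this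
  obtain ⟨hq, hωq⟩ : 1 ≤ F.period ω ∧ ω ∈ F.iter (F.period ω) ω :=
    Nat.sInf_mem (s := {q | 1 ≤ q ∧ ω ∈ F.iter q ω}) ⟨q', hq', hmem⟩
  refine ⟨hq, ?_⟩
  set q := F.period ω
  refine Nat.sInf_mem (s := {p | 1 ≤ p ∧ ∃ T, F.IsBranchFixing (F.period ω) T ω ∧
    ∃ n ≥ 1, IsHolAt T^[n] ω ∧ ∃ a : ℂ, a ≠ 0 ∧
      (fun u => localRep T^[n] ω u - (u + a * (u - chart ω ω) ^ (p + 1)))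
        =O[𝓝 (chart ω ω)] fun u => (u - chart ω ω) ^ (p + 2)}) ?_
  obtain ⟨T, hT, hTω⟩ := h.exists_isBranchAt_iter hωS hω.1 hωq
  have hTfix : F.IsBranchFixing q T ω := isBranchFixing_iff.2 ⟨hT, hTω⟩
  have hfω : f ω = ω := hf.2
  have heq : T^[q' * n] =ᶠ[𝓝 ω] (f^[n])^[q] := by
    have h1 : T^[q'] =ᶠ[𝓝 ω] f^[q] := h.eventuallyEq_of_fixing hω.1 (hTfix.iterate q')
      (mul_comm q' q ▸ hf.iterate q)
    have h2 := iterate_eventuallyEq (isBranchFixing_iff.1 (hTfix.iterate q')).1.2.continuousAt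
      (hTfix.iterate q').2 h1 n
    rw [← Function.iterate_mul f n q, Nat.mul_comm n q, Function.iterate_mul, Function.iterate_mul]
    exact h2
  have hfnω : f^[n] ω = ω := Function.iterate_fixed hfω n
  obtain ⟨hconf, hderiv⟩ := deriv_localRep_iterate (isConf_false_iff.2 hol) hfnω hd q
  have hconfT : IsConf false T^[q' * n] ω := hconf.congr heq.symm
  have hM := hTfix.iterate (q' * n)
  have hderivT : deriv (localRep T^[q' * n] ω) (chart ω ω) = 1 := by
    rw [← hderiv]
    refine EventuallyEq.deriv_eq ?_
    filter_upwards [eventually_nhds_param.1 (show ∀ᶠ z in 𝓝 (param ω (chart ω ω)),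
      T^[q' * n] z = (f^[n])^[q] z by rw [param_chart_self]; exact heq)] with s hs
    rw [localRep, localRep, hs, hM.2, Function.iterate_fixed hfnω q]
  have hne : ¬ ∀ᶠ u in 𝓝 (chart ω ω), localRep T^[q' * n] ω u = u := by
    intro hid
    have hid' : T^[q' * n] =ᶠ[𝓝 ω] id := by
      rw [← param_chart_self ω]
      refine eventually_nhds_param.2 ?_
      filter_upwards [hid, hconfT.self_rep.2] with s h1 h2
      rw [h2, h1, hM.2]; rfl
    refine hattr.not_eventuallyEq_id hω (q := q * (q' * n))
      (Nat.one_le_iff_ne_zero.2 (by positivity)) hM ?_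
    exact iterate_eventuallyEq hconfT.continuousAt hM.2 hid' 2
  obtain ⟨p, hp, a, ha, hO⟩ := exists_tangent_expansion
    (L := localRep T^[q' * n] ω) (c := chart ω ω) hconfT.self_rep.1
    (localRep_chart_self hM.2) hderivT hne
  exact ⟨p, hp, T, hTfix, q' * n, Nat.one_le_iff_ne_zero.2 (by positivity),
    isConf_false_iff.1 hconfT, a, ha, hO⟩

theorem parabolicBound_lt_iff {ω : RiemannSphere} {e : ℝ≥0∞} (he : e < ⊤) :
    F.parabolicBound ω < e ↔
      (F.parabolicExponent ω : ℝ) / (F.parabolicExponent ω + 1) < e.toReal := by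
  have h : F.parabolicBound ω =
      ENNReal.ofReal ((F.parabolicExponent ω : ℝ) / (F.parabolicExponent ω + 1)) := by
    rw [parabolicBound, ENNReal.ofReal_div_of_pos (by positivity),
      ENNReal.ofReal_add (by positivity) zero_le_one, ENNReal.ofReal_natCast, ENNReal.ofReal_one]
  rw [h, ENNReal.ofReal_lt_iff_lt_toReal (by positivity) he.ne]

theorem Setting.small_of_mem_parabolicSet (h : F.Setting S x) (hattr : F.LocallyAttracting x)
    {U : Set RiemannSphere} (hU : F.IsBranchDomain x U) {t : ℝ → ℕ → ℝ}
    (ht : F.GoodScheme x U (F.critExp x).toReal t) {ω : RiemannSphere}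
    (hω : ω ∈ F.parabolicSet x) (hlt : F.parabolicBound ω < F.critExp x)
    (hfin : F.critExp x < ⊤) : F.Small x U (F.critExp x).toReal t ω := by
  obtain ⟨hq, hp, T, hT, n, hn, hol, a, ha, hO⟩ := h.exists_parabolicExponent hattr hω
  obtain ⟨t₀, ht₀, ht₁⟩ := exists_between ((parabolicBound_lt_iff hfin).1 hlt)
  have hTn := isBranchFixing_iff.1 (hT.iterate n)
  exact h.small_of_contractsAt hU ht hω.1 (Nat.one_le_iff_ne_zero.2 (by positivity)) hTn.1 hTn.2
    (lt_of_le_of_lt (by positivity) ht₀) ht₁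
    (contractsAt_of_parabolic (isConf_false_iff.2 hol) hTn.2 hp ha hO ht₀)

theorem exists_fixing_of_isAttracting_or_isRepelling {y : RiemannSphere}
    (hy : F.IsAttracting y ∨ F.IsRepelling y) :
    ∃ q ≥ 1, ∃ f, F.IsBranchAt q f y ∧ f y = y ∧ ∀ t₀ > 0, ContractsAt f y t₀ := by
  rcases hy with ⟨q, hq, f, hf, hd⟩ | ⟨q, hq, f, hf, hd⟩
  · rw [isBranchFixing_iff] at hf
    exact ⟨q, hq, f, hf.1, hf.2, fun t₀ ht₀ => contractsAt_of_lt_one hf.1.2 hd ht₀⟩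
  · rw [isBranchFixing_iff] at hf
    exact ⟨q, hq, f, hf.1, hf.2, fun t₀ ht₀ => contractsAt_of_one_lt hf.1.2 hf.2 hd ht₀⟩

end Parabolic

end Correspondence

end

/-! ### The proposition -/

theorem mainTheorem7 (F : Correspondence) (S : Set RiemannSphere) (hS : IsClosed S)
    (hF : F.InvariantlyInverseLike S) (x : RiemannSphere) (hx : x ∈ S)
    (hsing : F.limitSet x ∩ F.singularSet = ∅) (hattr : F.LocallyAttracting x) :
    (∀ ω ∈ F.parabolicSet x, F.parabolicBound ω < F.critExp x → F.critExp x < ⊤ →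
      ∀ μ : ProbabilityMeasure RiemannSphere, F.IsLimitMeasure x μ →
        (μ : Measure RiemannSphere) {ω} = 0 ∧
        (μ : Measure RiemannSphere) (F.orbit ω) = 0 ∧
        ∀ y, F.IsAttracting y ∨ F.IsRepelling y →
          (μ : Measure RiemannSphere) {y} = 0 ∧
          (y ∈ S → (μ : Measure RiemannSphere) (F.orbit y) = 0)) ∧
    (F.parabolicBoundSup x < F.critExp x → F.critExp x < ⊤ →
      ∀ μ : ProbabilityMeasure RiemannSphere, F.IsLimitMeasure x μ →
        (μ : Measure RiemannSphere) (F.parabolicSet x) = 0) := by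
  have h : F.Setting S x := ⟨hS, hF, hx, hsing⟩
  refine ⟨fun ω hω hlt hfin μ hμ => ?_, fun hlt hfin μ hμ => ?_⟩
  -- The strict lower bound also yields δ > 0.
  · obtain ⟨U, t, hU, ht, hsmall, hcompl⟩ := hμ.exists_small (bot_le.trans_lt hlt) hfin
    have hωs := h.small_of_mem_parabolicSet hattr hU ht hω hlt hfin
    refine ⟨hsmall ω hωs, ?_, fun y hy => ?_⟩
    · obtain ⟨q, hq, f, hf, -⟩ := hω.2
      have hf' := Correspondence.isBranchFixing_iff.1 hf
      have hmem := hf'.1.1.self_of_nhds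
      rw [hf'.2] at hmem
      exact h.measure_orbit_eq_zero hU ht hsmall hcompl
        (Correspondence.limitSet_subset hS hF hx hω.1) hq hmem fun _ => hωs
    · obtain ⟨q, hq, f, hf, hfy, hc⟩ :=
        Correspondence.exists_fixing_of_isAttracting_or_isRepelling hy
      have hδ := ht.pos
      have hys : y ∈ F.limitSet x → F.Small x U (F.critExp x).toReal t y := fun hyL =>
        -- Attracting and repelling points contract with every positive exponent, so any number in
        -- (0, δ) would do.
        h.small_of_contractsAt hU ht hyL hq hf hfy (half_pos hδ) (half_lt_self hδ)
          (hc _ (half_pos hδ))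
      refine ⟨?_, fun hyS => ?_⟩
      · by_cases hyL : y ∈ F.limitSet x
        · exact hsmall y (hys hyL)
        · exact measure_mono_null (Set.singleton_subset_iff.2 hyL) hcompl
      · have hmem := hf.1.self_of_nhds
        rw [hfy] at hmem
        exact h.measure_orbit_eq_zero hU ht hsmall hcompl hyS hq hmem hys
  · obtain ⟨U, t, hU, ht, hsmall, -⟩ := hμ.exists_small (bot_le.trans_lt hlt) hfin
    refine Correspondence.measure_eq_zero_of_countable (h.countable_parabolicSet hattr)
      fun ω hω => ?_
    refine hsmall ω (h.small_of_mem_parabolicSet hattr hU ht hω (lt_of_le_of_lt ?_ hlt) hfin)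
    exact le_iSup₂ (f := fun ω (_ : ω ∈ F.parabolicSet x) => F.parabolicBound ω) ω hω
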